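/- **Proposition (structure of $X$, parts (i) and (ii)).** Let $Q=\{([x],[y])\in\mathbb P^3\times\mathbb P^3 : \sum_{i=0}^3 x_iy_i=0\}$ (over $\mathbb C$; this quadric is $\mathbb P(T^*\mathbb P^3)$), let $\sigma(z_0,z_1,z_2,z_3)=(-\bar z_1,\bar z_0,-\bar z_3,\bar z_2)$ and let $\tau([x],[y])=([\sigma(x)],[\sigma(y)])$. A line in $Q$ is a curve $\zeta\mapsto([a+b\zeta],[c+d\zeta])$, $\zeta\in\mathbb P^1$, contained in $Q$, with $a,b\in\mathbb C^4$ linearly independent and $c,d\in\mathbb C^4$ linearly independent. Let $X$ be the set of $\tau$-invariant lines in $Q$, let $X^{\circ}\subset X$ be the set of lines $l$ whose normal bundle satisfies $N_{l/Q}\simeq\mathcal O(1)^{\oplus 4}$, and let $X_\infty=X\setminus X^{\circ}$. Then $X$ is a smooth ($8$-dimensional) manifold, as the quotient of the manifold of pairs $(x,y)$ with $x,y\in\mathbb C^4\setminus\{0\}$, $x\cdot y=0$, $x\cdot\sigma(y)+\sigma(x)\cdot y=0$ by the submersion that sends $(x,y)$ to the line $\zeta\mapsto([x+\zeta\sigma(x)],[y+\zeta\sigma(y)])$.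 Identify the manifold of $\sigma$-invariant lines in $\mathbb P^3$ with the unit sphere $S^4\subset\mathbb H\times\mathbb R$ by sending the line through $[z]$ to $$h(z)=\frac{\bigl(2\bar q_1q_0,\ |q_0|^2-|q_1|^2\bigr)}{|q_0|^2+|q_1|^2},\qquad q_0=z_0+z_1j,\quad q_1=z_2+z_3j .$$ The two projections $Q\to\mathbb P^3$ then induce two projections $\pi_1,\pi_2:X\to S^4$, where $\pi_1(l)=h(x)$ and $\pi_2(l)=h(\bar y)$ for every point $([x],[y])$ of $l$. * (i) The map $(\pi_1,\pi_2):X\to S^4\times S^4$ is the real (non-oriented) blow-up of $S^4\times S^4$ along the antidiagonal $\{(p,-p) : p\in S^4\}$. The set $X_\infty$ is its exceptional divisor, that is, the preimage of the antidiagonal, and $X_\infty$ is diffeomorphic, over $S^4$, to the projectivized cotangent bundle $\mathbb P(T^*S^4)$. * (ii) With respect to either of the projections $\pi_1,\pi_2:X\to S^4$, $X$ is an $\mathbb{R}P^4$-bundle over $S^4$; more precisely, it is diffeomorphic over $S^4$ to $\mathbb P(T^*S^4\oplus\mathbb R)$, where $\mathbb R$ denotes the trivial line bundle. -/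

import Mathlib

open scoped Manifold ContDiff Topology LinearAlgebra.Projectivization Matrix Bundle

noncomputable section

namespace TwistorLines

/-! ### Lines in the quadric, and the real structure -/

/-- The complex vector space `ℂ⁴`. -/
abbrev C4 : Type := Fin 4 → ℂ

/-- Complex projective three-space. -/
abbrev P3 : Type := ℙ ℂ C4

/-- The quaternionic structure `σ(z₀,z₁,z₂,z₃) = (-z̄₁, z̄₀, -z̄₃, z̄₂)` on `ℂ⁴`. -/
def sigma : C4 →ₛₗ[starRingEnd ℂ] C4 where
  toFun z := ![-star (z 1), star (z 0), -star (z 3), star (z 2)]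
  map_add' z w := by
    ext i; fin_cases i <;> simp [add_comm]
  map_smul' c z := by
    ext i; fin_cases i <;> simp

theorem sigma_injective : Function.Injective sigma := by
  intro z w h
  have h0 := congrFun h 0
  have h1 := congrFun h 1
  have h2 := congrFun h 2
  have h3 := congrFun h 3
  simp only [sigma, LinearMap.coe_mk, AddHom.coe_mk, Matrix.cons_val, neg_inj, star_inj]
    at h0 h1 h2 h3
  ext i; fin_cases i
  exacts [h1, h0, h3, h2]

/-- The antiholomorphic involution `τ([x],[y]) = ([σ x],[σ y])` of `P³ × P³`. -/
def tau : P3 × P3 → P3 × P3 :=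
  Prod.map (Projectivization.map sigma sigma_injective)
    (Projectivization.map sigma sigma_injective)

/-- The quadric `Q = {([x],[y]) | ∑ xᵢ yᵢ = 0} ⊆ P³ × P³`, which is `P(T*P³)`. -/
def quadric : Set (P3 × P3) := {p | p.1.rep ⬝ᵥ p.2.rep = 0}

/-- The image of `P¹ → P³ × P³`, `[u] ↦ ([A u],[C u])`, for `A C : ℂ² → ℂ⁴` linear. -/
def lineSet (A C : (Fin 2 → ℂ) →ₗ[ℂ] C4) : Set (P3 × P3) :=
  {p | ∃ (u : Fin 2 → ℂ) (hA : A u ≠ 0) (hC : C u ≠ 0),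
    p = (Projectivization.mk ℂ (A u) hA, Projectivization.mk ℂ (C u) hC)}

/-- A `τ`-invariant line in `Q`: a curve `ζ ↦ ([a + bζ],[c + dζ])` (with `a, b` independent and
`c, d` independent) that lies in `Q` and is mapped to itself by `τ`. The type `RealLine` is the
set `X` of all of them. -/
@[ext]
structure RealLine where
  carrier : Set (P3 × P3)
  isLine : ∃ A C : (Fin 2 → ℂ) →ₗ[ℂ] C4,
    Function.Injective A ∧ Function.Injective C ∧ carrier = lineSet A C
  subset_quadric : carrier ⊆ quadric
  tau_invariant : tau '' carrier = carrier

/-! ### The normal bundle of a line in the quadric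

Holomorphic bundles on `P¹` are written in homogeneous coordinates `u ∈ ℂ² ∖ {0}`, as bundles on
`ℂ² ∖ {0}` together with an identification of the fibres over `u` and `c u`. -/

/-- The tangent space at `(A u, C u)` to the affine bicone `{(x, y) | x ⬝ y = 0}` over `Q`. -/
def coneTangentQuadric (A C : (Fin 2 → ℂ) →ₗ[ℂ] C4) (u : Fin 2 → ℂ) : Submodule ℂ (C4 × C4) where
  carrier := {v | v.1 ⬝ᵥ C u + A u ⬝ᵥ v.2 = 0}
  zero_mem' := by simp
  add_mem' := by
    intro v w hv hw
    simp only [Set.mem_ofPred_eq, Prod.fst_add, Prod.snd_add, add_dotProduct,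
      dotProduct_add] at *
    linear_combination hv + hw
  smul_mem' := by
    intro c v hv
    simp only [Set.mem_ofPred_eq, Prod.smul_fst, Prod.smul_snd, smul_dotProduct,
      dotProduct_smul, smul_eq_mul] at *
    linear_combination c * hv

/-- The tangent space at `(A u, C u)` to the affine bicone `{(λ A u, μ C u)}` over the line. It
is spanned by the derivatives `(A u', C u')` of the parametrization and by the two vertical
directions `(A u, 0)` and `(0, C u)`. -/
def coneTangentLine (A C : (Fin 2 → ℂ) →ₗ[ℂ] C4) (u : Fin 2 → ℂ) : Submodule ℂ (C4 × C4) :=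
  LinearMap.range (A.prod C) ⊔ Submodule.span ℂ {(A u, 0), (0, C u)}

/-- The fibre `T Q / T l` of the normal bundle `N_{l/Q}` at the point `([A u],[C u])` of the line
`l`; the vertical directions of the two bicones cancel in the quotient. The class of `v` at `u`
and the class of `c v` at `c u` are the same normal vector of `l`. -/
abbrev NormalFibre (A C : (Fin 2 → ℂ) →ₗ[ℂ] C4) (u : Fin 2 → ℂ) : Type :=
  coneTangentQuadric A C u ⧸ (coneTangentLine A C u).submoduleOf (coneTangentQuadric A C u)

/-- `N_{l/Q} ≃ O(k₀) ⊕ ⋯ ⊕ O(k₃)` as holomorphic vector bundles on `l`, where the total space of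
`O(k)` is `(ℂ² ∖ {0}) × ℂ` modulo `(u, z) ∼ (c u, cᵏ z)`: there are linear isomorphisms `Φ u` of
the fibres that respect the identifications along `u ↦ c u` and depend holomorphically on `u`. -/
def NormalBundleIso (A C : (Fin 2 → ℂ) →ₗ[ℂ] C4) (k : Fin 4 → ℤ) : Prop :=
  ∃ Φ : (u : Fin 2 → ℂ) → (NormalFibre A C u →ₗ[ℂ] (Fin 4 → ℂ)),
    (∀ u, u ≠ 0 → Function.Bijective (Φ u)) ∧
    (∀ (c : ℂ) (u : Fin 2 → ℂ), c ≠ 0 → u ≠ 0 →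
      ∀ (v : C4 × C4) (hv : v ∈ coneTangentQuadric A C u)
        (hcv : c • v ∈ coneTangentQuadric A C (c • u)) (i : Fin 4),
        Φ (c • u) (Submodule.Quotient.mk ⟨c • v, hcv⟩) i
          = c ^ k i * Φ u (Submodule.Quotient.mk ⟨v, hv⟩) i) ∧
    (∀ u₀, u₀ ≠ 0 → ∃ Ψ : (Fin 2 → ℂ) → (C4 × C4 →L[ℂ] (Fin 4 → ℂ)), AnalyticAt ℂ Ψ u₀ ∧
      ∀ᶠ u in 𝓝 u₀, ∀ (v : C4 × C4) (hv : v ∈ coneTangentQuadric A C u),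
        Φ u (Submodule.Quotient.mk ⟨v, hv⟩) = Ψ u v)

/-- `X°`: the `τ`-invariant lines `l` with `N_{l/Q} ≃ O(1)⁴`. -/
def generalLines : Set RealLine :=
  {l | ∃ A C : (Fin 2 → ℂ) →ₗ[ℂ] C4, Function.Injective A ∧ Function.Injective C ∧
    l.carrier = lineSet A C ∧ NormalBundleIso A C (fun _ => 1)}

/-- `X_∞ = X ∖ X°`. -/
def specialLines : Set RealLine := generalLinesᶜ

/-! ### The parametrization of the real lines -/

/-- The linear map `(s, t) ↦ s x + t σ(x)`. -/
def realPencil (x : C4) : (Fin 2 → ℂ) →ₗ[ℂ] C4 :=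
  (LinearMap.proj 0).smulRight x + (LinearMap.proj 1).smulRight (sigma x)

/-- The pairs `(x, y)` for which `ζ ↦ ([x + ζ σ(x)],[y + ζ σ(y)])` is a line in `Q`; a closed
submanifold of the open set `x ≠ 0, y ≠ 0`. -/
def realParams : Set (C4 × C4) :=
  {p | p.1 ≠ 0 ∧ p.2 ≠ 0 ∧ p.1 ⬝ᵥ p.2 = 0 ∧ p.1 ⬝ᵥ sigma p.2 + sigma p.1 ⬝ᵥ p.2 = 0}

/-! ### Quotient manifolds, projectivized bundles, real blow-ups -/

section Manifolds

variable {EN HN N EY HY Y : Type*}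
  [NormedAddCommGroup EN] [NormedSpace ℝ EN] [TopologicalSpace HN]
  [TopologicalSpace N] [ChartedSpace HN N]
  [NormedAddCommGroup EY] [NormedSpace ℝ EY] [TopologicalSpace HY]
  [TopologicalSpace Y] [ChartedSpace HY Y]

/-- `q : S → T` is a smooth surjective submersion, for submanifolds `S ⊆ N` and `T ⊆ Y` (open or
not): it is smooth and onto, and through every point of `S` passes a smooth local section. This
says that `T` is the quotient manifold of `S` by the relation `q s = q s'`; in particular it
determines the topology and the smooth structure of `T`. -/
structure IsSubmersionOnto (IN : ModelWithCorners ℝ EN HN) (IY : ModelWithCorners ℝ EY HY)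
    (S : Set N) (T : Set Y) (q : S → Y) : Prop where
  range_eq : Set.range q = T
  smooth : ∃ g : N → Y, ContMDiffOn IN IY ∞ g S ∧ ∀ s : S, g s = q s
  sections : ∀ s : S, ∃ (U : Set Y) (r : Y → N), IsOpen U ∧ q s ∈ U ∧
    ContMDiffOn IY IN ∞ r (U ∩ T) ∧ r (q s) = s ∧
    ∀ y ∈ U ∩ T, ∃ h : r y ∈ S, q ⟨r y, h⟩ = y

/-- The projectivization `P(E)` of a real vector bundle: the lines through `0` in its fibres. -/
abbrev ProjBundle {B : Type*} (E : B → Type*) [∀ b, AddCommGroup (E b)] [∀ b, Module ℝ (E b)] :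
    Type _ := Σ b, ℙ ℝ (E b)

/-- `f` is a diffeomorphism of `P(E)`, with its smooth structure as the quotient
`(E ∖ 0) / ℝ*` of the nonzero vectors, onto the submanifold `T` of `Y`. -/
def IsProjBundleDiffeo {B EB HB F : Type*} [NormedAddCommGroup EB] [NormedSpace ℝ EB]
    [TopologicalSpace HB] (IB : ModelWithCorners ℝ EB HB) [TopologicalSpace B] [ChartedSpace HB B]
    [NormedAddCommGroup F] [NormedSpace ℝ F]
    (E : B → Type*) [∀ b, AddCommGroup (E b)] [∀ b, Module ℝ (E b)]
    [TopologicalSpace (Bundle.TotalSpace F E)] [∀ b, TopologicalSpace (E b)] [FiberBundle F E]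
    (IY : ModelWithCorners ℝ EY HY) (T : Set Y) (f : ProjBundle E → Y) : Prop :=
  Function.Injective f ∧
  IsSubmersionOnto (IB.prod 𝓘(ℝ, F)) IY {v : Bundle.TotalSpace F E | v.2 ≠ 0} T
    (fun v => f ⟨v.1.1, Projectivization.mk ℝ v.1.2 v.2⟩)

/-- `p : Y → N` is a smooth fibre bundle with fibre `ℝPⁿ = (ℝⁿ⁺¹ ∖ 0) / ℝ*`: over a neighbourhood
`U` of each point, `p⁻¹(U)` is `U × ℝPⁿ`. -/
def IsRealProjectiveSpaceBundle (IN : ModelWithCorners ℝ EN HN) (IY : ModelWithCorners ℝ EY HY)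
    (n : ℕ) (p : Y → N) : Prop :=
  ∀ b : N, ∃ U : Set N, IsOpen U ∧ b ∈ U ∧
    ∃ q : {w : N × EuclideanSpace ℝ (Fin (n + 1)) | w.1 ∈ U ∧ w.2 ≠ 0} → Y,
      IsSubmersionOnto (IN.prod 𝓘(ℝ, EuclideanSpace ℝ (Fin (n + 1)))) IY _ (p ⁻¹' U) q ∧
      (∀ w, p (q w) = w.1.1) ∧
      ∀ w w', q w = q w' ↔ w.1.1 = w'.1.1 ∧ ∃ s : ℝ, s ≠ 0 ∧ w'.1.2 = s • w.1.2

/-- `p : Y → N` is the real (non-oriented) blow-up of `N` along the submanifold `Z` of dimension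
`d` and codimension `c`. Away from `Z`, `p` is a diffeomorphism. Around each point of `Z` there
is a chart `φ` with values `(a, x) ∈ ℝᵈ × ℝᶜ` in which `Z` is `x = 0` and in which `p` is the
projection `(a, x, ℓ) ↦ (a, x)` of `{(a, x, ℓ) ∈ ℝᵈ × ℝᶜ × P(ℝᶜ) | x ∈ ℓ}`. The latter manifold is
the quotient of the set of `(a, t, v)` with `v ≠ 0`, which stand for `(a, t v, [v])`, by
`(a, s t, v) ∼ (a, t, s v)` for `s ∈ ℝ*`. -/
def IsRealBlowUp (IN : ModelWithCorners ℝ EN HN) (IY : ModelWithCorners ℝ EY HY)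
    (d c : ℕ) (p : Y → N) (Z : Set N) : Prop :=
  ContMDiff IY IN ∞ p ∧
  Set.BijOn p (p ⁻¹' Zᶜ) Zᶜ ∧
  (∀ y, p y ∉ Z → IsLocalDiffeomorphAt IY IN ∞ p y) ∧
  ∀ z ∈ Z, ∃ φ : PartialDiffeomorph IN 𝓘(ℝ, EuclideanSpace ℝ (Fin d) × EuclideanSpace ℝ (Fin c))
      N (EuclideanSpace ℝ (Fin d) × EuclideanSpace ℝ (Fin c)) ∞,
    z ∈ φ.source ∧ (∀ m ∈ φ.source, m ∈ Z ↔ (φ m).2 = 0) ∧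
    ∃ q : {w : EuclideanSpace ℝ (Fin d) × ℝ × EuclideanSpace ℝ (Fin c) |
        w.2.2 ≠ 0 ∧ (w.1, w.2.1 • w.2.2) ∈ φ.target} → Y,
      IsSubmersionOnto
        𝓘(ℝ, EuclideanSpace ℝ (Fin d) × ℝ × EuclideanSpace ℝ (Fin c)) IY _ (p ⁻¹' φ.source) q ∧
      (∀ w, φ (p (q w)) = (w.1.1, w.1.2.1 • w.1.2.2)) ∧
      ∀ w w', q w = q w' ↔
        w.1.1 = w'.1.1 ∧ ∃ s : ℝ, s ≠ 0 ∧ w'.1.2.2 = s • w.1.2.2 ∧ w.1.2.1 = s * w'.1.2.1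

end Manifolds

/-! ### The four-sphere -/

/-- The unit sphere `S⁴ ⊆ ℝ⁵`. -/
abbrev S4 : Type := Metric.sphere (0 : EuclideanSpace ℝ (Fin 5)) 1

/-- The twistor fibration `P³ → ℍP¹ = S⁴ ⊆ ℍ × ℝ` in homogeneous coordinates. With
`q₀ = z₀ + z₁ j` and `q₁ = z₂ + z₃ j` it is `(2 q̄₁ q₀, |q₀|² - |q₁|²) / (|q₀|² + |q₁|²)`, which
is the point of `S⁴ = ℍ ∪ {∞}` with stereographic coordinate `q₁⁻¹ q₀`. Its fibres are the
`σ`-invariant lines of `P³`, so that it identifies the manifold of these lines with `S⁴`. -/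
def hopf (z : C4) : EuclideanSpace ℝ (Fin 5) :=
  let a : ℂ := star (z 2) * z 0 + z 3 * star (z 1)
  let b : ℂ := star (z 2) * z 1 - z 3 * star (z 0)
  (‖z 0‖ ^ 2 + ‖z 1‖ ^ 2 + ‖z 2‖ ^ 2 + ‖z 3‖ ^ 2)⁻¹ •
    !₂[2 * a.re, 2 * a.im, 2 * b.re, 2 * b.im,
      ‖z 0‖ ^ 2 + ‖z 1‖ ^ 2 - ‖z 2‖ ^ 2 - ‖z 3‖ ^ 2]

/-- The cotangent bundle `T*S⁴`. -/
abbrev CotangentS4 (x : S4) : Type :=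
  TangentSpace (𝓡 4) x →L[ℝ] Bundle.Trivial S4 ℝ x

/-- The bundle `T*S⁴ ⊕ ℝ`. -/
abbrev CotangentSumS4 (x : S4) : Type :=
  (CotangentS4 ×ᵇ Bundle.Trivial S4 ℝ) x

end TwistorLines

end

/-!
The idea is to describe real lines by real data, by means of the spin representation of `ℝ⁵`.
Clifford multiplication `clifford n` by `n ∈ ℝ⁵` acts on `ℂ⁴` by hermitian operators with
`n² = |n|²`, which commute with `σ`. For `p ∈ S⁴` its `+1`-eigenspace is a `σ`-invariant plane, and
`p = hopf x` for all `x` in it (`hopf_eq_of_clifford_eq`, `clifford_hopf`). If `(x, y)` satisfies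
the two equations of `realParams`, there is a unique `n ∈ ℝ⁵ ∖ 0` with `y = J (n x)`, where `J` is
the conjugate of `σ` (`symp_clifford_pairVec`). So a real line is the same as a point `p ∈ S⁴` and
a line `ℝ n ⊆ ℝ⁵`: it consists of the points `([a], [J (n a)])` with `p a = a` (`exists_lineOf`,
`lineOf_eq_iff`). Thus `X = S⁴ × ℝP⁴`, as the quotient of `S⁴ × (ℝ⁵ ∖ 0)` by `ℝ*`, and this defines
the smooth structure of `X`. All submersions onto parts of `X` are found by lifting them to pairs
`(p, n)` (`isSubmersionOnto_of_lift`).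

In this description `π₁` maps `(p, [n])` to `p`. As `n p n⁻¹` fixes `n x` if `p` fixes `x`, `π₂`
maps `(p, [n])` to the reflection `p'` of `p` in the line `ℝ n` (`proj_eq_hopf`), and
`(p, n) ↦ (p', n)` is an involution that exchanges the two projections. This gives the two
projective bundles, since `n ↦ (⟨n, ·⟩, ⟨p, n⟩)` is an isomorphism of `ℝ⁵` with `T*_p S⁴ ⊕ ℝ`
(`isProjBundleDiffeo_of_lift`).

For the blow-up, if `p' ≠ -p` the line `ℝ n` that bisects `p` and `p'` is spanned by `p + p'`
(`complDiffeo`), while `p' = -p` if and only if `n ⊥ p`, that is, if `n` represents a covector at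
`p` (`reflect_eq_neg_iff`). Near the antidiagonal, take as coordinates `p` and the stereographic
projection `x ∈ p^⊥` of `p'` from `p`; if `n` has the component `ξ` in `p^⊥`, with `ξ ≠ 0`, then
`n = t |ξ|² p + ξ` for some `t`, and `x = t ξ` (`reflect_eq_stereoInv`). So `(p, x, [ξ])` are the
coordinates of a blow-up (`isRealBlowUp_proj`).

Finally, let `A u` and `C u` be the two components of the line of `(p, n)`. The pairing of `A u`
and `C u'` is a multiple of `⟨p, n⟩` times the wedge product of `u` and `u'`. If `⟨p, n⟩ ≠ 0`, the
ranges of `A` and `C` are dual to each other, and the constant quotient of `ℂ⁴ ⊕ ℂ⁴` by both of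
them identifies the normal bundle with `O(1)⁴` (`normalBundleIso_of_dotProduct_eq`). If
`⟨p, n⟩ = 0`, the constant vector `(A e₁, 0)` is tangent to the quadric along the whole line, and
defines a section of the normal bundle twisted by `O(-1)`; this section vanishes at `e₁`, but not
at `e₂`. A trivial bundle has no such section, by Liouville's theorem
(`not_normalBundleIso_of_dotProduct_eq_zero`).
-/

noncomputable section

namespace TwistorLines

/-! ### Clifford multiplication on `ℂ⁴` -/

/-- Euclidean five-space, in which `S⁴` is the unit sphere. -/
abbrev E5 : Type := EuclideanSpace ℝ (Fin 5)

/-- Clifford multiplication by `n ∈ ℝ⁵`. With `a = n₀ + n₁ i` and `b = n₂ + n₃ i` it is the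
hermitian matrix with the blocks `n₄`, `-n₄` on the diagonal and `((a, -b̄), (b, ā))` and its
adjoint off it. The signs are chosen such that it commutes with `σ` and that `hopf x` is the vector
of `S⁴` that fixes `x`. -/
def clifford (n : E5) : C4 →ₗ[ℂ] C4 where
  toFun z :=
    let a : ℂ := n 0 + n 1 * Complex.I
    let b : ℂ := n 2 + n 3 * Complex.I
    ![n 4 * z 0 + a * z 2 - star b * z 3, n 4 * z 1 + b * z 2 + star a * z 3,
      star a * z 0 + star b * z 1 - n 4 * z 2, -(b * z 0) + a * z 1 - n 4 * z 3]
  map_add' z w := by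
    ext i; fin_cases i <;> simp <;> ring
  map_smul' c z := by
    ext i; fin_cases i <;> simp <;> ring

/-- The matrix of the symplectic form `(x, y) ↦ x ⬝ᵥ symp y` on `ℂ⁴`, which is the complex
conjugate of `σ`. -/
def symp : C4 →ₗ[ℂ] C4 where
  toFun z := ![-z 1, z 0, -z 3, z 2]
  map_add' z w := by
    ext i; fin_cases i <;> simp [add_comm]
  map_smul' c z := by
    ext i; fin_cases i <;> simp

/-- The square of the hermitian norm; the norm of `C4` itself is the supremum norm. -/
def normSq4 (z : C4) : ℝ := ‖z 0‖ ^ 2 + ‖z 1‖ ^ 2 + ‖z 2‖ ^ 2 + ‖z 3‖ ^ 2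

theorem inner_E5 (m n : E5) :
    inner ℝ m n = m 0 * n 0 + m 1 * n 1 + m 2 * n 2 + m 3 * n 3 + m 4 * n 4 := by
  simp [PiLp.inner_apply, Fin.sum_univ_five]; ring

theorem normSq4_pos {z : C4} (hz : z ≠ 0) : 0 < normSq4 z := by
  by_contra! h
  have h0 := sq_nonneg ‖z 0‖
  have h1 := sq_nonneg ‖z 1‖
  have h2 := sq_nonneg ‖z 2‖
  have h3 := sq_nonneg ‖z 3‖
  unfold normSq4 at h
  refine hz (funext fun i => ?_)
  fin_cases i <;> simp only [Fin.zero_eta, Fin.mk_one, Fin.reduceFinMk, Pi.zero_apply] <;>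
    refine norm_eq_zero.1 (pow_eq_zero_iff two_ne_zero |>.1 ?_) <;> linarith

theorem norm_sq_cast (w : ℂ) : ((‖w‖ : ℂ)) ^ 2 = w * star w := by
  simpa using (Complex.mul_conj' w).symm

theorem normSq4_cast (z : C4) :
    (normSq4 z : ℂ) =
      z 0 * star (z 0) + z 1 * star (z 1) + z 2 * star (z 2) + z 3 * star (z 3) := by
  unfold normSq4
  push_cast
  simp only [norm_sq_cast]

theorem clifford_clifford (m n : E5) (x : C4) :
    clifford m (clifford n x) + clifford n (clifford m x) = ((2 * inner ℝ m n : ℝ) : ℂ) • x := by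
  have hI := Complex.I_sq
  ext i
  rw [inner_E5]
  fin_cases i <;> simp [clifford] <;> ring_nf <;> simp only [hI] <;> ring

theorem clifford_self (n : E5) (x : C4) :
    clifford n (clifford n x) = ((‖n‖ ^ 2 : ℝ) : ℂ) • x := by
  have h := clifford_clifford n n x
  rw [real_inner_self_eq_norm_sq, ← two_smul ℂ, Complex.ofReal_mul, mul_smul] at h
  exact smul_right_injective _ (two_ne_zero (α := ℂ)) (by simpa using h)

theorem clifford_add (m n : E5) (x : C4) :
    clifford (m + n) x = clifford m x + clifford n x := by
  ext i; fin_cases i <;> simp [clifford] <;> ring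

theorem clifford_smul (r : ℝ) (n : E5) (x : C4) :
    clifford (r • n) x = (r : ℂ) • clifford n x := by
  ext i; fin_cases i <;> simp [clifford] <;> ring

theorem clifford_sigma (n : E5) (x : C4) : clifford n (sigma x) = sigma (clifford n x) := by
  ext i; fin_cases i <;> simp [clifford, sigma] <;> ring

theorem clifford_symm (n : E5) (x y : C4) :
    star (clifford n x) ⬝ᵥ y = star x ⬝ᵥ clifford n y := by
  simp [clifford, dotProduct, Fin.sum_univ_four]; ring

theorem sigma_sigma (x : C4) : sigma (sigma x) = -x := by
  ext i; fin_cases i <;> simp [sigma]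

theorem star_symp (x : C4) : star (symp x) = sigma x := by
  ext i; fin_cases i <;> simp [sigma, symp]

theorem symp_sigma (x : C4) : symp (sigma x) = sigma (symp x) := by
  ext i; fin_cases i <;> simp [sigma, symp]

theorem symp_symp (x : C4) : symp (symp x) = -x := by
  ext i; fin_cases i <;> simp [symp]

theorem re_cast (a : ℂ) : (a.re : ℂ) = (a + star a) / 2 := by
  simp [Complex.re_eq_add_conj]

/-- The Hopf map `x ↦ hopf x` is the moment map of Clifford multiplication. -/
theorem star_dot_clifford (n : E5) (x : C4) :
    star x ⬝ᵥ clifford n x = ((normSq4 x * inner ℝ n (hopf x) : ℝ) : ℂ) := by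
  rcases eq_or_ne x 0 with rfl | hx
  · simp [normSq4]
  have h := (normSq4_pos hx).ne'
  have key : normSq4 x * inner ℝ n (hopf x) =
      n 0 * (2 * (star (x 2) * x 0 + x 3 * star (x 1)).re) +
      n 1 * (2 * (star (x 2) * x 0 + x 3 * star (x 1)).im) +
      n 2 * (2 * (star (x 2) * x 1 - x 3 * star (x 0)).re) +
      n 3 * (2 * (star (x 2) * x 1 - x 3 * star (x 0)).im) +
      n 4 * (‖x 0‖ ^ 2 + ‖x 1‖ ^ 2 - ‖x 2‖ ^ 2 - ‖x 3‖ ^ 2) := by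
    rw [inner_E5]
    simp only [hopf, PiLp.smul_apply, smul_eq_mul]
    change normSq4 x * (_ * ((normSq4 x)⁻¹ * _) + _ * ((normSq4 x)⁻¹ * _) + _ * ((normSq4 x)⁻¹ * _)
      + _ * ((normSq4 x)⁻¹ * _) + _ * ((normSq4 x)⁻¹ * _)) = _
    field_simp
    simp
    ring
  rw [key]
  apply Complex.ext
  · simp [clifford, dotProduct, Fin.sum_univ_four, Complex.sq_norm, Complex.normSq_apply]; ring
  · rw [Complex.ofReal_im]
    simp [clifford, dotProduct, Fin.sum_univ_four]; ring

theorem star_dot_self (x : C4) : star x ⬝ᵥ x = normSq4 x := by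
  rw [normSq4_cast]; simp [dotProduct, Fin.sum_univ_four]; ring

/-- Pairing `n p x + p n x = 2 ⟨p, n⟩ x` with `x` shows that `⟨n, hopf x⟩ = ⟨n, p⟩` for all `n`. -/
theorem hopf_eq_of_clifford_eq {p : E5} {x : C4} (hx : x ≠ 0) (h : clifford p x = x) :
    hopf x = p := by
  refine ext_inner_left ℝ fun n => ?_
  have h1 := star_dot_clifford n x
  have h2 : star x ⬝ᵥ clifford n x + star x ⬝ᵥ clifford n x =
      star x ⬝ᵥ (((2 * inner ℝ p n : ℝ) : ℂ) • x) := by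
    rw [← clifford_clifford, dotProduct_add, ← clifford_symm p, h]
  rw [h1, dotProduct_smul, star_dot_self, smul_eq_mul] at h2
  norm_cast at h2
  have := (normSq4_pos hx).ne'
  rw [real_inner_comm p n]
  exact mul_left_cancel₀ this (by linarith)

/-- The coordinates of `hopf x`, combined to the complex entries of `clifford (hopf x)`. -/
theorem hopf_apply_cast {x : C4} (hx : x ≠ 0) :
    ((hopf x 0 : ℂ) + hopf x 1 * Complex.I) * normSq4 x =
        2 * (star (x 2) * x 0 + x 3 * star (x 1)) ∧
    ((hopf x 2 : ℂ) + hopf x 3 * Complex.I) * normSq4 x =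
        2 * (star (x 2) * x 1 - x 3 * star (x 0)) ∧
    (hopf x 4 : ℂ) * normSq4 x = x 0 * star (x 0) + x 1 * star (x 1) - x 2 * star (x 2)
      - x 3 * star (x 3) := by
  have h := (normSq4_pos hx).ne'
  have hc : (normSq4 x : ℂ) ≠ 0 := by exact_mod_cast h
  have e : ∀ i, (hopf x i) = (normSq4 x)⁻¹ * (!₂[2 * (star (x 2) * x 0 + x 3 * star (x 1)).re,
      2 * (star (x 2) * x 0 + x 3 * star (x 1)).im, 2 * (star (x 2) * x 1 - x 3 * star (x 0)).re,
      2 * (star (x 2) * x 1 - x 3 * star (x 0)).im,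
      ‖x 0‖ ^ 2 + ‖x 1‖ ^ 2 - ‖x 2‖ ^ 2 - ‖x 3‖ ^ 2] : E5) i := fun i => rfl
  simp only [← norm_sq_cast]
  generalize star (x 2) * x 0 + x 3 * star (x 1) = a at e
  generalize star (x 2) * x 1 - x 3 * star (x 0) = b at e
  refine ⟨?_, ?_, ?_⟩
  · simp [e]; field_simp; exact Complex.re_add_im a
  · simp [e]; field_simp; exact Complex.re_add_im b
  · simp [e]; field_simp

theorem star_hopf_apply_cast {x : C4} (hx : x ≠ 0) :
    ((hopf x 0 : ℂ) - hopf x 1 * Complex.I) * normSq4 x =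
        2 * (x 2 * star (x 0) + star (x 3) * x 1) ∧
    ((hopf x 2 : ℂ) - hopf x 3 * Complex.I) * normSq4 x =
        2 * (x 2 * star (x 1) - star (x 3) * x 0) := by
  obtain ⟨h1, h2, -⟩ := hopf_apply_cast hx
  constructor
  · simpa [sub_eq_add_neg] using congrArg star h1
  · simpa [sub_eq_add_neg] using congrArg star h2

/-- For `p = hopf x`, the operator `(1 + p) / 2` is the orthogonal projection
onto the span of `x` and `σ x`. -/
theorem add_clifford_hopf {x : C4} (hx : x ≠ 0) (a : C4) :
    (normSq4 x : ℂ) • (a + clifford (hopf x) a) =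
      (2 * (star x ⬝ᵥ a)) • x + (2 * (star (sigma x) ⬝ᵥ a)) • sigma x := by
  obtain ⟨h1, h2, h5⟩ := hopf_apply_cast hx
  obtain ⟨h3, h4⟩ := star_hopf_apply_cast hx
  have h0 := normSq4_cast x
  simp only [RCLike.star_def] at h0 h1 h2 h3 h4 h5
  ext i; fin_cases i
  · simp [clifford, sigma, dotProduct, Fin.sum_univ_four, Matrix.vecHead, Matrix.vecTail]
    linear_combination a 0 * h0 + a 0 * h5 + a 2 * h1 - a 3 * h4
  · simp [clifford, sigma, dotProduct, Fin.sum_univ_four, Matrix.vecHead, Matrix.vecTail]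
    linear_combination a 1 * h0 + a 1 * h5 + a 2 * h2 + a 3 * h3
  · simp [clifford, sigma, dotProduct, Fin.sum_univ_four, Matrix.vecHead, Matrix.vecTail]
    linear_combination a 2 * h0 - a 2 * h5 + a 0 * h3 + a 1 * h4
  · simp [clifford, sigma, dotProduct, Fin.sum_univ_four, Matrix.vecHead, Matrix.vecTail]
    linear_combination a 3 * h0 - a 3 * h5 - a 0 * h2 + a 1 * h1

theorem star_sigma_dot_self (x : C4) : star (sigma x) ⬝ᵥ x = 0 := by
  simp [sigma, dotProduct, Fin.sum_univ_four]; ring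

/-- The projection onto the span of `x` and `σ x` fixes `x`. -/
theorem clifford_hopf {x : C4} (hx : x ≠ 0) : clifford (hopf x) x = x := by
  have h := add_clifford_hopf hx x
  have hc : (normSq4 x : ℂ) ≠ 0 := by exact_mod_cast (normSq4_pos hx).ne'
  rw [star_dot_self, star_sigma_dot_self, mul_zero, zero_smul, add_zero, mul_comm, mul_smul,
    two_smul] at h
  exact add_left_cancel (smul_right_injective _ hc h)

/-- Clifford multiplication by `hopf x` has the eigenvalue `1`, and its square is `|hopf x|²`. -/
theorem norm_hopf {x : C4} (hx : x ≠ 0) : ‖hopf x‖ = 1 := by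
  have h := clifford_self (hopf x) x
  rw [clifford_hopf hx, clifford_hopf hx] at h
  obtain ⟨i, hi⟩ := Function.ne_iff.1 hx
  have h1 := congrFun h i
  simp only [Pi.smul_apply, smul_eq_mul, Pi.zero_apply] at h1 hi
  have h2 : ((‖hopf x‖ ^ 2 : ℝ) : ℂ) = 1 := by
    rw [← sub_eq_zero]; apply (mul_eq_zero.1 (_ : _ * x i = 0)).resolve_right hi
    linear_combination -h1
  norm_cast at h2
  nlinarith [norm_nonneg (hopf x)]

theorem sigma_ne_zero {x : C4} (hx : x ≠ 0) : sigma x ≠ 0 := by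
  intro h; exact hx (sigma_injective (by rw [h, map_zero]))

theorem clifford_eq_zero {n : E5} (hn : n ≠ 0) {x : C4} (h : clifford n x = 0) : x = 0 := by
  have := clifford_self n x
  rw [h, map_zero] at this
  have h2 : ((‖n‖ ^ 2 : ℝ) : ℂ) ≠ 0 := by
    exact_mod_cast pow_ne_zero 2 (norm_ne_zero_iff.2 hn)
  exact (smul_eq_zero.1 this.symm).resolve_left h2

theorem pencil_independent {x : C4} (hx : x ≠ 0) {s t : ℂ} (h : s • x + t • sigma x = 0) :
    s = 0 ∧ t = 0 := by
  have h1 := congrArg (fun v => star x ⬝ᵥ v) h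
  have h2 := congrArg (fun v => star (sigma x) ⬝ᵥ v) h
  have h3 : star x ⬝ᵥ sigma x = 0 := by simp [sigma, dotProduct, Fin.sum_univ_four]; ring
  have h4 : star (sigma x) ⬝ᵥ sigma x = normSq4 x := by
    rw [normSq4_cast]; simp [sigma, dotProduct, Fin.sum_univ_four]; ring
  have hc : (normSq4 x : ℂ) ≠ 0 := by exact_mod_cast (normSq4_pos hx).ne'
  simp only [dotProduct_add, dotProduct_smul, star_dot_self, star_sigma_dot_self, h3, h4,
    dotProduct_zero, smul_eq_mul, mul_zero, add_zero, zero_add, mul_eq_zero, hc, or_false] at h1 h2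
  exact ⟨h1, h2⟩

/-- The `+1`-eigenspace of Clifford multiplication by `p ∈ S⁴` is not zero. -/
theorem exists_clifford_eq {p : E5} (hp : ‖p‖ = 1) : ∃ x : C4, x ≠ 0 ∧ clifford p x = x := by
  have key : ∀ a : C4, clifford p (a + clifford p a) = a + clifford p a := by
    intro a; rw [map_add, clifford_self, hp]; simp [add_comm]
  by_contra! H
  have h0 : ∀ a : C4, a + clifford p a = 0 := fun a => by
    by_contra h; exact H _ h (key a)
  have h1 := congrFun (h0 ![1, 0, 0, 0]) 0
  have h2 := congrFun (h0 ![0, 0, 1, 0]) 2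
  simp [clifford] at h1 h2
  have : (2 : ℂ) = 0 := by linear_combination h1 + h2
  norm_num at this

/-- The `+1`-eigenspace is the span of `x` and `σ x`. -/
theorem exists_pencil_of_clifford_eq {p : E5} {x a : C4} (hx : x ≠ 0) (h : clifford p x = x)
    (ha : clifford p a = a) : ∃ s t : ℂ, a = s • x + t • sigma x := by
  have hc : (normSq4 x : ℂ) ≠ 0 := by exact_mod_cast (normSq4_pos hx).ne'
  have := add_clifford_hopf hx a
  rw [hopf_eq_of_clifford_eq hx h, ha, ← two_smul ℂ a, smul_smul] at this
  refine ⟨(star x ⬝ᵥ a) / normSq4 x, (star (sigma x) ⬝ᵥ a) / normSq4 x, ?_⟩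
  apply smul_right_injective _ (mul_ne_zero hc (two_ne_zero (α := ℂ)))
  simp only
  rw [this, smul_add, smul_smul, smul_smul]
  congr 2 <;> field_simp

/-! ### The vector of a pair `(x, y)` -/

/-- The vector `n ∈ ℝ⁵` with `y = symp (n x)`, for a pair `(x, y)` in `realParams`. The formula
solves this linear equation for the entries `a`, `b`, `n₄` of `clifford n`. -/
def pairVec (x y : C4) : E5 :=
  let a : ℂ := star (x 2) * y 1 - x 3 * star (y 0) + star (y 3) * x 0 - y 2 * star (x 1)
  let b : ℂ := -(star (x 2) * y 0) - x 3 * star (y 1) + star (y 3) * x 1 + y 2 * star (x 0)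
  let s : ℂ := star (x 0) * y 1 - star (x 1) * y 0 - star (x 2) * y 3 + star (x 3) * y 2
  (normSq4 x)⁻¹ • !₂[a.re, a.im, b.re, b.im, s.re]

/-- For fixed `x ≠ 0`, the real linear map `n ↦ symp (n x)` from `ℝ⁵` is onto the vectors `y` that
satisfy the two equations of `realParams`. -/
theorem symp_clifford_pairVec {x y : C4} (hx : x ≠ 0) (h1 : x ⬝ᵥ y = 0)
    (h2 : x ⬝ᵥ sigma y + sigma x ⬝ᵥ y = 0) : symp (clifford (pairVec x y) x) = y := by
  have h := (normSq4_pos hx).ne'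
  have hc : (normSq4 x : ℂ) ≠ 0 := by exact_mod_cast h
  set n := pairVec x y with hn
  have ha : ((n 0 : ℂ) + n 1 * Complex.I) * normSq4 x =
      star (x 2) * y 1 - x 3 * star (y 0) + star (y 3) * x 0 - y 2 * star (x 1) := by
    conv_rhs => rw [← Complex.re_add_im (_ - _)]
    simp only [hn, pairVec, PiLp.smul_apply, smul_eq_mul, Complex.ofReal_mul, Complex.ofReal_inv]
    field_simp
    simp
    ring
  have hb : ((n 2 : ℂ) + n 3 * Complex.I) * normSq4 x =
      -(star (x 2) * y 0) - x 3 * star (y 1) + star (y 3) * x 1 + y 2 * star (x 0) := by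
    conv_rhs => rw [← Complex.re_add_im (_ + _)]
    simp only [hn, pairVec, PiLp.smul_apply, smul_eq_mul, Complex.ofReal_mul, Complex.ofReal_inv]
    field_simp
    simp
    ring
  have hs : (n 4 : ℂ) * normSq4 x =
      ((star (x 0) * y 1 - star (x 1) * y 0 - star (x 2) * y 3 + star (x 3) * y 2) +
      star (star (x 0) * y 1 - star (x 1) * y 0 - star (x 2) * y 3 + star (x 3) * y 2)) / 2 := by
    rw [← re_cast]
    simp only [hn, pairVec, PiLp.smul_apply, smul_eq_mul, Complex.ofReal_mul, Complex.ofReal_inv]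
    field_simp
    simp
  have ha' := congrArg star ha
  have hb' := congrArg star hb
  have h0 := normSq4_cast x
  clear_value n
  simp [dotProduct, sigma, Fin.sum_univ_four] at ha hb hs ha' hb' h0 h1 h2
  ext i
  apply mul_left_cancel₀ hc
  fin_cases i
  · simp [clifford, symp, -mul_eq_mul_left_iff]
    linear_combination -x 1 * hs - x 2 * hb - x 3 * ha' - y 0 * h0 + 1/2 * x 1 * h2
      - starRingEnd ℂ (x 0) * h1
  · simp [clifford, symp, -mul_eq_mul_left_iff]
    linear_combination x 0 * hs + x 2 * ha - x 3 * hb' - y 1 * h0 - 1/2 * x 0 * h2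
      - starRingEnd ℂ (x 1) * h1
  · simp [clifford, symp, -mul_eq_mul_left_iff]
    linear_combination x 3 * hs + x 0 * hb - x 1 * ha - y 2 * h0 + 1/2 * x 3 * h2
      - starRingEnd ℂ (x 2) * h1
  · simp [clifford, symp, -mul_eq_mul_left_iff]
    linear_combination -x 2 * hs + x 0 * ha' + x 1 * hb' - y 3 * h0 - 1/2 * x 2 * h2
      - starRingEnd ℂ (x 3) * h1

theorem dot_symp_clifford (n : E5) (x : C4) : x ⬝ᵥ symp (clifford n x) = 0 := by
  simp [dotProduct, symp, clifford, Fin.sum_univ_four]; ring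

theorem dot_sigma_symp_clifford (n : E5) (x : C4) :
    x ⬝ᵥ sigma (symp (clifford n x)) + sigma x ⬝ᵥ symp (clifford n x) = 0 := by
  simp [dotProduct, symp, sigma, clifford, Fin.sum_univ_four]; ring

theorem clifford_injective {m n : E5} {x : C4} (hx : x ≠ 0) (h : clifford m x = clifford n x) :
    m = n := by
  by_contra hmn
  refine hx (clifford_eq_zero (sub_ne_zero.2 hmn) ?_)
  have := clifford_add (m - n) n x
  rw [sub_add_cancel, h] at this
  simpa using this.symm

theorem symp_injective : Function.Injective symp := by
  intro x y h
  have := congrArg symp h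
  simpa [symp_symp] using this

theorem symp_clifford_ne_zero {n : E5} (hn : n ≠ 0) {x : C4} (hx : x ≠ 0) :
    symp (clifford n x) ≠ 0 := by
  intro h
  exact hx (clifford_eq_zero hn (symp_injective (by rw [h, map_zero])))

theorem symp_clifford_mem_realParams {n : E5} (hn : n ≠ 0) {x : C4} (hx : x ≠ 0) :
    (x, symp (clifford n x)) ∈ realParams :=
  ⟨hx, symp_clifford_ne_zero hn hx, dot_symp_clifford n x, dot_sigma_symp_clifford n x⟩

theorem pairVec_symp_clifford (n : E5) {x : C4} (hx : x ≠ 0) :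
    pairVec x (symp (clifford n x)) = n :=
  clifford_injective hx <| symp_injective <|
    symp_clifford_pairVec hx (dot_symp_clifford n x) (dot_sigma_symp_clifford n x)

theorem pairVec_ne_zero {x y : C4} (h : (x, y) ∈ realParams) : pairVec x y ≠ 0 := by
  intro h0
  have := symp_clifford_pairVec h.1 h.2.2.1 h.2.2.2
  rw [h0] at this
  refine h.2.1 (this.symm.trans ?_)
  ext i; fin_cases i <;> simp [symp, clifford]

/-! ### Real lines and pairs `(p, n)` -/

theorem mk_mem_quadric {x y : C4} (hx : x ≠ 0) (hy : y ≠ 0) :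
    (Projectivization.mk ℂ x hx, Projectivization.mk ℂ y hy) ∈ quadric ↔ x ⬝ᵥ y = 0 := by
  obtain ⟨a, ha⟩ := Projectivization.exists_smul_eq_mk_rep ℂ x hx
  obtain ⟨b, hb⟩ := Projectivization.exists_smul_eq_mk_rep ℂ y hy
  simp only [quadric, Set.mem_ofPred_eq, ← ha, ← hb, smul_dotProduct, dotProduct_smul]
  simp [Units.smul_def]

theorem tau_mk {x y : C4} (hx : x ≠ 0) (hy : y ≠ 0) :
    tau (Projectivization.mk ℂ x hx, Projectivization.mk ℂ y hy) =
      (Projectivization.mk ℂ (sigma x) (sigma_ne_zero hx),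
        Projectivization.mk ℂ (sigma y) (sigma_ne_zero hy)) := rfl

theorem realPencil_apply (x : C4) (u : Fin 2 → ℂ) : realPencil x u = u 0 • x + u 1 • sigma x := rfl

theorem realPencil_injective {x : C4} (hx : x ≠ 0) : Function.Injective (realPencil x) := by
  rw [injective_iff_map_eq_zero]
  intro u hu
  obtain ⟨h0, h1⟩ := pencil_independent hx hu
  ext i; fin_cases i <;> assumption

/-- The points `([a], [symp (n a)])`, where `a` runs through the `+1`-eigenspace of Clifford
multiplication by `p`. For `p ∈ S⁴` and `n ∈ ℝ⁵ ∖ 0` this is a real line. -/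
def lineCarrier (p n : E5) : Set (P3 × P3) :=
  {P | ∃ (a : C4) (ha : a ≠ 0) (hb : symp (clifford n a) ≠ 0), clifford p a = a ∧
    P = (Projectivization.mk ℂ a ha, Projectivization.mk ℂ (symp (clifford n a)) hb)}

theorem mk_mem_lineCarrier {p n : E5} (hn : n ≠ 0) {a b : C4} (ha : a ≠ 0) (hb : b ≠ 0) :
    (Projectivization.mk ℂ a ha, Projectivization.mk ℂ b hb) ∈ lineCarrier p n ↔
      clifford p a = a ∧ ∃ c : ℂ, c • symp (clifford n a) = b := by
  constructor
  · rintro ⟨a', ha', hb', h, he⟩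
    obtain ⟨h1, h2⟩ := Prod.mk.inj he
    obtain ⟨k, hk⟩ := (Projectivization.mk_eq_mk_iff' ..).1 h1
    obtain ⟨c, hc⟩ := (Projectivization.mk_eq_mk_iff' ..).1 h2
    have hk0 : k ≠ 0 := by rintro rfl; exact ha (by rw [← hk, zero_smul])
    refine ⟨by rw [← hk, map_smul, h], c * k⁻¹, ?_⟩
    rw [← hk, ← hc, map_smul, map_smul, smul_smul, mul_assoc, inv_mul_cancel₀ hk0, mul_one]
  · rintro ⟨h, c, hc⟩
    refine ⟨a, ha, symp_clifford_ne_zero hn ha, h, ?_⟩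
    rw [Prod.mk.injEq]
    exact ⟨rfl, (Projectivization.mk_eq_mk_iff' ..).2 ⟨c, hc⟩⟩

theorem realPencil_symp_clifford (n : E5) (x : C4) (u : Fin 2 → ℂ) :
    realPencil (symp (clifford n x)) u = symp (clifford n (realPencil x u)) := by
  simp only [realPencil_apply, map_add, map_smul, clifford_sigma, symp_sigma]

theorem clifford_realPencil {p : E5} {x : C4} (h : clifford p x = x) (u : Fin 2 → ℂ) :
    clifford p (realPencil x u) = realPencil x u := by
  simp only [realPencil_apply, map_add, map_smul, clifford_sigma, h]

/-- The eigenspace is spanned by `x` and `σ x`, which the real pencil parametrizes. -/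
theorem lineSet_realPencil {p n : E5} {x : C4} (hx : x ≠ 0) (h : clifford p x = x) :
    lineSet (realPencil x) (realPencil (symp (clifford n x))) = lineCarrier p n := by
  ext P
  constructor
  · rintro ⟨u, hA, hC, rfl⟩
    refine ⟨realPencil x u, hA, by rwa [← realPencil_symp_clifford], clifford_realPencil h u, ?_⟩
    simp only [realPencil_symp_clifford]
  · rintro ⟨a, ha, hb, hp, rfl⟩
    obtain ⟨s, t, rfl⟩ := exists_pencil_of_clifford_eq hx h hp
    have e : realPencil x ![s, t] = s • x + t • sigma x := by simp [realPencil_apply]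
    refine ⟨![s, t], by rwa [e], by rwa [realPencil_symp_clifford, e], ?_⟩
    simp only [realPencil_symp_clifford, e]

/-- The real line attached to `p ∈ S⁴` and a nonzero `n ∈ ℝ⁵`. -/
def lineOf (p : S4) (n : E5) (hn : n ≠ 0) : RealLine where
  carrier := lineCarrier p n
  isLine := by
    obtain ⟨x, hx, h⟩ := exists_clifford_eq (p := p) (by simp)
    exact ⟨_, _, realPencil_injective hx, realPencil_injective (symp_clifford_ne_zero hn hx),
      (lineSet_realPencil hx h).symm⟩
  subset_quadric := by
    rintro P ⟨a, ha, hb, h, rfl⟩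
    exact (mk_mem_quadric ha hb).2 (dot_symp_clifford n a)
  tau_invariant := by
    have key : ∀ P ∈ lineCarrier p n, tau P ∈ lineCarrier p n := by
      rintro P ⟨a, ha, hb, h, rfl⟩
      rw [tau_mk, mk_mem_lineCarrier hn]
      exact ⟨by rw [clifford_sigma, h], 1, by rw [one_smul, clifford_sigma, symp_sigma]⟩
    have tt : ∀ P, tau (tau P) = P := by
      rintro ⟨P, R⟩
      induction P using Projectivization.ind with | h x hx => ?_
      induction R using Projectivization.ind with | h y hy => ?_
      rw [tau_mk, tau_mk, Prod.mk.injEq]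
      constructor <;> refine (Projectivization.mk_eq_mk_iff' ..).2 ⟨-1, ?_⟩ <;> simp [sigma_sigma]
    refine subset_antisymm ?_ fun P hP => ⟨tau P, key P hP, tt P⟩
    rintro _ ⟨P, hP, rfl⟩
    exact key P hP

theorem lineOf_smul {p : S4} {n : E5} (hn : n ≠ 0) {r : ℝ} (hr : r ≠ 0) :
    lineOf p (r • n) (smul_ne_zero hr hn) = lineOf p n hn := by
  have hr' : (r : ℂ) ≠ 0 := by exact_mod_cast hr
  apply RealLine.ext
  ext ⟨P, R⟩
  induction P using Projectivization.ind with | h x hx => ?_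
  induction R using Projectivization.ind with | h y hy => ?_
  simp only [lineOf]
  rw [mk_mem_lineCarrier hn, mk_mem_lineCarrier (smul_ne_zero hr hn)]
  refine and_congr_right fun _ => ⟨?_, ?_⟩
  · rintro ⟨c, hc⟩
    exact ⟨c * r, by rw [← hc, clifford_smul, map_smul, smul_smul]⟩
  · rintro ⟨c, hc⟩
    exact ⟨c * (r : ℂ)⁻¹, by
      rw [← hc, clifford_smul, map_smul, smul_smul, mul_assoc, inv_mul_cancel₀ hr', mul_one]⟩

/-- The vector `n` is determined up to a factor: `n' a` is a multiple of `n a` for all `a` in the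
eigenspace, and as both operators commute with `σ` the factor is real and does not depend on `a`. -/
theorem lineOf_eq_iff {p p' : S4} {n n' : E5} (hn : n ≠ 0) (hn' : n' ≠ 0) :
    lineOf p n hn = lineOf p' n' hn' ↔ p = p' ∧ ∃ r : ℝ, r ≠ 0 ∧ n' = r • n := by
  constructor
  · intro h
    have key : ∀ a : C4, a ≠ 0 → clifford p' a = a →
        clifford p a = a ∧ ∃ c : ℂ, c • clifford n a = clifford n' a := by
      intro a ha hp
      have hb := symp_clifford_ne_zero hn' ha
      have h1 := (mk_mem_lineCarrier hn' ha hb).2 ⟨hp, 1, one_smul _ _⟩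
      change _ ∈ (lineOf p' n' hn').carrier at h1
      rw [← h] at h1
      obtain ⟨h2, c, hc⟩ := (mk_mem_lineCarrier hn ha hb).1 h1
      exact ⟨h2, c, symp_injective (by rw [← hc, map_smul])⟩
    obtain ⟨x, hx, hp'⟩ := exists_clifford_eq (p := p') (by simp)
    obtain ⟨hp, c, hc⟩ := key x hx hp'
    have hs : x + sigma x ≠ 0 := fun h0 => one_ne_zero
      (pencil_independent hx (s := 1) (t := 1) (by simpa using h0)).1
    obtain ⟨-, c', hc'⟩ := key _ hs (by rw [map_add, clifford_sigma, hp'])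
    -- comparing the factors at `x` and `x + σ x` shows that they are real
    have hX : clifford n x ≠ 0 := fun h0 => hx (clifford_eq_zero hn h0)
    have h1 : (c' - c) • clifford n x + (c' - star c) • sigma (clifford n x) = 0 := by
      rw [map_add, map_add, clifford_sigma, clifford_sigma, ← hc, map_smulₛₗ] at hc'
      rw [sub_smul, sub_smul, sub_add_sub_comm, ← smul_add, hc', sub_eq_zero]
      rfl
    obtain ⟨h2, h3⟩ := pencil_independent hX h1
    obtain ⟨r, rfl⟩ : ∃ r : ℝ, (r : ℂ) = c :=
      ⟨c.re, Complex.conj_eq_iff_re.1 ((sub_eq_zero.1 h3).symm.trans (sub_eq_zero.1 h2))⟩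
    have h4 : n' = r • n := clifford_injective hx (by rw [clifford_smul, hc])
    refine ⟨Subtype.ext ((hopf_eq_of_clifford_eq hx hp).symm.trans
      (hopf_eq_of_clifford_eq hx hp')), r, ?_, h4⟩
    rintro rfl
    exact hn' (by rw [h4, zero_smul])
  · rintro ⟨rfl, r, hr, rfl⟩
    exact (lineOf_smul hn hr).symm

/-- Hilbert's theorem 90 for `ℂ / ℝ`. -/
theorem exists_smul_conj {ρ : ℂ} (h : ρ * star ρ = 1) : ∃ c : ℂ, c ≠ 0 ∧ star c * ρ = c := by
  by_cases h1 : 1 + ρ = 0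
  · refine ⟨Complex.I, Complex.I_ne_zero, ?_⟩
    rw [eq_neg_of_add_eq_zero_right h1]; simp
  · refine ⟨1 + ρ, h1, ?_⟩
    rw [star_add, star_one]
    linear_combination h

/-- Every real line is of the form `ζ ↦ ([x + ζ σ(x)],[y + ζ σ(y)])`: the parametrization can be
chosen such that `σ` exchanges the values at `0` and `∞`, up to scalars; these can be removed by
rescaling `y`. -/
theorem exists_realPencil (l : RealLine) : ∃ x y : C4, (x, y) ∈ realParams ∧
    l.carrier = lineSet (realPencil x) (realPencil y) := by
  obtain ⟨A, C, hA, hC, hl⟩ := l.isLine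
  have A0 : ∀ {u}, A u = 0 → u = 0 := fun {u} h => hA (by rw [h, map_zero])
  have C0 : ∀ {u}, C u = 0 → u = 0 := fun {u} h => hC (by rw [h, map_zero])
  have H : ∀ u, u ≠ 0 → ∃ (u' : Fin 2 → ℂ) (ρ : ℂ), ρ ≠ 0 ∧ sigma (A u) = A u' ∧
      sigma (C u) = ρ • C u' := by
    intro u hu
    have hAu : A u ≠ 0 := mt A0 hu
    have hCu : C u ≠ 0 := mt C0 hu
    have h1 : tau (Projectivization.mk ℂ (A u) hAu, Projectivization.mk ℂ (C u) hCu) ∈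
        lineSet A C := by
      rw [← hl, ← l.tau_invariant, hl]
      exact ⟨_, ⟨u, hAu, hCu, rfl⟩, rfl⟩
    obtain ⟨u', hA', hC', h2⟩ := h1
    rw [tau_mk, Prod.mk.injEq] at h2
    obtain ⟨a, ha⟩ := (Projectivization.mk_eq_mk_iff' ..).1 h2.1
    obtain ⟨b, hb⟩ := (Projectivization.mk_eq_mk_iff' ..).1 h2.2
    have ha0 : a ≠ 0 := by rintro rfl; exact sigma_ne_zero hAu (by rw [← ha, zero_smul])
    have hb0 : b ≠ 0 := by rintro rfl; exact sigma_ne_zero hCu (by rw [← hb, zero_smul])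
    refine ⟨a • u', b * a⁻¹, mul_ne_zero hb0 (inv_ne_zero ha0), by rw [← ha, map_smul], ?_⟩
    rw [← hb, map_smul, smul_smul, mul_assoc, inv_mul_cancel₀ ha0, mul_one]
  have hu0 : (![1, 0] : Fin 2 → ℂ) ≠ 0 := by
    intro h; simpa using congrFun h 0
  set u0 : Fin 2 → ℂ := ![1, 0]
  obtain ⟨u1, ρ, hρ0, hA1, hC1⟩ := H u0 hu0
  have ind : ∀ {s t : ℂ}, s • u0 + t • u1 = 0 → s = 0 ∧ t = 0 := fun {s t} h =>
    pencil_independent (mt A0 hu0) (by rw [hA1, ← map_smul, ← map_smul, ← map_add, h, map_zero])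
  have h01 : u0 + u1 ≠ 0 := fun h => one_ne_zero (ind (s := 1) (t := 1) (by simpa using h)).1
  obtain ⟨u2, μ, -, hA2, hC2⟩ := H _ h01
  have hu2 : u2 = u1 - u0 := by
    apply hA
    rw [← hA2, map_add, map_add, map_sub, ← hA1, sigma_sigma]
    abel
  have hC1' : sigma (C u1) = -(star ρ)⁻¹ • C u0 := by
    have h := congrArg sigma hC1
    rw [sigma_sigma, map_smulₛₗ] at h
    rw [neg_eq_iff_eq_neg.1 h]
    simp [smul_smul, hρ0]
  -- the value `C u₀ + C u₁` at a third point gives a condition on the factor `ρ`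
  have hρ : ρ * star ρ = 1 := by
    rw [map_add, map_add, hC1, hC1', hu2] at hC2
    have h1 : (μ - (star ρ)⁻¹) • u0 + (ρ - μ) • u1 = 0 := by
      apply hC
      rw [map_zero, map_add, map_smul, map_smul, ← sub_eq_zero.2 hC2, map_sub]
      module
    obtain ⟨h2, h3⟩ := ind h1
    have : star ρ ≠ 0 := by simpa using hρ0
    rw [← sub_eq_zero.1 h3] at h2
    field_simp at h2
    linear_combination h2
  obtain ⟨c, hc0, hc⟩ := exists_smul_conj hρ
  let B : (Fin 2 → ℂ) →ₗ[ℂ] (Fin 2 → ℂ) :=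
    (LinearMap.proj 0).smulRight u0 + (LinearMap.proj 1).smulRight u1
  have hB : ∀ u, B u = u 0 • u0 + u 1 • u1 := fun u => rfl
  have Bs : Function.Surjective B := by
    rw [← LinearMap.injective_iff_surjective, injective_iff_map_eq_zero]
    intro u hu
    obtain ⟨h0, h1⟩ := ind ((hB u).symm.trans hu)
    ext i; fin_cases i <;> assumption
  have hx : ∀ u, realPencil (A u0) u = A (B u) := fun u => by
    rw [realPencil_apply, hB, map_add, map_smul, map_smul, hA1]
  have hσ : sigma (c • C u0) = c • C u1 := by
    rw [map_smulₛₗ, hC1, smul_smul]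
    exact congrArg (· • C u1) hc
  have hy : ∀ u, realPencil (c • C u0) u = c • C (B u) := fun u => by
    rw [realPencil_apply, hσ, hB, map_add, map_smul, map_smul, smul_add, smul_comm (u 0),
      smul_comm (u 1)]
  have hcar : l.carrier = lineSet (realPencil (A u0)) (realPencil (c • C u0)) := by
    rw [hl]
    ext P
    constructor
    · rintro ⟨u, hAu, hCu, rfl⟩
      obtain ⟨w, rfl⟩ := Bs u
      refine ⟨w, by rwa [hx], by rw [hy]; exact smul_ne_zero hc0 hCu, ?_⟩
      rw [Prod.mk.injEq]
      exact ⟨(Projectivization.mk_eq_mk_iff' ..).2 ⟨1, by rw [hx, one_smul]⟩,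
        (Projectivization.mk_eq_mk_iff' ..).2 ⟨c⁻¹, by rw [hy, inv_smul_smul₀ hc0]⟩⟩
    · rintro ⟨w, hAu, hCu, rfl⟩
      have hBw : B w ≠ 0 := by
        intro h; rw [hx, h, map_zero] at hAu; exact hAu rfl
      refine ⟨B w, mt A0 hBw, mt C0 hBw, ?_⟩
      rw [Prod.mk.injEq]
      exact ⟨(Projectivization.mk_eq_mk_iff' ..).2 ⟨1, by rw [hx, one_smul]⟩,
        (Projectivization.mk_eq_mk_iff' ..).2 ⟨c, by rw [hy]⟩⟩
  have hx0 : A u0 ≠ 0 := mt A0 hu0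
  have hy0 : c • C u0 ≠ 0 := smul_ne_zero hc0 (mt C0 hu0)
  refine ⟨A u0, c • C u0, ?_, hcar⟩
  generalize A u0 = x at hx0 hcar
  generalize c • C u0 = y at hy0 hcar
  have hdot : ∀ u, u ≠ 0 → realPencil x u ⬝ᵥ realPencil y u = 0 := by
    intro u hu
    have h1 : realPencil x u ≠ 0 := fun h => hu (realPencil_injective hx0 (by rw [h, map_zero]))
    have h2 : realPencil y u ≠ 0 := fun h => hu (realPencil_injective hy0 (by rw [h, map_zero]))
    rw [← mk_mem_quadric h1 h2]
    apply l.subset_quadric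
    rw [hcar]
    exact ⟨u, h1, h2, rfl⟩
  have d1 := hdot ![1, 0] (fun h => by simpa using congrFun h 0)
  have d2 := hdot ![0, 1] (fun h => by simpa using congrFun h 1)
  have d3 := hdot ![1, 1] (fun h => by simpa using congrFun h 1)
  simp [realPencil_apply] at d1 d2 d3
  refine ⟨hx0, hy0, d1, ?_⟩
  linear_combination d3 - d1 - d2

/-- The line through `([x], [y])` and its image under `τ` is attached to `p = hopf x` and
`n = pairVec x y`. -/
theorem lineSet_of_mem_realParams {x y : C4} (h : (x, y) ∈ realParams) :
    lineSet (realPencil x) (realPencil y) = lineCarrier (hopf x) (pairVec x y) := by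
  rw [← lineSet_realPencil h.1 (clifford_hopf h.1), symp_clifford_pairVec h.1 h.2.2.1 h.2.2.2]

theorem exists_lineOf (l : RealLine) : ∃ (p : S4) (n : E5) (hn : n ≠ 0), l = lineOf p n hn := by
  obtain ⟨x, y, h, hl⟩ := exists_realPencil l
  refine ⟨⟨hopf x, by simpa using norm_hopf h.1⟩, pairVec x y, pairVec_ne_zero h, ?_⟩
  exact RealLine.ext (hl.trans (lineSet_of_mem_realParams h))

/-! ### The sphere `S⁴` -/

/-- Euclidean four-space, the model space of `S⁴`. -/
abbrev E4 : Type := EuclideanSpace ℝ (Fin 4)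

theorem finrank_E5 : Fact (Module.finrank ℝ E5 = 4 + 1) :=
  ⟨finrank_euclideanSpace_fin⟩

theorem S4.norm_coe (p : S4) : ‖(p : E5)‖ = 1 := by simp

theorem S4.coe_ne_zero (p : S4) : (p : E5) ≠ 0 := by
  intro h; simpa [h] using S4.norm_coe p

theorem S4.inner_self (p : S4) : inner ℝ (p : E5) (p : E5) = 1 := by
  rw [real_inner_self_eq_norm_sq, S4.norm_coe, one_pow]

theorem chartAt_S4_target (p : S4) : (chartAt E4 p).target = Set.univ :=
  haveI := finrank_E5
  stereographic'_target (-p)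

theorem chartAt_symm_mem_source (p : S4) (a : E4) :
    (chartAt E4 p).symm a ∈ (chartAt E4 p).source :=
  (chartAt E4 p).map_target (by rw [chartAt_S4_target]; trivial)

theorem chartAt_chartAt_symm (p : S4) (a : E4) : chartAt E4 p ((chartAt E4 p).symm a) = a :=
  (chartAt E4 p).right_inv (by rw [chartAt_S4_target]; trivial)

theorem contMDiff_chartAt_symm_S4 (p : S4) : ContMDiff (𝓡 4) (𝓡 4) ∞ (chartAt E4 p).symm := by
  rw [← contMDiffOn_univ, ← chartAt_S4_target p]
  exact contMDiffOn_chart_symm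

theorem contMDiff_coe_S4 : ContMDiff (𝓡 4) 𝓘(ℝ, E5) ∞ ((↑) : S4 → E5) :=
  haveI := finrank_E5
  contMDiff_coe_sphere

/-- A map to `S⁴` is smooth if it is smooth as a map to `ℝ⁵`. This is a pointwise form of
`ContMDiff.codRestrict_sphere`: the charts of the sphere extend smoothly to a neighbourhood. -/
theorem contMDiffAt_S4 {EM HM M : Type*} [NormedAddCommGroup EM] [NormedSpace ℝ EM]
    [TopologicalSpace HM] {I : ModelWithCorners ℝ EM HM} [TopologicalSpace M] [ChartedSpace HM M]
    {f : M → S4} {x : M} (h : ContMDiffAt I 𝓘(ℝ, E5) ∞ (fun y => (f y : E5)) x) :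
    ContMDiffAt I (𝓡 4) ∞ f x := by
  have := finrank_E5
  rw [contMDiffAt_iff_target]
  refine ⟨(Topology.IsInducing.subtypeVal.continuousAt_iff).2 h.continuousAt, ?_⟩
  let v := f x
  let U : _ ≃ₗᵢ[ℝ] _ := (OrthonormalBasis.fromOrthogonalSpanSingleton (𝕜 := ℝ)
    4 (ne_zero_of_mem_unit_sphere (-v))).repr
  have h1 : ContDiffAt ℝ ∞ (fun y : E5 => U (stereoToFun ((-v : S4) : E5) y)) (v : E5) := by
    refine U.contDiff.contDiffAt.comp _ (contDiffOn_stereoToFun.contDiffAt ?_)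
    refine IsOpen.mem_nhds (isOpen_ne_fun (by fun_prop) continuous_const) ?_
    simp only [innerSL_apply_apply, coe_neg_sphere, inner_neg_left]
    change -inner ℝ (v : E5) (v : E5) ≠ 1
    rw [S4.inner_self]
    norm_num
  have h2 : ContMDiffAt 𝓘(ℝ, E5) 𝓘(ℝ, E4) ∞ (fun y : E5 => U (stereoToFun ((-v : S4) : E5) y))
    (f x : E5) := h1.contMDiffAt
  exact ContMDiffAt.comp (f := fun y => (f y : E5)) x h2 h

/-! ### Coordinates on the orthogonal complement of a point of `S⁴` -/

/-- A linear isometry of `ℝ⁴` onto `a^⊥ ⊆ ℝ⁵`. -/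
def perpIncl (a : S4) : E4 →L[ℝ] E5 :=
  haveI := finrank_E5
  (ℝ ∙ (a : E5))ᗮ.subtypeL.comp (OrthonormalBasis.fromOrthogonalSpanSingleton (𝕜 := ℝ)
    4 (ne_zero_of_mem_unit_sphere a)).repr.symm.toContinuousLinearEquiv.toContinuousLinearMap

/-- The orthogonal projection to `a^⊥`, read as a vector of `ℝ⁴`. -/
def perpCoord (a : S4) : E5 →L[ℝ] E4 :=
  haveI := finrank_E5
  (OrthonormalBasis.fromOrthogonalSpanSingleton (𝕜 := ℝ)
    4 (ne_zero_of_mem_unit_sphere a)).repr.toContinuousLinearEquiv.toContinuousLinearMap.comp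
    (ℝ ∙ (a : E5))ᗮ.orthogonalProjectionOnto

theorem inner_perpIncl (a : S4) (y : E4) : inner ℝ (a : E5) (perpIncl a y) = 0 :=
  Submodule.mem_orthogonal_singleton_iff_inner_right.1 (Subtype.prop _)

theorem perpCoord_perpIncl (a : S4) (y : E4) : perpCoord a (perpIncl a y) = y := by
  simp [perpCoord, perpIncl]

theorem perpIncl_perpCoord (a : S4) (x : E5) :
    perpIncl a (perpCoord a x) = x - inner ℝ (a : E5) x • (a : E5) := by
  have h := Submodule.starProjection_add_starProjection_orthogonal (K := ℝ ∙ (a : E5)) x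
  rw [Submodule.starProjection_unit_singleton ℝ (S4.norm_coe a)] at h
  have h1 : perpIncl a (perpCoord a x) = (ℝ ∙ (a : E5))ᗮ.starProjection x :=
    congrArg Subtype.val (LinearIsometryEquiv.symm_apply_apply _ _)
  rw [h1]
  exact eq_sub_of_add_eq' h

theorem perpCoord_self (a : S4) : perpCoord a (a : E5) = 0 := by
  have h := perpIncl_perpCoord a (a : E5)
  rw [S4.inner_self, one_smul, sub_self] at h
  rw [← perpCoord_perpIncl a (perpCoord a a), h, map_zero]

/-! ### The smooth structure on the set of real lines -/

/-- Euclidean eight-space, the model space of the manifold of real lines. -/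
abbrev E8 : Type := EuclideanSpace ℝ (Fin 8)

open Classical in
/-- The map `(p, n) ↦ lineOf p n`, which identifies `RealLine` with the quotient of `S⁴ × (ℝ⁵ ∖ 0)`
by `ℝ*`. The value at `n = 0` is arbitrary. -/
def lineMap (w : S4 × E5) : RealLine :=
  if h : w.2 = 0 then lineOf w.1 w.1 (S4.coe_ne_zero w.1) else lineOf w.1 w.2 h

theorem lineMap_of_ne {w : S4 × E5} (h : w.2 ≠ 0) : lineMap w = lineOf w.1 w.2 h := dif_neg h

theorem lineMap_eq_iff {w w' : S4 × E5} (h : w.2 ≠ 0) (h' : w'.2 ≠ 0) :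
    lineMap w = lineMap w' ↔ w.1 = w'.1 ∧ ∃ r : ℝ, r ≠ 0 ∧ w'.2 = r • w.2 := by
  rw [lineMap_of_ne h, lineMap_of_ne h', lineOf_eq_iff]

theorem lineMap_smul (p : S4) {n : E5} (hn : n ≠ 0) {r : ℝ} (hr : r ≠ 0) :
    lineMap (p, r • n) = lineMap (p, n) :=
  ((lineMap_eq_iff (w := (p, n)) (w' := (p, r • n)) hn (smul_ne_zero hr hn)).2
    ⟨rfl, r, hr, rfl⟩).symm

theorem exists_lineMap (l : RealLine) : ∃ w : S4 × E5, w.2 ≠ 0 ∧ lineMap w = l := by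
  obtain ⟨p, n, hn, rfl⟩ := exists_lineOf l
  exact ⟨(p, n), hn, lineMap_of_ne (w := (p, n)) hn⟩

/-- A choice of `(p, n)` for every real line; `n` is determined up to a factor. -/
def lineRep (l : RealLine) : S4 × E5 := (exists_lineMap l).choose

theorem lineRep_ne (l : RealLine) : (lineRep l).2 ≠ 0 := (exists_lineMap l).choose_spec.1

theorem lineMap_lineRep (l : RealLine) : lineMap (lineRep l) = l :=
  (exists_lineMap l).choose_spec.2

theorem lineRep_lineMap {w : S4 × E5} (h : w.2 ≠ 0) :
    (lineRep (lineMap w)).1 = w.1 ∧ ∃ r : ℝ, r ≠ 0 ∧ (lineRep (lineMap w)).2 = r • w.2 := by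
  have := (lineMap_eq_iff h (lineRep_ne (lineMap w))).1 (lineMap_lineRep _).symm
  exact ⟨this.1.symm, this.2⟩

theorem isOpen_snd_ne_zero : IsOpen {w : S4 × E5 | w.2 ≠ 0} :=
  isOpen_ne_fun continuous_snd continuous_const

/-- The quotient topology of `S⁴ × (ℝ⁵ ∖ 0)`. -/
instance : TopologicalSpace RealLine where
  IsOpen O := IsOpen {w : S4 × E5 | w.2 ≠ 0 ∧ lineMap w ∈ O}
  isOpen_univ := by simpa using isOpen_snd_ne_zero
  isOpen_inter s t hs ht := by
    convert hs.inter ht using 1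
    ext w
    simp only [Set.mem_inter_iff, Set.mem_ofPred_eq]
    tauto
  isOpen_sUnion S hS := by
    have : {w : S4 × E5 | w.2 ≠ 0 ∧ lineMap w ∈ ⋃₀ S} =
        ⋃ s ∈ S, {w : S4 × E5 | w.2 ≠ 0 ∧ lineMap w ∈ s} := by
      ext w
      simp only [Set.mem_ofPred_eq, Set.mem_sUnion, Set.mem_iUnion, exists_prop]
      exact ⟨fun ⟨h, t, ht, hw⟩ => ⟨t, ht, h, hw⟩, fun ⟨t, ht, h, hw⟩ => ⟨h, t, ht, hw⟩⟩
    rw [this]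
    exact isOpen_biUnion hS

theorem isOpen_realLine_iff {O : Set RealLine} :
    IsOpen O ↔ IsOpen {w : S4 × E5 | w.2 ≠ 0 ∧ lineMap w ∈ O} := Iff.rfl

/-- `ℝ⁴ × ℝ⁴ = ℝ⁸`. -/
def prodEquivE8 : (E4 × E4) ≃L[ℝ] E8 :=
  ContinuousLinearEquiv.ofFinrankEq (by simp)

/-- The pairs `(p', n)` for which `p'` lies in the domain of the chart of `S⁴` at `p` and `n` is not
orthogonal to `a`; their lines are the domain of a chart. -/
def slabDomain (p a : S4) : Set (S4 × E5) :=
  {w | w.1 ∈ (chartAt E4 p).source ∧ inner ℝ (a : E5) w.2 ≠ 0}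

/-- The coordinates of `(p', n)`: the chart of `S⁴` at `p`, and the affine coordinates of `[n]` in
the affine space `a + a^⊥`. -/
def slabCoord (p a : S4) (w : S4 × E5) : E8 :=
  prodEquivE8 (chartAt E4 p w.1, (inner ℝ (a : E5) w.2)⁻¹ • perpCoord a w.2)

/-- The pair `(p', n)` with given coordinates and with `n ∈ a + a^⊥`. -/
def slabSection (p a : S4) (e : E8) : S4 × E5 :=
  ((chartAt E4 p).symm (prodEquivE8.symm e).1, a + perpIncl a (prodEquivE8.symm e).2)

theorem isOpen_slabDomain (p a : S4) : IsOpen (slabDomain p a) :=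
  ((chartAt E4 p).open_source.preimage continuous_fst).inter
    (isOpen_ne_fun (by fun_prop) continuous_const)

theorem ne_zero_of_mem_slabDomain {p a : S4} {w : S4 × E5} (h : w ∈ slabDomain p a) : w.2 ≠ 0 := by
  intro h0
  exact h.2 (by rw [h0, inner_zero_right])

theorem contMDiffOn_slabCoord (p a : S4) :
    ContMDiffOn ((𝓡 4).prod 𝓘(ℝ, E5)) (𝓡 8) ∞ (slabCoord p a) (slabDomain p a) := by
  have h1 : ContMDiffOn ((𝓡 4).prod 𝓘(ℝ, E5)) (𝓡 4) ∞ (fun w : S4 × E5 => chartAt E4 p w.1)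
      (slabDomain p a) :=
    (contMDiffOn_chart (I := 𝓡 4) (n := ∞) (x := p)).comp contMDiff_fst.contMDiffOn fun w hw => hw.1
  have h2 : ContMDiffOn ((𝓡 4).prod 𝓘(ℝ, E5)) 𝓘(ℝ, E4) ∞
      (fun w : S4 × E5 => (inner ℝ (a : E5) w.2)⁻¹ • perpCoord a w.2) (slabDomain p a) := by
    have : ContDiffOn ℝ ∞ (fun n : E5 => (inner ℝ (a : E5) n)⁻¹ • perpCoord a n)
        {n | inner ℝ (a : E5) n ≠ 0} := by
      refine ContDiffOn.smul (ContDiffOn.inv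
        (contDiff_const.inner ℝ contDiff_id).contDiffOn fun n hn => hn) (by fun_prop)
    exact this.contMDiffOn.comp contMDiff_snd.contMDiffOn fun w hw => hw.2
  exact prodEquivE8.contDiff.contMDiff.comp_contMDiffOn (h1.prodMk_space h2)

theorem contMDiff_slabSection (p a : S4) :
    ContMDiff (𝓡 8) ((𝓡 4).prod 𝓘(ℝ, E5)) ∞ (slabSection p a) := by
  refine ContMDiff.prodMk ?_ ?_
  · have h2 : ContDiff ℝ ∞ (fun e : E8 => (prodEquivE8.symm e).1) := by fun_prop
    exact (contMDiff_chartAt_symm_S4 p).comp h2.contMDiff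
  · have h2 : ContDiff ℝ ∞ (fun e : E8 => (a : E5) + perpIncl a (prodEquivE8.symm e).2) := by
      fun_prop
    exact h2.contMDiff

theorem slabSection_mem (p a : S4) (e : E8) : slabSection p a e ∈ slabDomain p a := by
  refine ⟨chartAt_symm_mem_source p _, ?_⟩
  simp only [slabSection]
  rw [inner_add_right, inner_perpIncl, S4.inner_self]
  norm_num

theorem slabCoord_slabSection (p a : S4) (e : E8) : slabCoord p a (slabSection p a e) = e := by
  simp only [slabCoord, slabSection]
  rw [chartAt_chartAt_symm, inner_add_right,
    inner_perpIncl, S4.inner_self, map_add, perpCoord_self, perpCoord_perpIncl]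
  simp

theorem slabSection_slabCoord {p a : S4} {w : S4 × E5} (h : w ∈ slabDomain p a) :
    slabSection p a (slabCoord p a w) = (w.1, (inner ℝ (a : E5) w.2)⁻¹ • w.2) := by
  simp only [slabCoord, slabSection]
  rw [ContinuousLinearEquiv.symm_apply_apply, (chartAt E4 p).left_inv h.1, map_smul,
    perpIncl_perpCoord, smul_sub, smul_smul, inv_mul_cancel₀ h.2, one_smul, add_sub_cancel]

theorem lineMap_slabSection_slabCoord {p a : S4} {w : S4 × E5} (h : w ∈ slabDomain p a) :
    lineMap (slabSection p a (slabCoord p a w)) = lineMap w := by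
  rw [slabSection_slabCoord h]
  exact lineMap_smul w.1 (ne_zero_of_mem_slabDomain h) (inv_ne_zero h.2)

theorem slabCoord_lineRep {p a : S4} {w : S4 × E5} (h : w.2 ≠ 0) :
    slabCoord p a (lineRep (lineMap w)) = slabCoord p a w := by
  obtain ⟨h1, r, hr, h2⟩ := lineRep_lineMap h
  simp only [slabCoord, h1, h2, inner_smul_right, map_smul, smul_smul, mul_inv]
  congr 3
  field_simp

theorem lineRep_mem_slabDomain {p a : S4} {w : S4 × E5} (h : w.2 ≠ 0) :
    lineRep (lineMap w) ∈ slabDomain p a ↔ w ∈ slabDomain p a := by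
  obtain ⟨h1, r, hr, h2⟩ := lineRep_lineMap h
  simp only [slabDomain, Set.mem_ofPred_eq, h1, h2, inner_smul_right, ne_eq, mul_eq_zero, hr,
    false_or]

/-- The chart of `RealLine` given by `slabCoord`. -/
def lineChart (p a : S4) : OpenPartialHomeomorph RealLine E8 where
  toFun l := slabCoord p a (lineRep l)
  invFun e := lineMap (slabSection p a e)
  source := {l | lineRep l ∈ slabDomain p a}
  target := Set.univ
  map_source' _ _ := trivial
  map_target' e _ := (lineRep_mem_slabDomain (ne_zero_of_mem_slabDomain (slabSection_mem p a e))).2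
    (slabSection_mem p a e)
  left_inv' l hl := (lineMap_slabSection_slabCoord hl).trans (lineMap_lineRep l)
  right_inv' e _ := (slabCoord_lineRep (ne_zero_of_mem_slabDomain (slabSection_mem p a e))).trans
    (slabCoord_slabSection p a e)
  open_source := by
    rw [isOpen_realLine_iff]
    convert isOpen_slabDomain p a using 1
    ext w
    refine ⟨fun h => (lineRep_mem_slabDomain h.1).1 h.2, fun h => ?_⟩
    exact ⟨ne_zero_of_mem_slabDomain h,
      (lineRep_mem_slabDomain (ne_zero_of_mem_slabDomain h)).2 h⟩
  open_target := isOpen_univ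
  continuousOn_toFun := by
    have ho : IsOpen {l | lineRep l ∈ slabDomain p a} := by
      rw [isOpen_realLine_iff]
      convert isOpen_slabDomain p a using 1
      ext w
      refine ⟨fun h => (lineRep_mem_slabDomain h.1).1 h.2, fun h => ?_⟩
      exact ⟨ne_zero_of_mem_slabDomain h,
        (lineRep_mem_slabDomain (ne_zero_of_mem_slabDomain h)).2 h⟩
    rw [continuousOn_open_iff ho]
    intro t ht
    rw [isOpen_realLine_iff]
    convert (contMDiffOn_slabCoord p a).continuousOn.isOpen_inter_preimage
      (isOpen_slabDomain p a) ht using 1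
    ext w
    constructor
    · rintro ⟨h0, h1, h2⟩
      rw [Set.mem_preimage, slabCoord_lineRep h0] at h2
      exact ⟨(lineRep_mem_slabDomain h0).1 h1, h2⟩
    · rintro ⟨h1, h2⟩
      have h0 := ne_zero_of_mem_slabDomain h1
      exact ⟨h0, (lineRep_mem_slabDomain h0).2 h1, by
        rwa [Set.mem_preimage, slabCoord_lineRep h0]⟩
  continuousOn_invFun := by
    rw [continuousOn_univ, continuous_def]
    intro O hO
    convert (isOpen_realLine_iff.1 hO).preimage (contMDiff_slabSection p a).continuous using 1
    ext e
    exact ⟨fun h => ⟨ne_zero_of_mem_slabDomain (slabSection_mem p a e), h⟩, fun h => h.2⟩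

/-- The unit vector in the direction of the chosen `n`. -/
def lineDirection (l : RealLine) : S4 :=
  ⟨‖(lineRep l).2‖⁻¹ • (lineRep l).2, by
    simp [norm_smul, inv_mul_cancel₀ (norm_ne_zero_iff.2 (lineRep_ne l))]⟩

theorem mem_lineChart_source (l : RealLine) :
    l ∈ (lineChart (lineRep l).1 (lineDirection l)).source := by
  refine ⟨mem_chart_source E4 _, ?_⟩
  simp only [lineDirection, inner_smul_left, real_inner_self_eq_norm_sq]
  have := norm_ne_zero_iff.2 (lineRep_ne l)
  simpa using this

instance : ChartedSpace E8 RealLine where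
  atlas := {e | ∃ p a, e = lineChart p a}
  chartAt l := lineChart (lineRep l).1 (lineDirection l)
  mem_chart_source := mem_lineChart_source
  chart_mem_atlas _ := ⟨_, _, rfl⟩

instance : IsManifold (𝓡 8) ∞ RealLine := by
  refine isManifold_of_contDiffOn (𝓡 8) ∞ RealLine ?_
  rintro _ _ ⟨p, a, rfl⟩ ⟨p', a', rfl⟩
  rw [← contMDiffOn_iff_contDiffOn]
  have h := (contMDiffOn_slabCoord p' a').comp (contMDiff_slabSection p a).contMDiffOn
    (s := slabSection p a ⁻¹' slabDomain p' a') (fun e he => he)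
  refine (h.congr fun e he => ?_).mono fun e he => ?_
  · exact slabCoord_lineRep (ne_zero_of_mem_slabDomain he)
  · have := he.1.2
    exact (lineRep_mem_slabDomain (ne_zero_of_mem_slabDomain (slabSection_mem p a e))).1 this

theorem lineChart_mem_maximalAtlas (p a : S4) :
    lineChart p a ∈ IsManifold.maximalAtlas (𝓡 8) ∞ RealLine :=
  IsManifold.subset_maximalAtlas ⟨p, a, rfl⟩

theorem contMDiffAt_lineMap {w : S4 × E5} (h : w.2 ≠ 0) :
    ContMDiffAt ((𝓡 4).prod 𝓘(ℝ, E5)) (𝓡 8) ∞ lineMap w := by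
  set p := (lineRep (lineMap w)).1
  set a := lineDirection (lineMap w)
  have hw : w ∈ slabDomain p a := (lineRep_mem_slabDomain h).1 (mem_lineChart_source (lineMap w))
  have hn := (isOpen_slabDomain p a).mem_nhds hw
  have h1 : ContMDiff (𝓡 8) (𝓡 8) ∞ (lineChart p a).symm := by
    rw [← contMDiffOn_univ]
    exact contMDiffOn_symm_of_mem_maximalAtlas (lineChart_mem_maximalAtlas p a)
  refine (h1.contMDiffAt.comp w ((contMDiffOn_slabCoord p a).contMDiffAt hn)).congr_of_eventuallyEq
    ?_
  filter_upwards [hn] with w' hw'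
  exact (lineMap_slabSection_slabCoord hw').symm

/-- The quotient map `lineMap` has smooth local sections through every point `(p, n)` with `n ≠ 0`:
the section of a chart, rescaled such that it passes through the given point. -/
theorem exists_local_section {w : S4 × E5} (h : w.2 ≠ 0) :
    ∃ (U : Set RealLine) (r : RealLine → S4 × E5), IsOpen U ∧ lineMap w ∈ U ∧
      ContMDiffOn (𝓡 8) ((𝓡 4).prod 𝓘(ℝ, E5)) ∞ r U ∧ r (lineMap w) = w ∧
      ∀ l ∈ U, (r l).2 ≠ 0 ∧ lineMap (r l) = l := by
  set p := (lineRep (lineMap w)).1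
  set a := lineDirection (lineMap w)
  have hw : w ∈ slabDomain p a := (lineRep_mem_slabDomain h).1 (mem_lineChart_source (lineMap w))
  have hs : ContMDiffOn (𝓡 8) ((𝓡 4).prod 𝓘(ℝ, E5)) ∞
      (fun l => slabSection p a (lineChart p a l)) (lineChart p a).source :=
    (contMDiff_slabSection p a).comp_contMDiffOn
      (contMDiffOn_of_mem_maximalAtlas (lineChart_mem_maximalAtlas p a))
  refine ⟨(lineChart p a).source, fun l => ((slabSection p a (lineChart p a l)).1,
    inner ℝ (a : E5) w.2 • (slabSection p a (lineChart p a l)).2), (lineChart p a).open_source,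
    (lineRep_mem_slabDomain h).2 hw, ?_, ?_, ?_⟩
  · refine (contMDiff_fst.comp_contMDiffOn hs).prodMk ?_
    have : ContDiff ℝ ∞ (fun n : E5 => inner ℝ (a : E5) w.2 • n) := by fun_prop
    exact this.contMDiff.comp_contMDiffOn (contMDiff_snd.comp_contMDiffOn hs)
  · have e : lineChart p a (lineMap w) = slabCoord p a w := slabCoord_lineRep h
    simp only
    rw [e, slabSection_slabCoord hw]
    simp only [smul_smul, mul_inv_cancel₀ hw.2, one_smul]
  · intro l hl
    have h0 := ne_zero_of_mem_slabDomain (slabSection_mem p a (lineChart p a l))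
    exact ⟨smul_ne_zero hw.2 h0,
      (lineMap_smul _ h0 hw.2).trans ((lineChart p a).left_inv hl)⟩

/-- The universal property of the quotient manifold `RealLine`. -/
theorem contMDiffAt_of_comp_lineMap {EY HY Y : Type*} [NormedAddCommGroup EY] [NormedSpace ℝ EY]
    [TopologicalSpace HY] [TopologicalSpace Y] [ChartedSpace HY Y] {I : ModelWithCorners ℝ EY HY}
    {f : RealLine → Y} {w : S4 × E5} (hw : w.2 ≠ 0)
    (h : ContMDiffAt ((𝓡 4).prod 𝓘(ℝ, E5)) I ∞ (fun w => f (lineMap w)) w) :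
    ContMDiffAt (𝓡 8) I ∞ f (lineMap w) := by
  obtain ⟨U, r, hU, hwU, hr, hrw, hrU⟩ := exists_local_section hw
  have h1 : ContMDiffAt (𝓡 8) I ∞ (fun l => f (lineMap (r l))) (lineMap w) := by
    refine ContMDiffAt.comp (g := fun w => f (lineMap w)) (lineMap w) ?_
      (hr.contMDiffAt (hU.mem_nhds hwU))
    rwa [hrw]
  refine h1.congr_of_eventuallyEq ?_
  filter_upwards [hU.mem_nhds hwU] with l hl
  rw [(hrU l hl).2]

/-- The map `(p, [n]) ↦ (p, n nᵀ / |n|²)` is continuous and injective. -/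
instance : T2Space RealLine := by
  have hpr : ∀ w : S4 × E5, w.2 ≠ 0 → ∀ i j : Fin 5,
      (lineRep (lineMap w)).2 i * (lineRep (lineMap w)).2 j / ‖(lineRep (lineMap w)).2‖ ^ 2 =
        w.2 i * w.2 j / ‖w.2‖ ^ 2 := by
    intro w hw i j
    obtain ⟨-, r, hr, h2⟩ := lineRep_lineMap hw
    have := norm_ne_zero_iff.2 hw
    rw [h2, norm_smul, mul_pow, Real.norm_eq_abs, sq_abs]
    simp only [PiLp.smul_apply, smul_eq_mul]
    field_simp
  let F : RealLine → S4 × (Fin 5 → Fin 5 → ℝ) := fun l => ((lineRep l).1,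
    fun i j => (lineRep l).2 i * (lineRep l).2 j / ‖(lineRep l).2‖ ^ 2)
  have hF : ∀ w : S4 × E5, w.2 ≠ 0 →
      F (lineMap w) = (w.1, fun i j => w.2 i * w.2 j / ‖w.2‖ ^ 2) := by
    intro w hw
    simp only [F, (lineRep_lineMap hw).1, hpr w hw]
  refine T2Space.of_injective_continuous (f := F) ?_ ?_
  · intro l l' h
    obtain ⟨w, hw, rfl⟩ := exists_lineMap l
    obtain ⟨w', hw', rfl⟩ := exists_lineMap l'
    rw [hF w hw, hF w' hw', Prod.mk.injEq] at h
    have hk : ∃ k, w.2 k ≠ 0 := by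
      by_contra! hk; exact hw (PiLp.ext hk)
    obtain ⟨k, hk⟩ := hk
    have hk2 := congrFun₂ h.2 k k
    have n1 := norm_ne_zero_iff.2 hw
    have n2 := norm_ne_zero_iff.2 hw'
    have hk' : w'.2 k ≠ 0 := by
      intro h0
      rw [h0] at hk2
      simp [hk, hw] at hk2
    refine (lineMap_eq_iff hw hw').2 ⟨h.1, w'.2 k / w.2 k, div_ne_zero hk' hk, PiLp.ext fun i => ?_⟩
    have hi := congrFun₂ h.2 k i
    simp only [PiLp.smul_apply, smul_eq_mul]
    -- `n k n i / |n|² = n' k n' i / |n'|²`, divided by the same equation for `i = k`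
    field_simp at hi hk2 ⊢
    have h5 : ‖w'.2‖ ^ 2 ≠ 0 := pow_ne_zero 2 n2
    apply mul_left_cancel₀ (mul_ne_zero h5 hk)
    linear_combination w'.2 i * hk2 - w'.2 k * hi
  · rw [continuous_iff_continuousAt]
    intro l
    obtain ⟨w, hw, rfl⟩ := exists_lineMap l
    obtain ⟨U, r, hU, hwU, hr, hrw, hrU⟩ := exists_local_section hw
    have hc : ContinuousAt (fun w : S4 × E5 =>
        ((w.1, fun i j => w.2 i * w.2 j / ‖w.2‖ ^ 2) : S4 × (Fin 5 → Fin 5 → ℝ)))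
        (r (lineMap w)) := by
      refine continuousAt_fst.prodMk ?_
      rw [continuousAt_pi]; intro i
      rw [continuousAt_pi]; intro j
      refine ContinuousAt.div (by fun_prop) (by fun_prop) ?_
      rw [hrw]
      exact pow_ne_zero 2 (norm_ne_zero_iff.2 hw)
    refine (ContinuousAt.comp hc (hr.continuousOn.continuousAt (hU.mem_nhds hwU))).congr ?_
    filter_upwards [hU.mem_nhds hwU] with l hl
    rw [← (hrU l hl).2, Function.comp_apply, (hrU l hl).2, ← hF _ (hrU l hl).1, (hrU l hl).2]

/-- `RealLine` is the image of `S⁴ × S⁴`. -/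
instance : CompactSpace RealLine := by
  have hc : IsCompact (Set.univ ×ˢ Metric.sphere 0 1 : Set (S4 × E5)) :=
    isCompact_univ.prod (isCompact_sphere 0 1)
  have hn : ∀ w ∈ (Set.univ ×ˢ Metric.sphere 0 1 : Set (S4 × E5)), w.2 ≠ 0 := by
    rintro w ⟨-, hw⟩ h0
    simp [h0] at hw
  refine ⟨?_⟩
  convert hc.image_of_continuousOn (f := lineMap)
    fun w hw => (contMDiffAt_lineMap (hn w hw)).continuousAt.continuousWithinAt using 1
  refine (Set.eq_univ_of_forall fun l => ?_).symm
  refine ⟨((lineRep l).1, lineDirection l), ⟨trivial, (lineDirection l).2⟩, ?_⟩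
  exact (lineMap_smul _ (lineRep_ne l) (inv_ne_zero (norm_ne_zero_iff.2 (lineRep_ne l)))).trans
    (lineMap_lineRep l)

instance : SecondCountableTopology RealLine :=
  ChartedSpace.secondCountable_of_sigmaCompact E8 RealLine

/-! ### Smoothness of the algebraic maps -/

section Smooth

variable {E : Type*} [NormedAddCommGroup E] [NormedSpace ℝ E] {k : ℕ∞ω} {f : E → ℂ}

@[fun_prop]
theorem contDiff_complex_re (hf : ContDiff ℝ k f) : ContDiff ℝ k fun x => (f x).re :=
  Complex.reCLM.contDiff.comp hf

@[fun_prop]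
theorem contDiff_complex_im (hf : ContDiff ℝ k f) : ContDiff ℝ k fun x => (f x).im :=
  Complex.imCLM.contDiff.comp hf

@[fun_prop]
theorem contDiff_complex_star (hf : ContDiff ℝ k f) : ContDiff ℝ k fun x => star (f x) :=
  Complex.conjCLE.contDiff.comp hf

@[fun_prop]
theorem contDiff_complex_ofReal {f : E → ℝ} (hf : ContDiff ℝ k f) :
    ContDiff ℝ k fun x => (f x : ℂ) :=
  Complex.ofRealCLM.contDiff.comp hf

end Smooth

theorem contDiff_vec4 {E : Type*} [NormedAddCommGroup E] [NormedSpace ℝ E] {f : E → C4}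
    (h0 : ContDiff ℝ ∞ fun x => f x 0) (h1 : ContDiff ℝ ∞ fun x => f x 1)
    (h2 : ContDiff ℝ ∞ fun x => f x 2) (h3 : ContDiff ℝ ∞ fun x => f x 3) : ContDiff ℝ ∞ f := by
  rw [contDiff_pi]
  intro i; fin_cases i <;> assumption

section

variable {E : Type*} [NormedAddCommGroup E] [NormedSpace ℝ E] {n : E → E5} {x : E → C4}

theorem contDiff_clifford_apply (hn : ContDiff ℝ ∞ n) (hx : ContDiff ℝ ∞ x) :
    ContDiff ℝ ∞ fun e => clifford (n e) (x e) := by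
  refine contDiff_vec4 ?_ ?_ ?_ ?_ <;>
  simp only [clifford, LinearMap.coe_mk, AddHom.coe_mk, Matrix.cons_val] <;> fun_prop

theorem contDiff_symp_apply (hx : ContDiff ℝ ∞ x) : ContDiff ℝ ∞ fun e => symp (x e) := by
  refine contDiff_vec4 ?_ ?_ ?_ ?_ <;>
  simp only [symp, LinearMap.coe_mk, AddHom.coe_mk, Matrix.cons_val] <;> fun_prop

end

theorem contDiff_vec5 {E : Type*} [NormedAddCommGroup E] [NormedSpace ℝ E] {f0 f1 f2 f3 f4 : E → ℝ}
    (h0 : ContDiff ℝ ∞ f0) (h1 : ContDiff ℝ ∞ f1) (h2 : ContDiff ℝ ∞ f2)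
    (h3 : ContDiff ℝ ∞ f3) (h4 : ContDiff ℝ ∞ f4) :
    ContDiff ℝ ∞ (fun x => (!₂[f0 x, f1 x, f2 x, f3 x, f4 x] : E5)) := by
  rw [contDiff_euclidean]
  intro i; fin_cases i <;> assumption

theorem contDiff_normSq4 : ContDiff ℝ ∞ normSq4 := by
  unfold normSq4
  simp only [Complex.sq_norm, Complex.normSq_apply]
  fun_prop

theorem contDiffAt_hopf {x : C4} (hx : x ≠ 0) : ContDiffAt ℝ ∞ hopf x := by
  refine ContDiffAt.smul (contDiff_normSq4.contDiffAt.inv (normSq4_pos hx).ne') ?_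
  refine ContDiff.contDiffAt (contDiff_vec5 ?_ ?_ ?_ ?_ ?_) <;>
    (try simp only [Complex.sq_norm, Complex.normSq_apply]) <;> fun_prop

theorem contDiffAt_pairVec {w : C4 × C4} (hx : w.1 ≠ 0) :
    ContDiffAt ℝ ∞ (fun w : C4 × C4 => pairVec w.1 w.2) w := by
  refine ContDiffAt.smul (((contDiff_normSq4.comp contDiff_fst).contDiffAt).inv
    (normSq4_pos hx).ne') ?_
  refine ContDiff.contDiffAt (contDiff_vec5 ?_ ?_ ?_ ?_ ?_) <;> fun_prop

/-! ### The projections to `S⁴` -/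

theorem norm_reflect (p : S4) (n : E5) :
    ‖(2 * inner ℝ (p : E5) n / ‖n‖ ^ 2) • n - (p : E5)‖ = 1 := by
  rcases eq_or_ne n 0 with rfl | hn
  · simp
  have h0 := norm_ne_zero_iff.2 hn
  have : ‖(2 * inner ℝ (p : E5) n / ‖n‖ ^ 2) • n - (p : E5)‖ ^ 2 = 1 := by
    rw [norm_sub_sq_real, norm_smul, inner_smul_left, S4.norm_coe, real_inner_comm, mul_pow,
      Real.norm_eq_abs, sq_abs]
    simp only [RCLike.conj_to_real]
    rw [real_inner_comm]
    field_simp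
    ring
  nlinarith [norm_nonneg ((2 * inner ℝ (p : E5) n / ‖n‖ ^ 2) • n - (p : E5))]

/-- The reflection of `p` in the line `ℝ n`. It is `-p` in the junk case `n = 0`. -/
def reflect (w : S4 × E5) : S4 :=
  ⟨(2 * inner ℝ (w.1 : E5) w.2 / ‖w.2‖ ^ 2) • w.2 - (w.1 : E5), by
    simpa using norm_reflect w.1 w.2⟩

theorem coe_reflect (w : S4 × E5) :
    (reflect w : E5) = (2 * inner ℝ (w.1 : E5) w.2 / ‖w.2‖ ^ 2) • w.2 - (w.1 : E5) := rfl

theorem inner_reflect {w : S4 × E5} (h : w.2 ≠ 0) :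
    inner ℝ (reflect w : E5) w.2 = inner ℝ (w.1 : E5) w.2 := by
  have h0 := norm_ne_zero_iff.2 h
  rw [coe_reflect, inner_sub_left, inner_smul_left, real_inner_self_eq_norm_sq]
  simp only [RCLike.conj_to_real]
  field_simp
  ring

theorem reflect_reflect {w : S4 × E5} (h : w.2 ≠ 0) : reflect (reflect w, w.2) = w.1 := by
  apply Subtype.ext
  rw [coe_reflect]
  simp only
  rw [inner_reflect h, coe_reflect, sub_sub_cancel]

theorem reflect_smul {w : S4 × E5} {r : ℝ} (hr : r ≠ 0) :
    reflect (w.1, r • w.2) = reflect w := by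
  rcases eq_or_ne w.2 0 with h | h
  · rw [h, smul_zero, ← h]
  have h0 := norm_ne_zero_iff.2 h
  apply Subtype.ext
  rw [coe_reflect, coe_reflect]
  simp only [inner_smul_right, norm_smul, mul_pow, Real.norm_eq_abs, sq_abs, smul_smul]
  congr 2
  field_simp

theorem contMDiffAt_reflect {w : S4 × E5} (h : w.2 ≠ 0) :
    ContMDiffAt ((𝓡 4).prod 𝓘(ℝ, E5)) (𝓡 4) ∞ reflect w := by
  apply contMDiffAt_S4
  have h1 : ContDiffAt ℝ ∞ (fun w : E5 × E5 => (2 * inner ℝ w.1 w.2 / ‖w.2‖ ^ 2) • w.2 - w.1)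
      ((w.1 : E5), w.2) := by
    have h0 : ContDiffAt ℝ ∞ (fun w : E5 × E5 => 2 * inner ℝ w.1 w.2 / ‖w.2‖ ^ 2)
        ((w.1 : E5), w.2) := by
      refine ContDiffAt.div ?_ ?_ ?_
      · exact (contDiff_const.mul (contDiff_fst.inner ℝ contDiff_snd)).contDiffAt
      · exact (contDiff_snd.norm_sq ℝ).contDiffAt
      · exact pow_ne_zero 2 (norm_ne_zero_iff.2 h)
    exact (h0.smul (contDiff_snd (𝕜 := ℝ)).contDiffAt).sub (contDiff_fst (𝕜 := ℝ)).contDiffAt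
  have h2 : ContMDiff ((𝓡 4).prod 𝓘(ℝ, E5)) 𝓘(ℝ, E5 × E5) ∞
      (fun w : S4 × E5 => ((w.1 : E5), w.2)) :=
    (contMDiff_coe_S4.comp contMDiff_fst).prodMk_space contMDiff_snd
  exact ContMDiffAt.comp (g := fun w : E5 × E5 => (2 * inner ℝ w.1 w.2 / ‖w.2‖ ^ 2) • w.2 - w.1)
    w h1.contMDiffAt h2.contMDiffAt

/-- The projection `π₁`, which maps the line of `(p, n)` to `p`. -/
def proj₁ (l : RealLine) : S4 := (lineRep l).1

/-- The projection `π₂`, which maps the line of `(p, n)` to the reflection of `p` in `ℝ n`. -/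
def proj₂ (l : RealLine) : S4 := reflect (lineRep l)

theorem proj₁_lineMap {w : S4 × E5} (h : w.2 ≠ 0) : proj₁ (lineMap w) = w.1 :=
  (lineRep_lineMap h).1

theorem proj₂_lineMap {w : S4 × E5} (h : w.2 ≠ 0) : proj₂ (lineMap w) = reflect w := by
  obtain ⟨h1, r, hr, h2⟩ := lineRep_lineMap h
  rw [← reflect_smul hr, ← h1, ← h2]
  rfl

theorem contMDiff_proj₁ : ContMDiff (𝓡 8) (𝓡 4) ∞ proj₁ := by
  intro l
  obtain ⟨w, hw, rfl⟩ := exists_lineMap l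
  refine contMDiffAt_of_comp_lineMap hw (contMDiffAt_fst.congr_of_eventuallyEq ?_)
  filter_upwards [isOpen_snd_ne_zero.mem_nhds hw] with w' hw' using proj₁_lineMap hw'

theorem contMDiff_proj₂ : ContMDiff (𝓡 8) (𝓡 4) ∞ proj₂ := by
  intro l
  obtain ⟨w, hw, rfl⟩ := exists_lineMap l
  refine contMDiffAt_of_comp_lineMap hw ((contMDiffAt_reflect hw).congr_of_eventuallyEq ?_)
  filter_upwards [isOpen_snd_ne_zero.mem_nhds hw] with w' hw' using proj₂_lineMap hw'

/-- If `p` fixes `x`, the reflection of `p` in `ℝ n` fixes `n x`: multiply `n p + p n = 2 ⟨p, n⟩` by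
`n / |n|²` from the right. -/
theorem clifford_reflect {w : S4 × E5} (hw : w.2 ≠ 0) {x : C4} (h : clifford w.1 x = x) :
    clifford (reflect w) (clifford w.2 x) = clifford w.2 x := by
  have h0 := norm_ne_zero_iff.2 hw
  have h1 := clifford_clifford w.1 w.2 x
  rw [h] at h1
  have h2 : (reflect w : E5) = (2 * inner ℝ (w.1 : E5) w.2 / ‖w.2‖ ^ 2) • w.2
      + (-1 : ℝ) • (w.1 : E5) := by
    rw [coe_reflect, neg_one_smul, sub_eq_add_neg]
  rw [h2, clifford_add, clifford_smul, clifford_smul, clifford_self, smul_smul,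
    ← Complex.ofReal_mul, div_mul_cancel₀ _ (pow_ne_zero 2 h0), ← h1]
  simp

theorem proj_eq_hopf (l : RealLine) (x y : C4) (hx : x ≠ 0) (hy : y ≠ 0)
    (h : (Projectivization.mk ℂ x hx, Projectivization.mk ℂ y hy) ∈ l.carrier) :
    (proj₁ l : E5) = hopf x ∧ (proj₂ l : E5) = hopf (star y) := by
  obtain ⟨w, hw, rfl⟩ := exists_lineMap l
  rw [proj₁_lineMap hw, proj₂_lineMap hw]
  rw [lineMap_of_ne hw] at h
  obtain ⟨h1, c, rfl⟩ := (mk_mem_lineCarrier hw hx hy).1 h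
  refine ⟨(hopf_eq_of_clifford_eq hx h1).symm, (hopf_eq_of_clifford_eq (by simpa using hy) ?_).symm⟩
  rw [star_smul, star_symp, map_smul, clifford_sigma, clifford_reflect hw h1]

/-! ### Submersions onto sets of real lines -/

/-- A map `q` to the real lines is a submersion onto `T` if it lifts to a smooth map `G` to the
pairs `(p, n)` such that, locally, `G` has a smooth one-sided inverse `K` up to rescaling of `n`:
local sections of `q` are then the composition of `K` with local sections of `lineMap`. -/
theorem isSubmersionOnto_of_lift {EN HN N : Type*} [NormedAddCommGroup EN] [NormedSpace ℝ EN]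
    [TopologicalSpace HN] [TopologicalSpace N] [ChartedSpace HN N]
    {IN : ModelWithCorners ℝ EN HN} {S : Set N} {T : Set RealLine} {q : S → RealLine}
    (G : N → S4 × E5) (hG : ContMDiffOn IN ((𝓡 4).prod 𝓘(ℝ, E5)) ∞ G S)
    (hG0 : ∀ s ∈ S, (G s).2 ≠ 0) (hq : ∀ s : S, q s = lineMap (G s))
    (hT : ∀ s ∈ S, lineMap (G s) ∈ T)
    (hS : ∀ w, w.2 ≠ 0 → lineMap w ∈ T → ∃ s ∈ S, lineMap (G s) = lineMap w)
    (hK : ∀ s ∈ S, ∃ (V : Set (S4 × E5)) (K : S4 × E5 → N), IsOpen V ∧ G s ∈ V ∧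
      ContMDiffOn ((𝓡 4).prod 𝓘(ℝ, E5)) IN ∞ K (V ∩ {w | w.2 ≠ 0 ∧ lineMap w ∈ T}) ∧
      K (G s) = s ∧ ∀ w ∈ V, w.2 ≠ 0 → lineMap w ∈ T → K w ∈ S ∧ lineMap (G (K w)) = lineMap w) :
    IsSubmersionOnto IN (𝓡 8) S T q where
  range_eq := by
    ext l
    constructor
    · rintro ⟨s, rfl⟩
      rw [hq]; exact hT s s.2
    · intro hl
      obtain ⟨w, hw, rfl⟩ := exists_lineMap l
      obtain ⟨s, hs, h⟩ := hS w hw hl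
      exact ⟨⟨s, hs⟩, by rw [hq, h]⟩
  smooth := ⟨fun s => lineMap (G s), fun s hs =>
    (contMDiffAt_lineMap (hG0 s hs)).comp_contMDiffWithinAt s (hG s hs), fun s => (hq s).symm⟩
  sections := by
    rintro ⟨s, hs⟩
    obtain ⟨V, K, hV, hsV, hK, hKs, hKV⟩ := hK s hs
    obtain ⟨U, r, hU, hsU, hr, hrs, hrU⟩ := exists_local_section (hG0 s hs)
    refine ⟨U ∩ r ⁻¹' V, fun l => K (r l), hr.continuousOn.isOpen_inter_preimage hU hV, ?_, ?_, ?_,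
      ?_⟩
    · rw [hq]
      exact ⟨hsU, by rwa [Set.mem_preimage, hrs]⟩
    · refine hK.comp (hr.mono fun l hl => hl.1.1) ?_
      rintro l ⟨⟨hlU, hlV⟩, hlT⟩
      exact ⟨hlV, (hrU l hlU).1, by rwa [(hrU l hlU).2]⟩
    · rw [hq]
      simp only [hrs, hKs]
    · rintro l ⟨⟨hlU, hlV⟩, hlT⟩
      obtain ⟨h1, h2⟩ := hKV (r l) hlV (hrU l hlU).1 (by rwa [(hrU l hlU).2])
      exact ⟨h1, by rw [hq, h2, (hrU l hlU).2]⟩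

/-! ### The parametrization of the real lines by pairs `(x, y)` -/

open Classical in
/-- The Hopf map as a map to the manifold `S⁴`, with an arbitrary value at `0`. -/
def hopfS4 (x : C4) : S4 :=
  if h : x = 0 then ⟨EuclideanSpace.single 0 1, by simp⟩ else ⟨hopf x, by simpa using norm_hopf h⟩

theorem coe_hopfS4 {x : C4} (h : x ≠ 0) : (hopfS4 x : E5) = hopf x := by
  rw [hopfS4, dif_neg h]

theorem contMDiffAt_hopfS4 {x : C4} (h : x ≠ 0) : ContMDiffAt 𝓘(ℝ, C4) (𝓡 4) ∞ hopfS4 x := by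
  apply contMDiffAt_S4
  refine (contDiffAt_hopf h).contMDiffAt.congr_of_eventuallyEq ?_
  filter_upwards [isOpen_ne.mem_nhds h] with y hy using coe_hopfS4 hy

/-- The real line `ζ ↦ ([x + ζ σ(x)],[y + ζ σ(y)])` of a pair `(x, y)` in `realParams`. -/
def paramLine (s : realParams) : RealLine := lineMap (hopfS4 s.1.1, pairVec s.1.1 s.1.2)

theorem paramLine_carrier (s : realParams) :
    (paramLine s).carrier = lineSet (realPencil s.1.1) (realPencil s.1.2) := by
  rw [lineSet_of_mem_realParams s.2, paramLine, lineMap_of_ne (pairVec_ne_zero s.2),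
    ← coe_hopfS4 s.2.1]
  rfl

/-- The projection of `x` to the `+1`-eigenspace of Clifford multiplication by `p`. -/
def eigenProj (x : C4) (p : E5) : C4 := (2⁻¹ : ℂ) • (x + clifford p x)

theorem clifford_eigenProj (x : C4) (p : S4) : clifford p (eigenProj x p) = eigenProj x p := by
  rw [eigenProj, map_smul, map_add, clifford_self, S4.norm_coe]
  simp [add_comm]

theorem eigenProj_of_clifford_eq {x : C4} {p : E5} (h : clifford p x = x) : eigenProj x p = x := by
  rw [eigenProj, h, ← two_smul ℂ, smul_smul, inv_mul_cancel₀ two_ne_zero, one_smul]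

theorem contDiff_eigenProj (x : C4) : ContDiff ℝ ∞ (eigenProj x) :=
  (contDiff_const.add (contDiff_clifford_apply contDiff_id contDiff_const)).const_smul (2⁻¹ : ℂ)

/-- A local section of the parametrization near the line of a pair `(x, y)`: for `(p, n)` close to
the pair `(hopf x, pairVec x y)`, the vector `x` is projected to the eigenspace of `p`. -/
def paramSection (x : C4) (w : S4 × E5) : C4 × C4 :=
  (eigenProj x w.1, symp (clifford w.2 (eigenProj x w.1)))

theorem contMDiff_coe_prod : ContMDiff ((𝓡 4).prod 𝓘(ℝ, E5)) 𝓘(ℝ, E5 × E5) ∞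
    (fun w : S4 × E5 => ((w.1 : E5), w.2)) :=
  (contMDiff_coe_S4.comp contMDiff_fst).prodMk_space contMDiff_snd

theorem contMDiff_paramSection (x : C4) :
    ContMDiff ((𝓡 4).prod 𝓘(ℝ, E5)) 𝓘(ℝ, C4 × C4) ∞ (paramSection x) := by
  have h1 : ContDiff ℝ ∞ (fun w : E5 × E5 => eigenProj x w.1) :=
    (contDiff_eigenProj x).comp contDiff_fst
  have h3 : ContDiff ℝ ∞ (fun w : E5 × E5 => symp (clifford w.2 (eigenProj x w.1))) :=
    contDiff_symp_apply (contDiff_clifford_apply contDiff_snd h1)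
  have h4 := (h1.prodMk h3).contMDiff.comp contMDiff_coe_prod
  unfold paramSection
  simpa only [Function.comp_def] using h4

/-- The pair `(p, n)` of the line of `(x, y)`. -/
def paramBase (s : C4 × C4) : S4 × E5 := (hopfS4 s.1, pairVec s.1 s.2)

theorem paramBase_symp_clifford {w : S4 × E5} {x : C4} (hx : x ≠ 0) (h : clifford w.1 x = x) :
    paramBase (x, symp (clifford w.2 x)) = w :=
  Prod.ext (Subtype.ext ((coe_hopfS4 hx).trans (hopf_eq_of_clifford_eq hx h)))
    (pairVec_symp_clifford w.2 hx)

theorem paramSection_paramBase {s : C4 × C4} (hs : s ∈ realParams) :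
    paramSection s.1 (paramBase s) = s := by
  have h : clifford (hopfS4 s.1) s.1 = s.1 := by rw [coe_hopfS4 hs.1, clifford_hopf hs.1]
  rw [paramSection, paramBase, eigenProj_of_clifford_eq h,
    symp_clifford_pairVec hs.1 hs.2.2.1 hs.2.2.2]

theorem contMDiffAt_paramBase {s : C4 × C4} (hs : s.1 ≠ 0) :
    ContMDiffAt 𝓘(ℝ, C4 × C4) ((𝓡 4).prod 𝓘(ℝ, E5)) ∞ paramBase s := by
  refine ContMDiffAt.prodMk ?_ ?_
  · exact (contMDiffAt_hopfS4 hs).comp s contDiff_fst.contMDiff.contMDiffAt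
  · exact (contDiffAt_pairVec hs).contMDiffAt

theorem isSubmersionOnto_paramLine :
    IsSubmersionOnto 𝓘(ℝ, C4 × C4) (𝓡 8) realParams Set.univ paramLine := by
  refine isSubmersionOnto_of_lift paramBase
    (fun s hs => (contMDiffAt_paramBase hs.1).contMDiffWithinAt)
    (fun s hs => pairVec_ne_zero hs) (fun s => rfl) (fun _ _ => trivial) ?_ ?_
  · intro w hw _
    obtain ⟨x, hx, h⟩ := exists_clifford_eq (S4.norm_coe w.1)
    exact ⟨_, symp_clifford_mem_realParams hw hx, by rw [paramBase_symp_clifford hx h]⟩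
  · intro s hs
    refine ⟨{w | eigenProj s.1 w.1 ≠ 0}, paramSection s.1, isOpen_ne_fun ?_ continuous_const,
      ?_, (contMDiff_paramSection s.1).contMDiffOn, paramSection_paramBase hs, ?_⟩
    · exact (contDiff_eigenProj s.1).continuous.comp (continuous_subtype_val.comp continuous_fst)
    · change (paramSection s.1 (paramBase s)).1 ≠ 0
      rw [paramSection_paramBase hs]
      exact hs.1
    · intro w hwV hw _
      exact ⟨symp_clifford_mem_realParams hw hwV, congrArg lineMap
        (paramBase_symp_clifford hwV (clifford_eigenProj s.1 w.1))⟩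

/-! ### The exchange of the two projections, and the bundles of projective spaces -/

/-- The involution `(p, n) ↦ (p', n)`, with `p'` the reflection of `p` in `ℝ n`. It induces the
involution of `X` that exchanges `π₁` and `π₂`. -/
def exchange (w : S4 × E5) : S4 × E5 := (reflect w, w.2)

theorem exchange_exchange {w : S4 × E5} (h : w.2 ≠ 0) : exchange (exchange w) = w :=
  Prod.ext (reflect_reflect h) rfl

theorem contMDiffAt_exchange {w : S4 × E5} (h : w.2 ≠ 0) :
    ContMDiffAt ((𝓡 4).prod 𝓘(ℝ, E5)) ((𝓡 4).prod 𝓘(ℝ, E5)) ∞ exchange w :=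
  (contMDiffAt_reflect h).prodMk contMDiffAt_snd

theorem proj₂_exchange {w : S4 × E5} (h : w.2 ≠ 0) : proj₂ (lineMap (exchange w)) = w.1 :=
  (proj₂_lineMap (w := exchange w) h).trans (reflect_reflect h)

theorem lineMap_exchange_eq_iff {w w' : S4 × E5} (h : w.2 ≠ 0) (h' : w'.2 ≠ 0) :
    lineMap (exchange w) = lineMap (exchange w') ↔ lineMap w = lineMap w' := by
  have key : ∀ {w w' : S4 × E5}, w.2 ≠ 0 → w'.2 ≠ 0 → lineMap w = lineMap w' →
      lineMap (exchange w) = lineMap (exchange w') := by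
    intro w w' h h' he
    obtain ⟨h1, r, hr, h2⟩ := (lineMap_eq_iff h h').1 he
    refine (lineMap_eq_iff (w := exchange w) (w' := exchange w') h h').2 ⟨?_, r, hr, h2⟩
    change reflect w = reflect w'
    rw [← reflect_smul hr, ← h2, h1]
  refine ⟨fun he => ?_, key h h'⟩
  have := key (w := exchange w) (w' := exchange w') h h' he
  rwa [exchange_exchange h, exchange_exchange h'] at this

/-- The projective bundle is globally trivial: `G` is the identity or the exchange of the two
projections, and `(p, [n]) ↦ lineMap (G (p, n))` is a trivialization. -/
theorem isRealProjectiveSpaceBundle_of_lift {pr : RealLine → S4} (G : S4 × E5 → S4 × E5)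
    (hG : ∀ w, w.2 ≠ 0 → ContMDiffAt ((𝓡 4).prod 𝓘(ℝ, E5)) ((𝓡 4).prod 𝓘(ℝ, E5)) ∞ G w)
    (hG2 : ∀ w, (G w).2 = w.2) (hGG : ∀ w, w.2 ≠ 0 → G (G w) = w)
    (hiff : ∀ w w', w.2 ≠ 0 → w'.2 ≠ 0 →
      (lineMap (G w) = lineMap (G w') ↔ lineMap w = lineMap w'))
    (hpr : ∀ w, w.2 ≠ 0 → pr (lineMap (G w)) = w.1) :
    IsRealProjectiveSpaceBundle (𝓡 4) (𝓡 8) 4 pr := by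
  intro b
  refine ⟨Set.univ, isOpen_univ, trivial, fun w => lineMap (G w.1), ?_, fun w => hpr _ w.2.2,
    fun w w' => (hiff _ _ w.2.2 w'.2.2).trans (lineMap_eq_iff w.2.2 w'.2.2)⟩
  refine isSubmersionOnto_of_lift G (fun w hw => (hG w hw.2).contMDiffWithinAt)
    (fun w hw => by rw [hG2]; exact hw.2) (fun _ => rfl) (fun _ _ => trivial) ?_ ?_
  · intro w hw _
    exact ⟨G w, ⟨trivial, by rwa [hG2]⟩, by rw [hGG w hw]⟩
  · intro w hw
    refine ⟨Set.univ, G, isOpen_univ, trivial, fun w hw => (hG w hw.2.1).contMDiffWithinAt,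
      hGG w hw.2, fun w _ hw _ => ⟨⟨trivial, by rwa [hG2]⟩, by rw [hGG w hw]⟩⟩

theorem isRealProjectiveSpaceBundle_proj₁ :
    IsRealProjectiveSpaceBundle (𝓡 4) (𝓡 8) 4 proj₁ :=
  isRealProjectiveSpaceBundle_of_lift id (fun _ _ => contMDiffAt_id) (fun _ => rfl)
    (fun _ _ => rfl) (fun _ _ _ _ => Iff.rfl) fun _ h => proj₁_lineMap h

theorem isRealProjectiveSpaceBundle_proj₂ :
    IsRealProjectiveSpaceBundle (𝓡 4) (𝓡 8) 4 proj₂ :=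
  isRealProjectiveSpaceBundle_of_lift exchange (fun _ h => contMDiffAt_exchange h) (fun _ => rfl)
    (fun _ h => exchange_exchange h) (fun _ _ h h' => lineMap_exchange_eq_iff h h')
    fun _ h => proj₂_exchange h

/-! ### The cotangent bundle of `S⁴` -/

/-- The differential at `p` of the inclusion `S⁴ → ℝ⁵`. -/
def dIncl (p : S4) : TangentSpace (𝓡 4) p →L[ℝ] E5 := mvfderiv (𝓡 4) ((↑) : S4 → E5) p

theorem range_dIncl (p : S4) : (dIncl p).range = (ℝ ∙ (p : E5))ᗮ :=
  haveI := finrank_E5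
  range_mvfderiv_subtypeVal p

/-- The trivialization of the tangent bundle of `S⁴` around `p₀`. -/
abbrev tangentTriv (p₀ : S4) : Bundle.Trivialization E4
    (Bundle.TotalSpace.proj : Bundle.TotalSpace E4 (TangentSpace (𝓡 4) : S4 → Type) → S4) :=
  trivializationAt E4 (TangentSpace (𝓡 4)) p₀

/-- The differential at `p` of the inclusion `S⁴ → ℝ⁵`, in the trivialization of the tangent bundle
around `p₀`. -/
def dInclAt (p₀ p : S4) : E4 →L[ℝ] E5 := (dIncl p).comp ((tangentTriv p₀).symmL ℝ p)

theorem contMDiffAt_dInclAt (p₀ : S4) : ContMDiffAt (𝓡 4) 𝓘(ℝ, E4 →L[ℝ] E5) ∞ (dInclAt p₀) p₀ := by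
  have h := ContMDiffAt.mfderiv_const (m := ∞) (contMDiff_coe_S4.contMDiffAt (x := p₀)) (by simp)
  refine h.congr_of_eventuallyEq (Filter.Eventually.of_forall fun p => ?_)
  have e :
    (trivializationAt E5 (TangentSpace 𝓘(ℝ, E5)) (p₀ : E5)).continuousLinearMapAt ℝ (p : E5) =
    (1 : E5 →L[ℝ] E5) := TangentBundle.continuousLinearMapAt_model_space _ _
  exact ContinuousLinearMap.ext fun y =>
    (congrArg (fun L : E5 →L[ℝ] E5 => L (dInclAt p₀ p y)) e).symm

section CovectorMap

variable {V W : Type*} [NormedAddCommGroup V] [InnerProductSpace ℝ V] [NormedAddCommGroup W]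
  [NormedSpace ℝ W]

/-- The inner product of a real inner product space as a linear map to the dual space. -/
def innerDual : V →L[ℝ] V →L[ℝ] ℝ := innerSL ℝ

/-- For `p : V` and `D : W → V`, the map `V → W* ⊕ ℝ`, `n ↦ (⟨n, D ·⟩, ⟨p, n⟩)`. -/
def covectorMap (p : V) (D : W →L[ℝ] V) : V →L[ℝ] (W →L[ℝ] ℝ) × ℝ :=
  (ContinuousLinearMap.inl ℝ (W →L[ℝ] ℝ) ℝ).comp
      ((D.precomp ℝ).comp innerDual) +
    (ContinuousLinearMap.inr ℝ (W →L[ℝ] ℝ) ℝ).comp (innerDual p)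

theorem covectorMap_apply (p : V) (D : W →L[ℝ] V) (n : V) :
    covectorMap p D n = ((innerDual n).comp D, inner ℝ p n) :=
  Prod.ext (add_zero ((innerDual n).comp D)) (zero_add (inner ℝ p n))

set_option synthInstance.maxHeartbeats 200000 in
theorem contMDiffAt_covectorMap {EM HM M : Type*} [NormedAddCommGroup EM] [NormedSpace ℝ EM]
    [TopologicalSpace HM] {I : ModelWithCorners ℝ EM HM} [TopologicalSpace M] [ChartedSpace HM M]
    {p : M → V} {D : M → W →L[ℝ] V} {x : M} (hp : ContMDiffAt I 𝓘(ℝ, V) ∞ p x)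
    (hD : ContMDiffAt I 𝓘(ℝ, W →L[ℝ] V) ∞ D x) :
    ContMDiffAt I 𝓘(ℝ, V →L[ℝ] (W →L[ℝ] ℝ) × ℝ) ∞ (fun m => covectorMap (p m) (D m)) x := by
  have h1 : ContMDiffAt I 𝓘(ℝ, (V →L[ℝ] ℝ) →L[ℝ] (W →L[ℝ] ℝ)) ∞
      (fun m => (D m).precomp ℝ) x := hD.clm_precomp
  have h2 : ContMDiffAt I 𝓘(ℝ, V →L[ℝ] ℝ) ∞ (fun m => innerDual (p m)) x :=
    (innerDual (V := V)).contMDiff.contMDiffAt.comp x hp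
  exact (contMDiffAt_const.clm_comp (h1.clm_comp contMDiffAt_const)).add
    (contMDiffAt_const.clm_comp h2)

end CovectorMap

theorem contMDiffAt_covectorMap_dInclAt (p₀ : S4) :
    ContMDiffAt (𝓡 4) 𝓘(ℝ, E5 →L[ℝ] (E4 →L[ℝ] ℝ) × ℝ) ∞
      (fun p : S4 => covectorMap (p : E5) (dInclAt p₀ p)) p₀ :=
  contMDiffAt_covectorMap contMDiff_coe_S4.contMDiffAt (contMDiffAt_dInclAt p₀)

theorem eq_zero_of_inner_dIncl {p : S4} {n : E5} (h : ∀ y, inner ℝ n (dIncl p y) = 0)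
    (hp : inner ℝ (p : E5) n = 0) : n = 0 := by
  have hn : n ∈ (dIncl p).range := by
    rw [range_dIncl]
    exact Submodule.mem_orthogonal_singleton_iff_inner_right.2 hp
  obtain ⟨y, hy⟩ := hn
  have := h y
  have hy' : dIncl p y = n := hy
  rw [hy'] at this
  exact inner_self_eq_zero.1 this

theorem covectorMap_bijective {p₀ p : S4} (hp : p ∈ (tangentTriv p₀).baseSet) :
    Function.Bijective (covectorMap (p : E5) (dInclAt p₀ p)) := by
  have hi : Function.Injective (covectorMap (p : E5) (dInclAt p₀ p)).toLinearMap := by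
    rw [injective_iff_map_eq_zero]
    intro n hn
    have hn' : ((innerDual n).comp (dInclAt p₀ p), inner ℝ (p : E5) n) =
      (0 : (E4 →L[ℝ] ℝ) × ℝ) := (covectorMap_apply _ _ _).symm.trans hn
    rw [Prod.mk_eq_zero] at hn'
    refine eq_zero_of_inner_dIncl (fun y => ?_) hn'.2
    have := congrArg (fun L => L ((tangentTriv p₀).continuousLinearMapAt ℝ p y)) hn'.1
    change inner ℝ n (dIncl p ((tangentTriv p₀).symmL ℝ p
      ((tangentTriv p₀).continuousLinearMapAt ℝ p y))) = 0 at this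
    rwa [(tangentTriv p₀).symmL_continuousLinearMapAt hp] at this
  have hd : Module.finrank ℝ E5 = Module.finrank ℝ ((E4 →L[ℝ] ℝ) × ℝ) := by
    rw [Module.finrank_prod, ← (InnerProductSpace.toDual ℝ E4).toLinearEquiv.finrank_eq]
    simp
  exact ⟨hi, (LinearMap.injective_iff_surjective_of_finrank_eq_finrank hd).1 hi⟩

/-- The linear map `n ↦ (⟨n, ·⟩, ⟨p, n⟩)` from `ℝ⁵` to the fibre `T*_p S⁴ ⊕ ℝ`; it is an isomorphism
as `ℝ⁵ = T_p S⁴ ⊕ ℝ p`. -/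
def toCovector (p : S4) : E5 →ₗ[ℝ] CotangentSumS4 p where
  toFun n := ((innerDual n).comp (dIncl p), (inner ℝ (p : E5) n : ℝ))
  map_add' m n := by
    rw [inner_add_right, map_add, ContinuousLinearMap.add_comp]; rfl
  map_smul' r n := by
    rw [inner_smul_right, map_smul, ContinuousLinearMap.smul_comp]; rfl

theorem toCovector_bijective (p : S4) : Function.Bijective (toCovector p) := by
  constructor
  · rw [injective_iff_map_eq_zero]
    intro n hn
    have hn' := Prod.mk_eq_zero.1 hn
    exact eq_zero_of_inner_dIncl (fun y => congrArg (fun L => L y) hn'.1) hn'.2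
  · rintro ⟨ξ, a⟩
    have hb : p ∈ (tangentTriv p).baseSet := FiberBundle.mem_baseSet_trivializationAt' p
    obtain ⟨n, hn⟩ := (covectorMap_bijective hb).2
      (((ξ : TangentSpace (𝓡 4) p →L[ℝ] ℝ).comp ((tangentTriv p).symmL ℝ p) : E4 →L[ℝ] ℝ), (a : ℝ))
    have hn' := Prod.mk.inj ((covectorMap_apply _ _ _).symm.trans hn)
    refine ⟨n, Prod.ext (ContinuousLinearMap.ext fun y => ?_) hn'.2⟩
    have := congrArg (fun L => L ((tangentTriv p).continuousLinearMapAt ℝ p y)) hn'.1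
    change inner ℝ n (dIncl p ((tangentTriv p).symmL ℝ p
      ((tangentTriv p).continuousLinearMapAt ℝ p y))) = ξ ((tangentTriv p).symmL ℝ p
      ((tangentTriv p).continuousLinearMapAt ℝ p y)) at this
    rw [(tangentTriv p).symmL_continuousLinearMapAt hb] at this
    exact this

/-- The isomorphism `toCovector p` of `ℝ⁵` with the fibre `T*_p S⁴ ⊕ ℝ`. -/
def covectorEquiv (p : S4) : E5 ≃ₗ[ℝ] CotangentSumS4 p :=
  LinearEquiv.ofBijective (toCovector p) (toCovector_bijective p)

theorem cotangentS4_triv (p₀ p : S4) (ξ : CotangentS4 p) :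
    (trivializationAt (E4 →L[ℝ] ℝ) CotangentS4 p₀ ⟨p, ξ⟩).2 =
      ContinuousLinearMap.comp (ξ : TangentSpace (𝓡 4) p →L[ℝ] ℝ) ((tangentTriv p₀).symmL ℝ p) := by
  rw [hom_trivializationAt_apply]
  simp only [ContinuousLinearMap.inCoordinates]
  ext y
  simp [Bundle.Trivial.fiberBundle_trivializationAt']

theorem cotangentSumS4_triv (p₀ p : S4) (ξ : CotangentSumS4 p) :
    (trivializationAt ((E4 →L[ℝ] ℝ) × ℝ) CotangentSumS4 p₀ ⟨p, ξ⟩).2 =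
      (ContinuousLinearMap.comp (ξ.1 : TangentSpace (𝓡 4) p →L[ℝ] ℝ)
        ((tangentTriv p₀).symmL ℝ p), ξ.2) := by
  refine Prod.ext ?_ ?_
  · exact cotangentS4_triv p₀ p ξ.1
  · rfl


theorem contMDiff_toCovector :
    ContMDiff ((𝓡 4).prod 𝓘(ℝ, E5)) ((𝓡 4).prod 𝓘(ℝ, (E4 →L[ℝ] ℝ) × ℝ)) ∞
      (fun w : S4 × E5 => (⟨w.1, toCovector w.1 w.2⟩ :
        Bundle.TotalSpace ((E4 →L[ℝ] ℝ) × ℝ) CotangentSumS4)) := by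
  intro w
  rw [Bundle.contMDiffAt_totalSpace]
  refine ⟨contMDiffAt_fst, ?_⟩
  have h1 : ContMDiffAt ((𝓡 4).prod 𝓘(ℝ, E5)) 𝓘(ℝ, E5 →L[ℝ] (E4 →L[ℝ] ℝ) × ℝ) ∞
      (fun w' : S4 × E5 => covectorMap (w'.1 : E5) (dInclAt w.1 w'.1)) w :=
    ContMDiffAt.comp (g := fun p : S4 => covectorMap (p : E5) (dInclAt w.1 p)) w
      (contMDiffAt_covectorMap_dInclAt w.1) contMDiffAt_fst
  refine (h1.clm_apply contMDiffAt_snd).congr_of_eventuallyEq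
    (Filter.Eventually.of_forall fun w' => ?_)
  exact (cotangentSumS4_triv w.1 w'.1 _).trans
    (covectorMap_apply (w'.1 : E5) (dInclAt w.1 w'.1) w'.2).symm

theorem contMDiff_toCovector_fst :
    ContMDiff ((𝓡 4).prod 𝓘(ℝ, E5)) ((𝓡 4).prod 𝓘(ℝ, E4 →L[ℝ] ℝ)) ∞
      (fun w : S4 × E5 => (⟨w.1, (toCovector w.1 w.2).1⟩ :
        Bundle.TotalSpace (E4 →L[ℝ] ℝ) CotangentS4)) := by
  intro w
  rw [Bundle.contMDiffAt_totalSpace]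
  refine ⟨contMDiffAt_fst, ?_⟩
  have h1 : ContMDiffAt ((𝓡 4).prod 𝓘(ℝ, E5)) 𝓘(ℝ, E5 →L[ℝ] (E4 →L[ℝ] ℝ) × ℝ) ∞
      (fun w' : S4 × E5 => covectorMap (w'.1 : E5) (dInclAt w.1 w'.1)) w :=
    ContMDiffAt.comp (g := fun p : S4 => covectorMap (p : E5) (dInclAt w.1 p)) w
      (contMDiffAt_covectorMap_dInclAt w.1) contMDiffAt_fst
  refine (contDiff_fst.contMDiff.contMDiffAt.comp w (h1.clm_apply contMDiffAt_snd)
    ).congr_of_eventuallyEq (Filter.Eventually.of_forall fun w' => ?_)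
  exact (cotangentS4_triv w.1 w'.1 _).trans
    (congrArg Prod.fst (covectorMap_apply (w'.1 : E5) (dInclAt w.1 w'.1) w'.2).symm)

theorem covectorMap_covectorEquiv_symm (p₀ : S4) {p : S4} (ξ : CotangentSumS4 p) :
    covectorMap (p : E5) (dInclAt p₀ p) ((covectorEquiv p).symm ξ) =
      (trivializationAt ((E4 →L[ℝ] ℝ) × ℝ) CotangentSumS4 p₀ ⟨p, ξ⟩).2 := by
  obtain ⟨n, rfl⟩ := (covectorEquiv p).surjective ξ
  rw [LinearEquiv.symm_apply_apply, cotangentSumS4_triv]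
  exact covectorMap_apply _ _ _

/-- In the trivializations, the inverse of `toCovector` is the inverse of the operator
`covectorMap`, hence depends smoothly on the point. -/
theorem covectorEquiv_symm_eventually (p₀ : S4) :
    ContMDiffAt (𝓡 4) 𝓘(ℝ, ((E4 →L[ℝ] ℝ) × ℝ) →L[ℝ] E5) ∞
      (fun p : S4 => (covectorMap (p : E5) (dInclAt p₀ p)).inverse) p₀ ∧
    ∀ p ∈ (tangentTriv p₀).baseSet, ∀ ξ : CotangentSumS4 p, (covectorEquiv p).symm ξ =
      (covectorMap (p : E5) (dInclAt p₀ p)).inverse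
        (trivializationAt ((E4 →L[ℝ] ℝ) × ℝ) CotangentSumS4 p₀ ⟨p, ξ⟩).2 := by
  have key : ∀ p ∈ (tangentTriv p₀).baseSet, ∃ e : E5 ≃L[ℝ] ((E4 →L[ℝ] ℝ) × ℝ),
      (e : E5 →L[ℝ] ((E4 →L[ℝ] ℝ) × ℝ)) = covectorMap (p : E5) (dInclAt p₀ p) := fun p hp =>
    ⟨(LinearEquiv.ofBijective (covectorMap (p : E5) (dInclAt p₀ p)).toLinearMap
      (covectorMap_bijective hp)).toContinuousLinearEquiv, rfl⟩
  constructor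
  · obtain ⟨e, he⟩ := key p₀ (FiberBundle.mem_baseSet_trivializationAt' p₀)
    have h := contDiffAt_map_inverse (𝕜 := ℝ) (n := ∞) e
    rw [he] at h
    exact ContMDiffAt.comp (g := ContinuousLinearMap.inverse) p₀ h.contMDiffAt
      (contMDiffAt_covectorMap_dInclAt p₀)
  · intro p hp ξ
    obtain ⟨e, he⟩ := key p hp
    rw [← covectorMap_covectorEquiv_symm, ← he, ContinuousLinearMap.inverse_equiv]
    exact (e.symm_apply_apply _).symm

theorem contMDiff_covectorEquiv_symm :
    ContMDiff ((𝓡 4).prod 𝓘(ℝ, (E4 →L[ℝ] ℝ) × ℝ)) ((𝓡 4).prod 𝓘(ℝ, E5)) ∞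
      (fun v : Bundle.TotalSpace ((E4 →L[ℝ] ℝ) × ℝ) CotangentSumS4 =>
        (v.1, (covectorEquiv v.1).symm v.2)) := by
  intro v
  have hpr : ContMDiffAt ((𝓡 4).prod 𝓘(ℝ, (E4 →L[ℝ] ℝ) × ℝ)) (𝓡 4) ∞
      (fun v : Bundle.TotalSpace ((E4 →L[ℝ] ℝ) × ℝ) CotangentSumS4 => v.1) v :=
    Bundle.contMDiffAt_proj CotangentSumS4
  refine hpr.prodMk ?_
  obtain ⟨h1, h2⟩ := covectorEquiv_symm_eventually v.1
  have h3 := (Bundle.contMDiffAt_totalSpace (f := id)).1 (contMDiffAt_id (x := v)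
    (n := ∞) (I := (𝓡 4).prod 𝓘(ℝ, (E4 →L[ℝ] ℝ) × ℝ)))
  refine ((h1.comp v hpr).clm_apply h3.2).congr_of_eventuallyEq ?_
  filter_upwards [hpr.continuousAt.preimage_mem_nhds ((tangentTriv v.1).open_baseSet.mem_nhds
    (FiberBundle.mem_baseSet_trivializationAt' v.1))] with v' hv'
  exact h2 v'.1 hv' v'.2

theorem contMDiff_covectorEquiv_symm_inl :
    ContMDiff ((𝓡 4).prod 𝓘(ℝ, E4 →L[ℝ] ℝ)) ((𝓡 4).prod 𝓘(ℝ, E5)) ∞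
      (fun v : Bundle.TotalSpace (E4 →L[ℝ] ℝ) CotangentS4 =>
        (v.1, (covectorEquiv v.1).symm (v.2, (0 : ℝ)))) := by
  intro v
  have hpr : ContMDiffAt ((𝓡 4).prod 𝓘(ℝ, E4 →L[ℝ] ℝ)) (𝓡 4) ∞
      (fun v : Bundle.TotalSpace (E4 →L[ℝ] ℝ) CotangentS4 => v.1) v :=
    Bundle.contMDiffAt_proj CotangentS4
  refine hpr.prodMk ?_
  obtain ⟨h1, h2⟩ := covectorEquiv_symm_eventually v.1
  have h3 := (Bundle.contMDiffAt_totalSpace (f := id)).1 (contMDiffAt_id (x := v)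
    (n := ∞) (I := (𝓡 4).prod 𝓘(ℝ, E4 →L[ℝ] ℝ)))
  refine ((h1.comp v hpr).clm_apply (h3.2.prodMk_space
    (contMDiffAt_const (c := (0 : ℝ))))).congr_of_eventuallyEq ?_
  filter_upwards [hpr.continuousAt.preimage_mem_nhds ((tangentTriv v.1).open_baseSet.mem_nhds
    (FiberBundle.mem_baseSet_trivializationAt' v.1))] with v' hv'
  refine (h2 v'.1 hv' (v'.2, (0 : ℝ))).trans ?_
  rw [cotangentSumS4_triv, ← cotangentS4_triv]
  rfl

/-! ### Projectivized bundles of covectors -/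

/-- Let `E` be a vector bundle on `S⁴` and `ι : E → S⁴ × ℝ⁵` a smooth inclusion of vector bundles,
with a smooth left inverse `ρ`. If `T` consists of the lines of the pairs `G (p, n)` with `n` in
the image of `ι`, then `P(E)` is diffeomorphic to `T`. Here `G` is the identity or the exchange of
the two projections, so that the diffeomorphism lies over `π₁` or over `π₂`. -/
theorem isProjBundleDiffeo_of_lift {F : Type*} [NormedAddCommGroup F] [NormedSpace ℝ F]
    {E : S4 → Type*} [∀ b, AddCommGroup (E b)] [∀ b, Module ℝ (E b)]
    [TopologicalSpace (Bundle.TotalSpace F E)] [∀ b, TopologicalSpace (E b)] [FiberBundle F E]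
    {T : Set RealLine} (ι : ∀ p, E p →ₗ[ℝ] E5) (ρ : ∀ p, E5 →ₗ[ℝ] E p)
    (hρι : ∀ p ξ, ρ p (ι p ξ) = ξ)
    (hι : ContMDiff ((𝓡 4).prod 𝓘(ℝ, F)) ((𝓡 4).prod 𝓘(ℝ, E5)) ∞
      (fun v : Bundle.TotalSpace F E => (v.1, ι v.1 v.2)))
    (hρ : ContMDiff ((𝓡 4).prod 𝓘(ℝ, E5)) ((𝓡 4).prod 𝓘(ℝ, F)) ∞
      (fun w : S4 × E5 => (⟨w.1, ρ w.1 w.2⟩ : Bundle.TotalSpace F E)))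
    (G : S4 × E5 → S4 × E5)
    (hG : ∀ w, w.2 ≠ 0 → ContMDiffAt ((𝓡 4).prod 𝓘(ℝ, E5)) ((𝓡 4).prod 𝓘(ℝ, E5)) ∞ G w)
    (hG2 : ∀ w, (G w).2 = w.2) (hGG : ∀ w, w.2 ≠ 0 → G (G w) = w)
    (hiff : ∀ w w', w.2 ≠ 0 → w'.2 ≠ 0 →
      (lineMap (G w) = lineMap (G w') ↔ lineMap w = lineMap w'))
    (hT : ∀ w, w.2 ≠ 0 → (lineMap (G w) ∈ T ↔ ι w.1 (ρ w.1 w.2) = w.2))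
    {pr : RealLine → S4} (hpr : ∀ w, w.2 ≠ 0 → pr (lineMap (G w)) = w.1) :
    ∃ f : ProjBundle E → RealLine,
      IsProjBundleDiffeo (F := F) (𝓡 4) E (𝓡 8) T f ∧ ∀ ξ, pr (f ξ) = ξ.1 := by
  have ι0 : ∀ {p} {ξ : E p}, ξ ≠ 0 → ι p ξ ≠ 0 := fun {p ξ} h h0 =>
    h (by rw [← hρι p ξ, h0, map_zero])
  have hf : ∀ (p : S4) (ξ : E p) (h : ξ ≠ 0),
      lineMap (G (p, ι p (Projectivization.mk ℝ ξ h).rep)) = lineMap (G (p, ι p ξ)) := by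
    intro p ξ h
    obtain ⟨a, ha⟩ := Projectivization.exists_smul_eq_mk_rep ℝ ξ h
    rw [← ha, hiff _ _ (ι0 (smul_ne_zero a.ne_zero h)) (ι0 h), Units.smul_def, map_smul,
      lineMap_smul p (ι0 h) a.ne_zero]
  refine ⟨fun ξ => lineMap (G (ξ.1, ι ξ.1 ξ.2.rep)), ⟨?_, ?_⟩,
    fun ξ => hpr _ (ι0 ξ.2.rep_nonzero)⟩
  · rintro ⟨p, ξ⟩ ⟨p', ξ'⟩ h
    rw [hiff _ _ (ι0 ξ.rep_nonzero) (ι0 ξ'.rep_nonzero),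
      lineMap_eq_iff (ι0 ξ.rep_nonzero) (ι0 ξ'.rep_nonzero)] at h
    obtain ⟨h1, r, hr, h2⟩ := h
    dsimp only at h1
    subst h1
    change ι p ξ'.rep = r • ι p ξ.rep at h2
    have h3 : ξ'.rep = r • ξ.rep := by rw [← hρι _ ξ'.rep, h2, map_smul, hρι]
    congr 1
    rw [← ξ.mk_rep, ← ξ'.mk_rep, Projectivization.mk_eq_mk_iff']
    exact ⟨r⁻¹, by rw [h3, inv_smul_smul₀ hr]⟩
  · have hs : ∀ w : S4 × E5, w.2 ≠ 0 → lineMap w ∈ T →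
        ρ (G w).1 (G w).2 ≠ 0 ∧ G ((G w).1, ι (G w).1 (ρ (G w).1 (G w).2)) = w := by
      intro w hw hwT
      have h1 := (hT (G w) (by rwa [hG2])).1 (by rwa [hGG w hw])
      refine ⟨fun h0 => hw ?_, ?_⟩
      · rw [← hG2 w, ← h1, h0, map_zero]
      · rw [h1]; exact hGG w hw
    refine isSubmersionOnto_of_lift (fun v => G (v.1, ι v.1 v.2)) ?_ ?_ ?_ ?_ ?_ ?_
    · exact fun v hv => ((hG _ (ι0 hv)).comp v hι.contMDiffAt).contMDiffWithinAt
    · intro v hv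
      rw [hG2]; exact ι0 hv
    · exact fun v => hf v.1.1 v.1.2 v.2
    · intro v hv
      rw [hT _ (ι0 hv)]
      exact congrArg _ (hρι _ _)
    · intro w hw hwT
      obtain ⟨h1, h2⟩ := hs w hw hwT
      exact ⟨⟨(G w).1, ρ (G w).1 (G w).2⟩, h1, by simp only [h2]⟩
    · intro v hv
      refine ⟨Set.univ, fun w => ⟨(G w).1, ρ (G w).1 (G w).2⟩, isOpen_univ, trivial, ?_, ?_, ?_⟩
      · rintro w ⟨-, hw, -⟩
        exact (hρ.contMDiffAt.comp w (hG w hw)).contMDiffWithinAt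
      · dsimp only
        rw [hGG (v.1, ι v.1 v.2) (ι0 hv)]
        simp only [hρι]
      · intro w _ hw hwT
        obtain ⟨h1, h2⟩ := hs w hw hwT
        exact ⟨h1, by simp only [h2]⟩

theorem exists_projBundleDiffeo_proj₁ :
    ∃ f : ProjBundle CotangentSumS4 → RealLine,
      IsProjBundleDiffeo (F := (E4 →L[ℝ] ℝ) × ℝ) (𝓡 4) CotangentSumS4 (𝓡 8) Set.univ f ∧
      ∀ ξ, proj₁ (f ξ) = ξ.1 :=
  isProjBundleDiffeo_of_lift (T := Set.univ) (fun p => (covectorEquiv p).symm.toLinearMap)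
    (fun p => (covectorEquiv p).toLinearMap) (fun p => (covectorEquiv p).apply_symm_apply)
    contMDiff_covectorEquiv_symm contMDiff_toCovector id (fun _ _ => contMDiffAt_id)
    (fun _ => rfl) (fun _ _ => rfl) (fun _ _ _ _ => Iff.rfl)
    (fun w _ => ⟨fun _ => (covectorEquiv w.1).symm_apply_apply w.2, fun _ => Set.mem_univ _⟩)
    fun _ h => proj₁_lineMap h

theorem exists_projBundleDiffeo_proj₂ :
    ∃ f : ProjBundle CotangentSumS4 → RealLine,
      IsProjBundleDiffeo (F := (E4 →L[ℝ] ℝ) × ℝ) (𝓡 4) CotangentSumS4 (𝓡 8) Set.univ f ∧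
      ∀ ξ, proj₂ (f ξ) = ξ.1 :=
  isProjBundleDiffeo_of_lift (T := Set.univ) (fun p => (covectorEquiv p).symm.toLinearMap)
    (fun p => (covectorEquiv p).toLinearMap) (fun p => (covectorEquiv p).apply_symm_apply)
    contMDiff_covectorEquiv_symm contMDiff_toCovector exchange (fun _ h => contMDiffAt_exchange h)
    (fun _ => rfl) (fun _ h => exchange_exchange h) (fun _ _ h h' => lineMap_exchange_eq_iff h h')
    (fun w _ => ⟨fun _ => (covectorEquiv w.1).symm_apply_apply w.2, fun _ => Set.mem_univ _⟩)
    fun _ h => proj₂_exchange h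

/-- The reflection of `p` in `ℝ n` is `-p` if and only if `n` is tangent to `S⁴` at `p`. -/
theorem reflect_eq_neg_iff {w : S4 × E5} (hw : w.2 ≠ 0) :
    reflect w = -w.1 ↔ inner ℝ (w.1 : E5) w.2 = 0 := by
  rw [← Subtype.coe_inj, coe_reflect, sub_eq_iff_eq_add]
  have hn : ‖w.2‖ ^ 2 ≠ 0 := pow_ne_zero 2 (norm_ne_zero_iff.2 hw)
  rw [show ((-w.1 : S4) : E5) + (w.1 : E5) = 0 from neg_add_cancel _, smul_eq_zero_iff_left hw,
    div_eq_zero_iff, or_iff_left hn, mul_eq_zero, or_iff_right two_ne_zero]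

theorem exists_projBundleDiffeo_antidiagonal :
    ∃ f : ProjBundle CotangentS4 → RealLine,
      IsProjBundleDiffeo (F := E4 →L[ℝ] ℝ) (𝓡 4) CotangentS4 (𝓡 8)
        {l | proj₂ l = -proj₁ l} f ∧ ∀ ξ, proj₁ (f ξ) = ξ.1 := by
  refine isProjBundleDiffeo_of_lift
    (fun p => (covectorEquiv p).symm.toLinearMap.comp (LinearMap.inl ℝ (CotangentS4 p) ℝ))
    (fun p => (LinearMap.fst ℝ (CotangentS4 p) ℝ).comp (covectorEquiv p).toLinearMap)
    (fun p ξ => congrArg Prod.fst ((covectorEquiv p).apply_symm_apply (ξ, (0 : ℝ))))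
    contMDiff_covectorEquiv_symm_inl contMDiff_toCovector_fst id (fun _ _ => contMDiffAt_id)
    (fun _ => rfl) (fun _ _ => rfl) (fun _ _ _ _ => Iff.rfl) ?_ fun _ h => proj₁_lineMap h
  intro w hw
  have hn : ‖w.2‖ ^ 2 ≠ 0 := pow_ne_zero 2 (norm_ne_zero_iff.2 hw)
  change proj₂ (lineMap w) = -proj₁ (lineMap w) ↔
    (covectorEquiv w.1).symm (((covectorEquiv w.1) w.2).1, (0 : ℝ)) = w.2
  rw [proj₁_lineMap hw, proj₂_lineMap hw, LinearEquiv.symm_apply_eq, reflect_eq_neg_iff hw]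
  exact ⟨fun h => Prod.ext rfl h.symm, fun h => (congrArg Prod.snd h).symm⟩

/-! ### The complement of the antidiagonal -/

theorem S4.add_eq_zero_iff {p p' : S4} : (p : E5) + (p' : E5) = 0 ↔ p' = -p := by
  rw [← Subtype.coe_inj]
  exact add_eq_zero_iff_eq_neg'

theorem reflect_add {p p' : S4} (h : p' ≠ -p) : reflect (p, (p : E5) + p') = p' := by
  have h0 : (p : E5) + p' ≠ 0 := mt S4.add_eq_zero_iff.1 h
  apply Subtype.ext
  rw [coe_reflect]
  have h1 : ‖(p : E5) + p'‖ ^ 2 = 2 * inner ℝ (p : E5) ((p : E5) + p') := by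
    rw [norm_add_sq_real, inner_add_right, S4.inner_self, S4.norm_coe, S4.norm_coe]
    ring
  rw [← h1, div_self (pow_ne_zero 2 (norm_ne_zero_iff.2 h0)), one_smul, add_sub_cancel_left]

/-- If `p` and its reflection `p'` in `ℝ n` are not antipodal, `n` is a multiple of `p + p'`. -/
theorem lineMap_add_reflect {w : S4 × E5} (hw : w.2 ≠ 0) (h : reflect w ≠ -w.1) :
    lineMap (w.1, (w.1 : E5) + reflect w) = lineMap w := by
  rw [coe_reflect, add_sub_cancel]
  refine lineMap_smul w.1 hw (div_ne_zero (mul_ne_zero two_ne_zero ?_)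
    (pow_ne_zero 2 (norm_ne_zero_iff.2 hw)))
  exact mt (reflect_eq_neg_iff hw).2 h

theorem isClosed_antidiagonal : IsClosed {m : S4 × S4 | m.2 = -m.1} :=
  isClosed_eq continuous_snd continuous_fst.neg

/-- Away from the antidiagonal, the inverse of `(pr₁, pr₂)` is `(p, p') ↦ (p, [p + p'])`. -/
def complDiffeo : PartialDiffeomorph (𝓡 8) ((𝓡 4).prod (𝓡 4)) RealLine (S4 × S4) ∞ where
  toFun l := (proj₁ l, proj₂ l)
  invFun m := lineMap (m.1, (m.1 : E5) + m.2)
  source := {l | proj₂ l ≠ -proj₁ l}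
  target := {m | m.2 ≠ -m.1}
  map_source' _ h := h
  map_target' m h := by
    have h0 : (m.1 : E5) + m.2 ≠ 0 := mt S4.add_eq_zero_iff.1 h
    change proj₂ _ ≠ -proj₁ _
    rwa [proj₁_lineMap (w := (m.1, (m.1 : E5) + m.2)) h0,
      proj₂_lineMap (w := (m.1, (m.1 : E5) + m.2)) h0, reflect_add h]
  left_inv' l h := by
    obtain ⟨w, hw, rfl⟩ := exists_lineMap l
    change proj₂ _ ≠ -proj₁ _ at h
    rw [proj₁_lineMap hw, proj₂_lineMap hw] at h
    rw [proj₁_lineMap hw, proj₂_lineMap hw]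
    exact lineMap_add_reflect hw h
  right_inv' m h := by
    have h0 : (m.1 : E5) + m.2 ≠ 0 := mt S4.add_eq_zero_iff.1 h
    rw [proj₁_lineMap (w := (m.1, (m.1 : E5) + m.2)) h0,
      proj₂_lineMap (w := (m.1, (m.1 : E5) + m.2)) h0, reflect_add h]
  open_source := isClosed_antidiagonal.isOpen_compl.preimage
    (contMDiff_proj₁.continuous.prodMk contMDiff_proj₂.continuous)
  open_target := isClosed_antidiagonal.isOpen_compl
  contMDiffOn_toFun := (contMDiff_proj₁.prodMk contMDiff_proj₂).contMDiffOn
  contMDiffOn_invFun m h := by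
    have h0 : (m.1 : E5) + m.2 ≠ 0 := mt S4.add_eq_zero_iff.1 h
    have h1 : ContMDiffAt ((𝓡 4).prod (𝓡 4)) 𝓘(ℝ, E5) ∞
        (fun m : S4 × S4 => (m.1 : E5) + m.2) m :=
      ((contMDiff_coe_S4.comp contMDiff_fst).add (contMDiff_coe_S4.comp contMDiff_snd)).contMDiffAt
    exact (ContMDiffAt.comp (g := lineMap) m (contMDiffAt_lineMap h0)
      (contMDiffAt_fst.prodMk h1)).contMDiffWithinAt

/-! ### Stereographic projection from a moving point -/

/-- The stereographic projection of `p'` from the point `p` to `p^⊥`. -/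
def stereo (p p' : E5) : E5 := (1 - inner ℝ p p')⁻¹ • (p' - inner ℝ p p' • p)

/-- The inverse of the stereographic projection from `p`, which takes `x ∈ p^⊥` to
`p - 2 (p - x) / (1 + |x|²)`. -/
def stereoInv (p : S4) (x : E5) : S4 := -reflect (p, (p : E5) - x)

theorem inner_stereo (p : S4) (p' : E5) : inner ℝ (p : E5) (stereo p p') = 0 := by
  rw [stereo, inner_smul_right, inner_sub_right, inner_smul_right, S4.inner_self, mul_one, sub_self,
    mul_zero]

theorem coe_stereoInv {p : S4} {x : E5} (h : inner ℝ (p : E5) x = 0) :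
    (stereoInv p x : E5) = (p : E5) - (2 / (1 + ‖x‖ ^ 2)) • ((p : E5) - x) := by
  have h1 : inner ℝ (p : E5) ((p : E5) - x) = 1 := by
    rw [inner_sub_right, S4.inner_self, h, sub_zero]
  have h2 : ‖(p : E5) - x‖ ^ 2 = 1 + ‖x‖ ^ 2 := by
    rw [norm_sub_sq_real, h, S4.norm_coe]; ring
  change -(reflect (p, (p : E5) - x) : E5) = _
  rw [coe_reflect]
  simp only
  rw [h1, h2, neg_sub, mul_one]

theorem sub_ne_zero_of_inner_eq_zero {p : S4} {x : E5} (h : inner ℝ (p : E5) x = 0) :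
    (p : E5) - x ≠ 0 := by
  intro h0
  rw [← sub_eq_zero.1 h0, S4.inner_self] at h
  exact one_ne_zero h

theorem stereoInv_ne {p : S4} {x : E5} (h : inner ℝ (p : E5) x = 0) : stereoInv p x ≠ p := by
  intro h1
  have h2 := congrArg ((↑) : S4 → E5) h1
  rw [coe_stereoInv h, sub_eq_self, smul_eq_zero,
    or_iff_left (sub_ne_zero_of_inner_eq_zero h)] at h2
  have : 0 < 2 / (1 + ‖x‖ ^ 2) := by positivity
  exact this.ne' h2

theorem stereo_stereoInv {p : S4} {x : E5} (h : inner ℝ (p : E5) x = 0) :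
    stereo p (stereoInv p x) = x := by
  have hs : 2 / (1 + ‖x‖ ^ 2) ≠ 0 := by positivity
  have h1 : inner ℝ (p : E5) (stereoInv p x : E5) = 1 - 2 / (1 + ‖x‖ ^ 2) := by
    rw [coe_stereoInv h, inner_sub_right, inner_smul_right, inner_sub_right, S4.inner_self, h]
    ring
  rw [stereo, h1, coe_stereoInv h, sub_sub_cancel]
  have h2 : (p : E5) - (2 / (1 + ‖x‖ ^ 2)) • ((p : E5) - x) - (1 - 2 / (1 + ‖x‖ ^ 2)) • (p : E5) =
      (2 / (1 + ‖x‖ ^ 2)) • x := by module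
  rw [h2, inv_smul_smul₀ hs]

theorem S4.inner_ne_one {p p' : S4} (h : p' ≠ p) : 1 - inner ℝ (p : E5) p' ≠ 0 := by
  intro h0
  refine h (Subtype.ext ((inner_eq_one_iff_of_norm_eq_one (𝕜 := ℝ) (S4.norm_coe p)
    (S4.norm_coe p')).1 ?_).symm)
  linarith

theorem stereoInv_stereo {p p' : S4} (h : p' ≠ p) : stereoInv p (stereo p p') = p' := by
  have h0 := S4.inner_ne_one h
  apply Subtype.ext
  rw [coe_stereoInv (inner_stereo p p')]
  have h1 : 1 + ‖stereo p p'‖ ^ 2 = 2 * (1 - inner ℝ (p : E5) p')⁻¹ := by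
    have h3 : ‖(p' : E5) - inner ℝ (p : E5) p' • (p : E5)‖ ^ 2 = 1 - inner ℝ (p : E5) p' ^ 2 := by
      rw [norm_sub_sq_real, norm_smul, inner_smul_right, real_inner_comm, S4.norm_coe, S4.norm_coe,
        mul_one, Real.norm_eq_abs, sq_abs]
      ring
    rw [stereo, norm_smul, mul_pow, h3, Real.norm_eq_abs, sq_abs]
    field_simp
    ring
  have h2 : 2 / (1 + ‖stereo p p'‖ ^ 2) = 1 - inner ℝ (p : E5) p' := by
    rw [h1]; field_simp
  rw [h2, stereo, smul_sub, smul_inv_smul₀ h0]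
  module

theorem stereoInv_zero (p : S4) : stereoInv p 0 = -p := by
  apply Subtype.ext
  rw [coe_stereoInv (inner_zero_right _)]
  change _ = -(p : E5)
  rw [norm_zero]
  module

/-- For `ξ ∈ p^⊥`, the line `ℝ (t |ξ|² p + ξ)` bisects `p` and the point with the stereographic
coordinate `t ξ`. -/
theorem reflect_eq_stereoInv {p : S4} {ξ : E5} (h : inner ℝ (p : E5) ξ = 0) (hξ : ξ ≠ 0) (t : ℝ) :
    reflect (p, (t * ‖ξ‖ ^ 2) • (p : E5) + ξ) = stereoInv p (t • ξ) := by
  have hs : ‖ξ‖ ^ 2 ≠ 0 := pow_ne_zero 2 (norm_ne_zero_iff.2 hξ)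
  have ht : 1 + t ^ 2 * ‖ξ‖ ^ 2 ≠ 0 := by positivity
  apply Subtype.ext
  rw [coe_reflect, coe_stereoInv (by rw [inner_smul_right, h, mul_zero])]
  have h1 : inner ℝ (p : E5) ((t * ‖ξ‖ ^ 2) • (p : E5) + ξ) = t * ‖ξ‖ ^ 2 := by
    rw [inner_add_right, inner_smul_right, S4.inner_self, h]; ring
  have h2 : ‖(t * ‖ξ‖ ^ 2) • (p : E5) + ξ‖ ^ 2 = ‖ξ‖ ^ 2 * (1 + t ^ 2 * ‖ξ‖ ^ 2) := by
    rw [norm_add_sq_real, norm_smul, inner_smul_left, h, S4.norm_coe, mul_one, Real.norm_eq_abs,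
      sq_abs]
    ring
  have h3 : ‖t • ξ‖ ^ 2 = t ^ 2 * ‖ξ‖ ^ 2 := by
    rw [norm_smul, mul_pow, Real.norm_eq_abs, sq_abs]
  simp only
  rw [h1, h2, h3]
  match_scalars
  · field_simp
    ring
  · field_simp

theorem contDiffAt_stereo {w : E5 × E5} (h : 1 - inner ℝ w.1 w.2 ≠ 0) :
    ContDiffAt ℝ ∞ (fun w : E5 × E5 => stereo w.1 w.2) w := by
  have h1 : ContDiff ℝ ∞ (Prod.fst : E5 × E5 → E5) := contDiff_fst
  have h2 : ContDiff ℝ ∞ (Prod.snd : E5 × E5 → E5) := contDiff_snd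
  have h3 : ContDiff ℝ ∞ (fun w : E5 × E5 => inner ℝ w.1 w.2) := h1.inner ℝ h2
  have h4 : ContDiffAt ℝ ∞ (fun w : E5 × E5 => (1 - inner ℝ w.1 w.2)⁻¹) w :=
    ((contDiff_const.sub h3).contDiffAt).inv h
  exact h4.smul (h2.sub (h3.smul h1)).contDiffAt

theorem contMDiffAt_stereo {EM HM M : Type*} [NormedAddCommGroup EM] [NormedSpace ℝ EM]
    [TopologicalSpace HM] {I : ModelWithCorners ℝ EM HM} [TopologicalSpace M] [ChartedSpace HM M]
    {f g : M → S4} {x : M} (hf : ContMDiffAt I (𝓡 4) ∞ f x) (hg : ContMDiffAt I (𝓡 4) ∞ g x)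
    (h : g x ≠ f x) : ContMDiffAt I 𝓘(ℝ, E5) ∞ (fun m => stereo (f m) (g m)) x := by
  have h1 : ContMDiffAt I 𝓘(ℝ, E5 × E5) ∞ (fun m => ((f m : E5), (g m : E5))) x :=
    (contMDiff_coe_S4.contMDiffAt.comp x hf).prodMk_space (contMDiff_coe_S4.contMDiffAt.comp x hg)
  have h2 : ContMDiffAt 𝓘(ℝ, E5 × E5) 𝓘(ℝ, E5) ∞ (fun w : E5 × E5 => stereo w.1 w.2)
      ((f x : E5), (g x : E5)) := (contDiffAt_stereo (S4.inner_ne_one h)).contMDiffAt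
  exact ContMDiffAt.comp (f := fun m => ((f m : E5), (g m : E5)))
    (g := fun w : E5 × E5 => stereo w.1 w.2) x h2 h1

theorem contMDiffAt_stereoInv {w : S4 × E5} (h : inner ℝ (w.1 : E5) w.2 = 0) :
    ContMDiffAt ((𝓡 4).prod 𝓘(ℝ, E5)) (𝓡 4) ∞ (fun w : S4 × E5 => stereoInv w.1 w.2) w := by
  apply contMDiffAt_S4
  have h1 : ContMDiffAt ((𝓡 4).prod 𝓘(ℝ, E5)) ((𝓡 4).prod 𝓘(ℝ, E5)) ∞
      (fun w : S4 × E5 => (w.1, (w.1 : E5) - w.2)) w :=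
    contMDiffAt_fst.prodMk ((contMDiff_coe_S4.comp contMDiff_fst).sub contMDiff_snd).contMDiffAt
  have h2 : ContMDiffAt ((𝓡 4).prod 𝓘(ℝ, E5)) (𝓡 4) ∞ reflect (w.1, (w.1 : E5) - w.2) :=
    contMDiffAt_reflect (sub_ne_zero_of_inner_eq_zero h)
  exact (contMDiff_coe_S4.contMDiffAt.comp w (ContMDiffAt.comp (g := reflect) w h2 h1)).neg

/-! ### The blow-up of the antidiagonal -/

/-- For `⟨p₀, p⟩ ≠ 0`, the inverse of the restriction of `perpCoord p₀` to `p^⊥`. -/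
def perpLift (p₀ : S4) (p : E5) (y : E4) : E5 :=
  perpIncl p₀ y - (inner ℝ p (perpIncl p₀ y) / inner ℝ p (p₀ : E5)) • (p₀ : E5)

section PerpLift

variable {p₀ : S4} {p : E5}

theorem inner_perpLift (h : inner ℝ p (p₀ : E5) ≠ 0) (y : E4) :
    inner ℝ p (perpLift p₀ p y) = 0 := by
  rw [perpLift, inner_sub_right, inner_smul_right, div_mul_cancel₀ _ h, sub_self]

theorem perpCoord_perpLift (p₀ : S4) (p : E5) (y : E4) : perpCoord p₀ (perpLift p₀ p y) = y := by
  rw [perpLift, map_sub, map_smul, perpCoord_self, smul_zero, sub_zero, perpCoord_perpIncl]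

theorem perpLift_perpCoord (h : inner ℝ p (p₀ : E5) ≠ 0) {ξ : E5} (hξ : inner ℝ p ξ = 0) :
    perpLift p₀ p (perpCoord p₀ ξ) = ξ := by
  rw [perpLift, perpIncl_perpCoord, inner_sub_right, inner_smul_right, hξ, zero_sub, neg_div,
    mul_div_cancel_right₀ _ h, neg_smul, sub_neg_eq_add, sub_add_cancel]

theorem perpLift_smul (p₀ : S4) (p : E5) (r : ℝ) (y : E4) :
    perpLift p₀ p (r • y) = r • perpLift p₀ p y := by
  rw [perpLift, perpLift, map_smul, inner_smul_right, mul_div_assoc, smul_sub, smul_smul]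

theorem perpLift_ne_zero (p₀ : S4) (p : E5) {y : E4} (hy : y ≠ 0) : perpLift p₀ p y ≠ 0 := by
  intro h
  rw [← perpCoord_perpLift p₀ p y, h, map_zero] at hy
  exact hy rfl

theorem contMDiffAt_perpLift {EM HM M : Type*} [NormedAddCommGroup EM] [NormedSpace ℝ EM]
    [TopologicalSpace HM] {I : ModelWithCorners ℝ EM HM} [TopologicalSpace M] [ChartedSpace HM M]
    {f : M → E5} {g : M → E4} {x : M} (hf : ContMDiffAt I 𝓘(ℝ, E5) ∞ f x)
    (hg : ContMDiffAt I 𝓘(ℝ, E4) ∞ g x) (h : inner ℝ (f x) (p₀ : E5) ≠ 0) :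
    ContMDiffAt I 𝓘(ℝ, E5) ∞ (fun m => perpLift p₀ (f m) (g m)) x := by
  have h1 : ContDiff ℝ ∞ (Prod.fst : E5 × E4 → E5) := contDiff_fst
  have h2 : ContDiff ℝ ∞ (fun w : E5 × E4 => perpIncl p₀ w.2) :=
    (perpIncl p₀).contDiff.comp contDiff_snd
  have h3 : ContDiffAt ℝ ∞ (fun w : E5 × E4 => inner ℝ w.1 (perpIncl p₀ w.2) /
      inner ℝ w.1 (p₀ : E5)) (f x, g x) :=
    (h1.inner ℝ h2).contDiffAt.div (h1.inner ℝ contDiff_const).contDiffAt h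
  have h4 : ContDiffAt ℝ ∞ (fun w : E5 × E4 => perpLift p₀ w.1 w.2) (f x, g x) :=
    h2.contDiffAt.sub (h3.smul contDiffAt_const)
  have h5 : ContMDiffAt 𝓘(ℝ, E5 × E4) 𝓘(ℝ, E5) ∞ (fun w : E5 × E4 => perpLift p₀ w.1 w.2)
    (f x, g x) := h4.contMDiffAt
  exact ContMDiffAt.comp (f := fun m => (f m, g m))
    (g := fun w : E5 × E4 => perpLift p₀ w.1 w.2) x h5 (hf.prodMk_space hg)

end PerpLift

/-- The chart `(p, p') ↦ (p, stereographic projection of p' from p)` around `(p₀, -p₀)`, in which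
the antidiagonal is the zero section. The factor `p` is read in the chart of `S⁴` at `p₀`, and
`p^⊥` is identified with `p₀^⊥ = ℝ⁴` by orthogonal projection. -/
def antidiagonalChart (p₀ : S4) :
    PartialDiffeomorph ((𝓡 4).prod (𝓡 4)) 𝓘(ℝ, E4 × E4) (S4 × S4) (E4 × E4) ∞ where
  toFun m := (chartAt E4 p₀ m.1, perpCoord p₀ (stereo m.1 m.2))
  invFun e := ((chartAt E4 p₀).symm e.1,
    stereoInv ((chartAt E4 p₀).symm e.1) (perpLift p₀ ((chartAt E4 p₀).symm e.1) e.2))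
  source := {m | m.1 ∈ (chartAt E4 p₀).source ∧ inner ℝ (m.1 : E5) (p₀ : E5) ≠ 0 ∧ m.2 ≠ m.1}
  target := {e | inner ℝ ((chartAt E4 p₀).symm e.1 : E5) (p₀ : E5) ≠ 0}
  map_source' m h := by
    change inner ℝ ((chartAt E4 p₀).symm (chartAt E4 p₀ m.1) : E5) (p₀ : E5) ≠ 0
    rw [(chartAt E4 p₀).left_inv h.1]
    exact h.2.1
  map_target' e h := ⟨chartAt_symm_mem_source p₀ e.1, h, stereoInv_ne (inner_perpLift h e.2)⟩
  left_inv' m h := by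
    simp only
    rw [(chartAt E4 p₀).left_inv h.1, perpLift_perpCoord h.2.1 (inner_stereo _ _),
      stereoInv_stereo h.2.2]
  right_inv' e h := by
    simp only
    rw [stereo_stereoInv (inner_perpLift h e.2), perpCoord_perpLift, chartAt_chartAt_symm]
  open_source := by
    refine ((chartAt E4 p₀).open_source.preimage continuous_fst).inter (IsOpen.inter ?_ ?_)
    · exact isOpen_ne_fun ((continuous_subtype_val.comp continuous_fst).inner continuous_const)
        continuous_const
    · exact isOpen_ne_fun continuous_snd continuous_fst
  open_target := isOpen_ne_fun ((continuous_subtype_val.comp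
    ((contMDiff_chartAt_symm_S4 p₀).continuous.comp continuous_fst)).inner continuous_const)
      continuous_const
  contMDiffOn_toFun m h := by
    have h1 : ContMDiffAt ((𝓡 4).prod (𝓡 4)) 𝓘(ℝ, E4) ∞
        (fun m : S4 × S4 => chartAt E4 p₀ m.1) m :=
      ContMDiffAt.comp (g := chartAt E4 p₀) m
        (contMDiffOn_chart.contMDiffAt ((chartAt E4 p₀).open_source.mem_nhds h.1)) contMDiffAt_fst
    have h2 : ContMDiffAt ((𝓡 4).prod (𝓡 4)) 𝓘(ℝ, E5) ∞
        (fun m : S4 × S4 => stereo m.1 m.2) m :=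
      contMDiffAt_stereo contMDiffAt_fst contMDiffAt_snd h.2.2
    have h3 : ContMDiffAt ((𝓡 4).prod (𝓡 4)) 𝓘(ℝ, E4) ∞
        (fun m : S4 × S4 => perpCoord p₀ (stereo m.1 m.2)) m :=
      ContMDiffAt.comp (g := perpCoord p₀) m (perpCoord p₀).contMDiff.contMDiffAt h2
    exact (h1.prodMk_space h3).contMDiffWithinAt
  contMDiffOn_invFun e h := by
    have h1 : ContMDiffAt 𝓘(ℝ, E4 × E4) (𝓡 4) ∞
        (fun e : E4 × E4 => (chartAt E4 p₀).symm e.1) e :=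
      ContMDiffAt.comp (g := (chartAt E4 p₀).symm) e
        (contMDiff_chartAt_symm_S4 p₀).contMDiffAt contDiff_fst.contMDiff.contMDiffAt
    have h2 : ContMDiffAt 𝓘(ℝ, E4 × E4) 𝓘(ℝ, E5) ∞
        (fun e : E4 × E4 => perpLift p₀ ((chartAt E4 p₀).symm e.1) e.2) e :=
      contMDiffAt_perpLift (contMDiff_coe_S4.contMDiffAt.comp e h1)
        contDiff_snd.contMDiff.contMDiffAt h
    have h3 := contMDiffAt_stereoInv (w := ((chartAt E4 p₀).symm e.1,
      perpLift p₀ ((chartAt E4 p₀).symm e.1) e.2)) (inner_perpLift h e.2)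
    have h4 : ContMDiffAt 𝓘(ℝ, E4 × E4) (𝓡 4) ∞ (fun e : E4 × E4 =>
        stereoInv ((chartAt E4 p₀).symm e.1) (perpLift p₀ ((chartAt E4 p₀).symm e.1) e.2)) e :=
      ContMDiffAt.comp (f := fun e : E4 × E4 => ((chartAt E4 p₀).symm e.1,
        perpLift p₀ ((chartAt E4 p₀).symm e.1) e.2))
        (g := fun w : S4 × E5 => stereoInv w.1 w.2) e h3 (h1.prodMk h2)
    exact (h1.prodMk h4).contMDiffWithinAt

theorem mem_antidiagonal_iff {p₀ : S4} {m : S4 × S4} (h : m ∈ (antidiagonalChart p₀).source) :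
    m ∈ {m : S4 × S4 | m.2 = -m.1} ↔ (antidiagonalChart p₀ m).2 = 0 := by
  have h1 : (antidiagonalChart p₀ m).2 = 0 ↔ stereo m.1 m.2 = 0 := by
    refine ⟨fun h0 => ?_, fun h0 => (congrArg (perpCoord p₀) h0).trans (map_zero _)⟩
    rw [← perpLift_perpCoord h.2.1 (inner_stereo m.1 m.2)]
    change perpLift p₀ m.1 (antidiagonalChart p₀ m).2 = 0
    rw [h0, ← zero_smul ℝ (0 : E4), perpLift_smul, zero_smul]
  rw [h1]
  constructor
  · intro h0
    rw [show m.2 = stereoInv m.1 0 from h0.trans (stereoInv_zero m.1).symm,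
      stereo_stereoInv (inner_zero_right _)]
  · intro h0
    rw [Set.mem_ofPred_eq, ← stereoInv_stereo h.2.2, h0, stereoInv_zero]

/-- The pair `(p, n)` of the line with the coordinates `(a, t, v)`, which stand for the point
`(a, t v, [v])` of the blow-up of `ℝ⁴ × ℝ⁴` along `ℝ⁴ × 0`. Here `p` is the point with the
coordinate `a`, and `n = t |ξ|² p + ξ` for the vector `ξ ∈ p^⊥` with the coordinate `v`. -/
def blowUpLift (p₀ : S4) (e : E4 × ℝ × E4) : S4 × E5 :=
  ((chartAt E4 p₀).symm e.1,
    (e.2.1 * ‖perpLift p₀ ((chartAt E4 p₀).symm e.1) e.2.2‖ ^ 2) •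
      ((chartAt E4 p₀).symm e.1 : E5) + perpLift p₀ ((chartAt E4 p₀).symm e.1) e.2.2)

/-- The component of `n` orthogonal to `p`. -/
def perpPart (w : S4 × E5) : E5 := w.2 - inner ℝ (w.1 : E5) w.2 • (w.1 : E5)

/-- The coordinates `(a, t, v)` of the real line of `(p, n)`: with `ξ` the component of `n`
orthogonal to `p`, the line through `n` is spanned by `t |ξ|² p + ξ`. -/
def blowUpCoord (p₀ : S4) (w : S4 × E5) : E4 × ℝ × E4 :=
  (chartAt E4 p₀ w.1, inner ℝ (w.1 : E5) w.2 / ‖perpPart w‖ ^ 2, perpCoord p₀ (perpPart w))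

theorem inner_perpPart (w : S4 × E5) : inner ℝ (w.1 : E5) (perpPart w) = 0 := by
  rw [perpPart, inner_sub_right, inner_smul_right, S4.inner_self, mul_one, sub_self]

theorem perpPart_smul (p : S4) (n : E5) (r : ℝ) : perpPart (p, r • n) = r • perpPart (p, n) := by
  rw [perpPart, perpPart, inner_smul_right, smul_sub, smul_smul]

/-- If `n` is a multiple of `p`, the reflection of `p` in `ℝ n` is `p`. -/
theorem perpPart_ne_zero {w : S4 × E5} (hw : w.2 ≠ 0) (h : reflect w ≠ w.1) : perpPart w ≠ 0 := by
  intro h0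
  have h1 : w.2 = inner ℝ (w.1 : E5) w.2 • (w.1 : E5) := sub_eq_zero.1 h0
  have hr : inner ℝ (w.1 : E5) w.2 ≠ 0 := fun hr => hw (by rw [h1, hr, zero_smul])
  refine h ?_
  have h2 : reflect w = reflect (w.1, (w.1 : E5)) := by
    rw [← reflect_smul (w := (w.1, (w.1 : E5))) hr, ← h1]
  rw [h2]
  apply Subtype.ext
  rw [coe_reflect]
  simp only
  rw [S4.inner_self, S4.norm_coe]
  module

theorem blowUpCoord_smul (p₀ p : S4) (n : E5) {r : ℝ} (hr : r ≠ 0) :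
    blowUpCoord p₀ (p, r • n) = ((blowUpCoord p₀ (p, n)).1, r⁻¹ * (blowUpCoord p₀ (p, n)).2.1,
      r • (blowUpCoord p₀ (p, n)).2.2) := by
  refine Prod.ext rfl (Prod.ext ?_ ?_)
  · simp only [blowUpCoord, perpPart_smul, inner_smul_right, norm_smul, mul_pow, Real.norm_eq_abs,
      sq_abs]
    field_simp
  · simp only [blowUpCoord, perpPart_smul, map_smul]

/-- The coordinates `(a, t, v)` with `v ≠ 0` and with `(a, t v)` in the range of the chart. -/
def blowUpDomain (p₀ : S4) : Set (E4 × ℝ × E4) :=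
  {e | e.2.2 ≠ 0 ∧ (e.1, e.2.1 • e.2.2) ∈ (antidiagonalChart p₀).target}

/-- The real lines over the domain of the chart. -/
def blowUpImage (p₀ : S4) : Set RealLine :=
  (fun l => (proj₁ l, proj₂ l)) ⁻¹' (antidiagonalChart p₀).source

section BlowUp

variable {p₀ : S4} {e : E4 × ℝ × E4}

theorem perpPart_blowUpLift (he : e ∈ blowUpDomain p₀) :
    perpPart (blowUpLift p₀ e) = perpLift p₀ ((chartAt E4 p₀).symm e.1) e.2.2 := by
  have h := inner_perpLift (p := (chartAt E4 p₀).symm e.1) he.2 e.2.2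
  rw [perpPart, blowUpLift]
  simp only
  rw [inner_add_right, inner_smul_right, S4.inner_self, h]
  module

theorem blowUpCoord_blowUpLift (he : e ∈ blowUpDomain p₀) :
    blowUpCoord p₀ (blowUpLift p₀ e) = e := by
  have h := inner_perpLift (p := (chartAt E4 p₀).symm e.1) he.2 e.2.2
  have h0 := norm_ne_zero_iff.2 (perpLift_ne_zero p₀ ((chartAt E4 p₀).symm e.1) he.1)
  refine Prod.ext (chartAt_chartAt_symm p₀ e.1) (Prod.ext ?_ ?_)
  · simp only [blowUpCoord]
    rw [perpPart_blowUpLift he, blowUpLift]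
    simp only
    rw [inner_add_right, inner_smul_right, S4.inner_self, h]
    field_simp
    ring
  · simp only [blowUpCoord]
    rw [perpPart_blowUpLift he, perpCoord_perpLift]

theorem blowUpLift_ne_zero (he : e ∈ blowUpDomain p₀) : (blowUpLift p₀ e).2 ≠ 0 := by
  intro h
  have h1 := perpPart_blowUpLift he
  rw [perpPart, h, inner_zero_right, zero_smul, sub_zero] at h1
  exact perpLift_ne_zero p₀ _ he.1 h1.symm

theorem reflect_blowUpLift (he : e ∈ blowUpDomain p₀) :
    reflect (blowUpLift p₀ e) = stereoInv ((chartAt E4 p₀).symm e.1)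
      (perpLift p₀ ((chartAt E4 p₀).symm e.1) (e.2.1 • e.2.2)) := by
  rw [perpLift_smul]
  exact reflect_eq_stereoInv (inner_perpLift he.2 e.2.2) (perpLift_ne_zero p₀ _ he.1) e.2.1

theorem proj_lineMap_blowUpLift (he : e ∈ blowUpDomain p₀) :
    (proj₁ (lineMap (blowUpLift p₀ e)), proj₂ (lineMap (blowUpLift p₀ e))) =
      (antidiagonalChart p₀).invFun (e.1, e.2.1 • e.2.2) := by
  rw [proj₁_lineMap (blowUpLift_ne_zero he), proj₂_lineMap (blowUpLift_ne_zero he),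
    reflect_blowUpLift he]
  rfl

theorem mem_blowUpImage_iff {w : S4 × E5} (hw : w.2 ≠ 0) : lineMap w ∈ blowUpImage p₀ ↔
    w.1 ∈ (chartAt E4 p₀).source ∧ inner ℝ (w.1 : E5) (p₀ : E5) ≠ 0 ∧ reflect w ≠ w.1 := by
  change (proj₁ (lineMap w), proj₂ (lineMap w)) ∈ (antidiagonalChart p₀).source ↔ _
  rw [proj₁_lineMap hw, proj₂_lineMap hw]
  rfl

theorem blowUpCoord_mem {w : S4 × E5} (hw : w.2 ≠ 0) (h : lineMap w ∈ blowUpImage p₀) :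
    blowUpCoord p₀ w ∈ blowUpDomain p₀ ∧ blowUpLift p₀ (blowUpCoord p₀ w) = w := by
  rw [mem_blowUpImage_iff hw] at h
  have hξ := perpPart_ne_zero hw h.2.2
  have h1 := perpLift_perpCoord h.2.1 (inner_perpPart w)
  refine ⟨⟨fun h0 => hξ ?_, ?_⟩, ?_⟩
  · change perpCoord p₀ (perpPart w) = 0 at h0
    rw [← h1, h0, ← zero_smul ℝ (0 : E4), perpLift_smul, zero_smul]
  · change inner ℝ ((chartAt E4 p₀).symm (chartAt E4 p₀ w.1) : E5) (p₀ : E5) ≠ 0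
    rw [(chartAt E4 p₀).left_inv h.1]
    exact h.2.1
  · simp only [blowUpLift, blowUpCoord]
    rw [(chartAt E4 p₀).left_inv h.1, h1,
      div_mul_cancel₀ _ (pow_ne_zero 2 (norm_ne_zero_iff.2 hξ)), perpPart, add_sub_cancel]

theorem contMDiffAt_blowUpLift (he : e ∈ blowUpDomain p₀) :
    ContMDiffAt 𝓘(ℝ, E4 × ℝ × E4) ((𝓡 4).prod 𝓘(ℝ, E5)) ∞ (blowUpLift p₀) e := by
  have h1 : ContMDiffAt 𝓘(ℝ, E4 × ℝ × E4) (𝓡 4) ∞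
      (fun e : E4 × ℝ × E4 => (chartAt E4 p₀).symm e.1) e :=
    ContMDiffAt.comp (g := (chartAt E4 p₀).symm) e
      (contMDiff_chartAt_symm_S4 p₀).contMDiffAt contDiff_fst.contMDiff.contMDiffAt
  have h1' : ContMDiffAt 𝓘(ℝ, E4 × ℝ × E4) 𝓘(ℝ, E5) ∞
      (fun e : E4 × ℝ × E4 => ((chartAt E4 p₀).symm e.1 : E5)) e :=
    contMDiff_coe_S4.contMDiffAt.comp e h1
  have h2 : ContMDiffAt 𝓘(ℝ, E4 × ℝ × E4) 𝓘(ℝ, E5) ∞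
      (fun e : E4 × ℝ × E4 => perpLift p₀ ((chartAt E4 p₀).symm e.1) e.2.2) e :=
    contMDiffAt_perpLift h1' (contDiff_snd.comp contDiff_snd).contMDiff.contMDiffAt he.2
  have h3 : ContMDiffAt 𝓘(ℝ, E4 × ℝ × E4) 𝓘(ℝ, ℝ) ∞
      (fun e : E4 × ℝ × E4 => ‖perpLift p₀ ((chartAt E4 p₀).symm e.1) e.2.2‖ ^ 2) e :=
    (contDiff_norm_sq ℝ).contMDiff.contMDiffAt.comp e h2
  have h4 : ContMDiffAt 𝓘(ℝ, E4 × ℝ × E4) 𝓘(ℝ, ℝ) ∞ (fun e : E4 × ℝ × E4 => e.2.1) e :=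
    (contDiff_fst.comp contDiff_snd).contMDiff.contMDiffAt
  exact h1.prodMk (((h4.mul h3).smul h1').add h2)

theorem contMDiffAt_blowUpCoord {w : S4 × E5} (hw : w.2 ≠ 0) (h : lineMap w ∈ blowUpImage p₀) :
    ContMDiffAt ((𝓡 4).prod 𝓘(ℝ, E5)) 𝓘(ℝ, E4 × ℝ × E4) ∞ (blowUpCoord p₀) w := by
  rw [mem_blowUpImage_iff hw] at h
  have hξ := pow_ne_zero 2 (norm_ne_zero_iff.2 (perpPart_ne_zero hw h.2.2))
  have h1 : ContMDiffAt ((𝓡 4).prod 𝓘(ℝ, E5)) 𝓘(ℝ, E4) ∞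
      (fun w : S4 × E5 => chartAt E4 p₀ w.1) w :=
    ContMDiffAt.comp (g := chartAt E4 p₀) w
      (contMDiffOn_chart.contMDiffAt ((chartAt E4 p₀).open_source.mem_nhds h.1)) contMDiffAt_fst
  have h2 : ContDiff ℝ ∞ (fun w : E5 × E5 => inner ℝ w.1 w.2) :=
    (contDiff_fst (𝕜 := ℝ)).inner ℝ contDiff_snd
  have h3 : ContDiff ℝ ∞ (fun w : E5 × E5 => w.2 - inner ℝ w.1 w.2 • w.1) :=
    contDiff_snd.sub (h2.smul contDiff_fst)
  have h4 : ContDiffAt ℝ ∞ (fun w : E5 × E5 => inner ℝ w.1 w.2 /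
      ‖w.2 - inner ℝ w.1 w.2 • w.1‖ ^ 2) ((w.1 : E5), w.2) :=
    h2.contDiffAt.div (h3.norm_sq ℝ).contDiffAt hξ
  have h5 : ContMDiffAt 𝓘(ℝ, E5 × E5) 𝓘(ℝ, ℝ × E4) ∞ (fun w : E5 × E5 => (inner ℝ w.1 w.2 /
      ‖w.2 - inner ℝ w.1 w.2 • w.1‖ ^ 2, perpCoord p₀ (w.2 - inner ℝ w.1 w.2 • w.1)))
      ((w.1 : E5), w.2) :=
    (h4.prodMk ((perpCoord p₀).contDiff.comp h3).contDiffAt).contMDiffAt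
  have h6 := ContMDiffAt.comp (f := fun w : S4 × E5 => ((w.1 : E5), w.2)) w h5
    contMDiff_coe_prod.contMDiffAt
  exact h1.prodMk_space h6

theorem isSubmersionOnto_blowUpLift (p₀ : S4) :
    IsSubmersionOnto 𝓘(ℝ, E4 × ℝ × E4) (𝓡 8) (blowUpDomain p₀) (blowUpImage p₀)
      (fun e => lineMap (blowUpLift p₀ e)) := by
  have hT : ∀ e ∈ blowUpDomain p₀, lineMap (blowUpLift p₀ e) ∈ blowUpImage p₀ := by
    intro e he
    change (proj₁ (lineMap _), proj₂ (lineMap _)) ∈ (antidiagonalChart p₀).source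
    rw [proj_lineMap_blowUpLift he]
    exact (antidiagonalChart p₀).map_target' he.2
  refine isSubmersionOnto_of_lift (blowUpLift p₀)
    (fun e he => (contMDiffAt_blowUpLift he).contMDiffWithinAt)
    (fun e he => blowUpLift_ne_zero he) (fun _ => rfl) hT ?_ ?_
  · intro w hw h
    exact ⟨_, (blowUpCoord_mem hw h).1, by rw [(blowUpCoord_mem hw h).2]⟩
  · intro e he
    refine ⟨Set.univ, blowUpCoord p₀, isOpen_univ, trivial, ?_, blowUpCoord_blowUpLift he, ?_⟩
    · rintro w ⟨-, hw, h⟩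
      exact (contMDiffAt_blowUpCoord hw h).contMDiffWithinAt
    · intro w _ hw h
      exact ⟨(blowUpCoord_mem hw h).1, by rw [(blowUpCoord_mem hw h).2]⟩

theorem lineMap_blowUpLift_eq_iff {e' : E4 × ℝ × E4} (he : e ∈ blowUpDomain p₀)
    (he' : e' ∈ blowUpDomain p₀) : lineMap (blowUpLift p₀ e) = lineMap (blowUpLift p₀ e') ↔
      e.1 = e'.1 ∧ ∃ s : ℝ, s ≠ 0 ∧ e'.2.2 = s • e.2.2 ∧ e.2.1 = s * e'.2.1 := by
  rw [lineMap_eq_iff (blowUpLift_ne_zero he) (blowUpLift_ne_zero he')]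
  constructor
  · rintro ⟨h1, r, hr, h2⟩
    have h3 : e' = (e.1, r⁻¹ * e.2.1, r • e.2.2) := by
      have h4 := blowUpCoord_smul p₀ (blowUpLift p₀ e).1 (blowUpLift p₀ e).2 hr
      rw [blowUpCoord_blowUpLift he] at h4
      rw [← h4, ← blowUpCoord_blowUpLift he', h1, ← h2]
    rw [h3]
    exact ⟨rfl, r, hr, rfl, (mul_inv_cancel_left₀ hr _).symm⟩
  · rintro ⟨h1, s, hs, h2, h3⟩
    refine ⟨congrArg (chartAt E4 p₀).symm h1, s, hs, ?_⟩
    simp only [blowUpLift]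
    rw [← h1, h2, h3, perpLift_smul, norm_smul, Real.norm_eq_abs, mul_pow, sq_abs]
    module

end BlowUp

theorem isRealBlowUp_proj : IsRealBlowUp ((𝓡 4).prod (𝓡 4)) (𝓡 8) 4 4
    (fun l => (proj₁ l, proj₂ l)) {m : S4 × S4 | m.2 = -m.1} := by
  refine ⟨contMDiff_proj₁.prodMk contMDiff_proj₂, complDiffeo.toPartialEquiv.bijOn,
    fun l hl => ⟨complDiffeo, hl, fun _ _ => rfl⟩, ?_⟩
  rintro ⟨p₀, p'⟩ h
  obtain rfl : p' = -p₀ := h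
  refine ⟨antidiagonalChart p₀, ⟨mem_chart_source E4 p₀, ?_, ?_⟩,
    fun m hm => mem_antidiagonal_iff hm, fun e => lineMap (blowUpLift p₀ e),
    isSubmersionOnto_blowUpLift p₀, ?_, fun e e' => lineMap_blowUpLift_eq_iff e.2 e'.2⟩
  · rw [S4.inner_self]; exact one_ne_zero
  · rw [← stereoInv_zero]
    exact stereoInv_ne (inner_zero_right _)
  · intro e
    change antidiagonalChart p₀ (proj₁ (lineMap (blowUpLift p₀ e)),
      proj₂ (lineMap (blowUpLift p₀ e))) = _
    rw [proj_lineMap_blowUpLift e.2]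
    exact (antidiagonalChart p₀).right_inv' e.2.2

/-! ### The normal bundle of a real line -/

section NormalBundle

variable {A C : (Fin 2 → ℂ) →ₗ[ℂ] C4}

theorem mem_coneTangentQuadric {u : Fin 2 → ℂ} {v : C4 × C4} :
    v ∈ coneTangentQuadric A C u ↔ v.1 ⬝ᵥ C u + A u ⬝ᵥ v.2 = 0 := Iff.rfl

theorem mem_coneTangentLine {u : Fin 2 → ℂ} {v : C4 × C4} : v ∈ coneTangentLine A C u ↔
    ∃ (u' : Fin 2 → ℂ) (a b : ℂ), v = (A u' + a • A u, C u' + b • C u) := by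
  rw [coneTangentLine, Submodule.mem_sup]
  simp only [LinearMap.mem_range, Submodule.mem_span_pair]
  constructor
  · rintro ⟨_, ⟨u', rfl⟩, _, ⟨a, b, rfl⟩, rfl⟩
    exact ⟨u', a, b, by simp⟩
  · rintro ⟨u', a, b, rfl⟩
    exact ⟨_, ⟨u', rfl⟩, _, ⟨a, b, rfl⟩, by simp⟩

theorem exists_wedge_eq {u : Fin 2 → ℂ} (hu : u ≠ 0) (c : ℂ) :
    ∃ u' : Fin 2 → ℂ, u' 0 * u 1 - u' 1 * u 0 = c := by
  by_cases h0 : u 0 = 0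
  · have h1 : u 1 ≠ 0 := fun h1 => hu (by ext i; fin_cases i <;> assumption)
    exact ⟨![c / u 1, 0], by simp [h1]⟩
  · exact ⟨![0, -c / u 0], by simp [h0]⟩

theorem exists_smul_of_wedge_eq_zero {u u' : Fin 2 → ℂ} (hu : u ≠ 0)
    (h : u' 0 * u 1 - u' 1 * u 0 = 0) : ∃ b : ℂ, u' = b • u := by
  by_cases h0 : u 0 = 0
  · have h1 : u 1 ≠ 0 := fun h1 => hu (by ext i; fin_cases i <;> assumption)
    have h2 : u' 0 = 0 := by simpa [h0, h1] using h
    refine ⟨u' 1 / u 1, ?_⟩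
    ext i; fin_cases i
    · simp [h0, h2]
    · simp [h1]
  · refine ⟨u' 0 / u 0, ?_⟩
    ext i; fin_cases i
    · simp [h0]
    · simp only [Fin.mk_one, Pi.smul_apply, smul_eq_mul]
      field_simp
      linear_combination -h

/-- If `range A` and `range C` are paired nondegenerately, the normal bundle is trivialized, up to
the twist by `O(1)`, by the constant quotient `ℂ⁴ / range A ⊕ ℂ⁴ / range C`. -/
theorem normalBundleIso_of_dotProduct_eq (hA : Function.Injective A) (hC : Function.Injective C)
    {κ : ℂ} (hκ : κ ≠ 0) (h : ∀ u u', A u ⬝ᵥ C u' = κ * (u 0 * u' 1 - u 1 * u' 0)) :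
    NormalBundleIso A C (fun _ => 1) := by
  have hd : Module.finrank ℂ ((C4 × C4) ⧸ (A.prodMap C).range) = 4 := by
    have h1 := (A.prodMap C).range.finrank_quotient_add_finrank
    rw [LinearMap.finrank_range_of_inj (hA.prodMap hC)] at h1
    simp at h1
    omega
  let e : ((C4 × C4) ⧸ (A.prodMap C).range) ≃ₗ[ℂ] (Fin 4 → ℂ) :=
    LinearEquiv.ofFinrankEq _ _ (by rw [hd]; simp)
  let P : C4 × C4 →ₗ[ℂ] (Fin 4 → ℂ) := e.toLinearMap.comp (A.prodMap C).range.mkQ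
  have hP : ∀ v, P v = 0 ↔ ∃ u' u'', v = (A u', C u'') := fun v => by
    change e (Submodule.Quotient.mk v) = 0 ↔ _
    rw [e.map_eq_zero_iff, Submodule.Quotient.mk_eq_zero, LinearMap.mem_range]
    constructor
    · rintro ⟨⟨u', u''⟩, rfl⟩
      exact ⟨u', u'', rfl⟩
    · rintro ⟨u', u'', rfl⟩
      exact ⟨(u', u''), rfl⟩
  have hPs : Function.Surjective P := e.surjective.comp (Submodule.mkQ_surjective _)
  have hle : ∀ u, (coneTangentLine A C u).submoduleOf (coneTangentQuadric A C u) ≤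
      (P.comp (coneTangentQuadric A C u).subtype).ker := by
    rintro u ⟨v, hv⟩ hv'
    obtain ⟨u', a, b, rfl⟩ := mem_coneTangentLine.1 hv'
    exact (hP _).2 ⟨u' + a • u, u' + b • u, by simp⟩
  refine ⟨fun u => Submodule.liftQ _ (P.comp (coneTangentQuadric A C u).subtype) (hle u),
    ?_, ?_, ?_⟩
  · intro u hu
    constructor
    · rw [← LinearMap.ker_eq_bot, Submodule.ker_liftQ_eq_bot']
      refine le_antisymm (hle u) ?_
      rintro ⟨v, hv⟩ hv'
      obtain ⟨u', u'', rfl⟩ := (hP v).1 hv'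
      rw [mem_coneTangentQuadric, h, h, ← mul_add, mul_eq_zero, or_iff_right hκ] at hv
      obtain ⟨b, hb⟩ := exists_smul_of_wedge_eq_zero (u' := u'' - u') hu (by
        simp only [Pi.sub_apply]; linear_combination -hv)
      refine mem_coneTangentLine.2 ⟨u', 0, b, ?_⟩
      rw [zero_smul, add_zero, ← map_smul, ← map_add, ← hb, add_sub_cancel]
      rfl
    · intro z
      obtain ⟨v, rfl⟩ := hPs z
      -- a vector of `range A` can be added to `v.1` to make `v` tangent to the quadric
      obtain ⟨u', hu'⟩ := exists_wedge_eq hu (-κ⁻¹ * (v.1 ⬝ᵥ C u + A u ⬝ᵥ v.2))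
      refine ⟨Submodule.Quotient.mk ⟨(v.1 + A u', v.2), ?_⟩, ?_⟩
      · rw [mem_coneTangentQuadric, add_dotProduct, h, hu']
        field_simp
        ring
      · change P (v.1 + A u', v.2) = P v
        have h0 : P (A u', 0) = 0 := (hP _).2 ⟨u', 0, by simp⟩
        rw [← add_zero (P v), ← h0, ← map_add, Prod.add_def, add_zero]
  · intro c u _ _ v hv hcv i
    change P (c • v) i = c ^ (1 : ℤ) * P v i
    rw [map_smul, zpow_one]
    rfl
  · intro u₀ _
    exact ⟨fun _ => P.toContinuousLinearMap, analyticAt_const,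
      Filter.Eventually.of_forall fun u v hv => rfl⟩

/-- If `range A` and `range C` are orthogonal, the constant vector `(A e₁, 0)` is a section of
`N(-1)` that vanishes at `e₁` but not everywhere, which is impossible for a trivial bundle. -/
theorem not_normalBundleIso_of_dotProduct_eq_zero (hA : Function.Injective A)
    (hC : Function.Injective C) (h : ∀ u u', A u ⬝ᵥ C u' = 0) :
    ¬ NormalBundleIso A C (fun _ => 1) := by
  rintro ⟨Φ, hΦ, hc, ha⟩
  set e₁ : Fin 2 → ℂ := ![1, 0] with he₁
  set e₂ : Fin 2 → ℂ := ![0, 1] with he₂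
  have hv : ∀ u, ((A e₁, 0) : C4 × C4) ∈ coneTangentQuadric A C u := fun u => by
    rw [mem_coneTangentQuadric, h, dotProduct_zero, add_zero]
  let f : (Fin 2 → ℂ) → (Fin 4 → ℂ) := fun u => Φ u (Submodule.Quotient.mk ⟨(A e₁, 0), hv u⟩)
  have hf0 : ∀ u, u ≠ 0 → (f u = 0 ↔ ((A e₁, 0) : C4 × C4) ∈ coneTangentLine A C u) := by
    intro u hu
    refine (map_eq_zero_iff (Φ u) (hΦ u hu).1).trans ?_
    rw [Submodule.Quotient.mk_eq_zero]
    rfl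
  have hfs : ∀ (c : ℂ) u, c ≠ 0 → u ≠ 0 → f (c • u) = f u := by
    intro c u hc0 hu
    ext i
    have h1 := hc c u hc0 hu (A e₁, 0) (hv u) ((coneTangentQuadric A C (c • u)).smul_mem c (hv _)) i
    have h2 : Φ (c • u) (Submodule.Quotient.mk ⟨c • ((A e₁, 0) : C4 × C4),
        (coneTangentQuadric A C (c • u)).smul_mem c (hv _)⟩) = c • f (c • u) :=
      (Φ (c • u)).map_smul c (Submodule.Quotient.mk ⟨(A e₁, 0), hv (c • u)⟩)
    rw [h2, zpow_one] at h1
    exact mul_left_cancel₀ hc0 h1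
  have hfa : ∀ u, u ≠ 0 → AnalyticAt ℂ f u := by
    intro u hu
    obtain ⟨Ψ, hΨ, he⟩ := ha u hu
    have h1 : AnalyticAt ℂ (fun u => Ψ u (A e₁, 0)) u :=
      ((ContinuousLinearMap.apply ℂ (Fin 4 → ℂ) ((A e₁, 0) : C4 × C4)).analyticAt _).comp hΨ
    refine h1.congr ?_
    filter_upwards [he] with u' hu'
    exact (hu' _ (hv u')).symm
  have he₁0 : e₁ ≠ 0 := fun h0 => one_ne_zero (congrFun h0 0)
  have hline : ∀ t : ℂ, e₂ + t • e₁ ≠ 0 := fun t h0 => by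
    simpa [he₁, he₂] using congrFun h0 1
  have hg : Differentiable ℂ fun t : ℂ => f (e₂ + t • e₁) := fun t =>
    DifferentiableAt.comp (g := f) t (hfa _ (hline t)).differentiableAt (by fun_prop)
  -- `f` is homogeneous of degree `0`, so that `f (e₂ + t e₁) = f (e₁ + t⁻¹ e₂)`
  have hlim : Filter.Tendsto (fun t : ℂ => f (e₂ + t • e₁)) (Filter.cocompact ℂ) (𝓝 0) := by
    have h1 : f e₁ = 0 := (hf0 e₁ he₁0).2 (mem_coneTangentLine.2 ⟨0, 1, 0, by simp⟩)
    have h2 : Filter.Tendsto (fun t : ℂ => e₁ + t⁻¹ • e₂) (Filter.cocompact ℂ) (𝓝 e₁) := by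
      have h3 := ((Filter.tendsto_inv₀_cobounded (α := ℂ)).smul_const e₂).const_add e₁
      rwa [zero_smul, add_zero, Metric.cobounded_eq_cocompact] at h3
    have h3 := (hfa e₁ he₁0).continuousAt.tendsto.comp h2
    rw [h1] at h3
    refine h3.congr' ?_
    have h4 : ∀ᶠ t : ℂ in Filter.cocompact ℂ, t ≠ 0 :=
      (isCompact_singleton (x := (0 : ℂ))).compl_mem_cocompact
    filter_upwards [h4] with t ht
    rw [Function.comp_apply, ← hfs t⁻¹ (e₂ + t • e₁) (inv_ne_zero ht) (hline t), smul_add,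
      inv_smul_smul₀ ht, add_comm]
  -- Liouville's theorem
  have h0 : f e₂ = 0 := by
    simpa using hg.apply_eq_of_tendsto_cocompact 0 hlim
  have he₂0 : e₂ ≠ 0 := by simpa using hline 0
  obtain ⟨u', a, b, h1⟩ := mem_coneTangentLine.1 ((hf0 e₂ he₂0).1 h0)
  obtain ⟨h2, h3⟩ := Prod.mk.inj h1
  have h4 : u' + b • e₂ = 0 := hC (by rw [map_add, map_smul, ← h3, map_zero])
  have h5 : e₁ = u' + a • e₂ := hA (by rw [map_add, map_smul, h2])
  rw [eq_neg_of_add_eq_zero_left h4] at h5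
  simpa [he₁, he₂] using congrFun h5 0

end NormalBundle

theorem sigma_dot_sigma (x y : C4) : sigma x ⬝ᵥ sigma y = star (x ⬝ᵥ y) := by
  simp [dotProduct, Fin.sum_univ_four, sigma]
  ring

/-- The two pencils of the line of `(p, n)` are paired by this number, times the wedge product on
`ℂ²`. -/
theorem dot_sigma_symp_clifford_eq {p n : E5} {x : C4} (hx : x ≠ 0) (h : clifford p x = x) :
    x ⬝ᵥ sigma (symp (clifford n x)) = -((normSq4 x * inner ℝ n p : ℝ) : ℂ) := by
  rw [← star_symp, symp_symp, star_neg, dotProduct_neg, neg_inj, ← hopf_eq_of_clifford_eq hx h]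
  rw [dotProduct_comm, clifford_symm, star_dot_clifford]

theorem clifford_dot_symp (p : E5) (x y : C4) :
    clifford p x ⬝ᵥ symp y = x ⬝ᵥ symp (clifford p y) := by
  simp [clifford, symp, dotProduct, Fin.sum_univ_four]
  ring

/-- If `⟨p, n⟩ = 0`, Clifford multiplication by `n` exchanges the eigenspaces of Clifford
multiplication by `p`, and these are orthogonal to each other for the symplectic form. -/
theorem dot_symp_clifford_eq_zero {p n : E5} (hpn : inner ℝ p n = 0) {a b : C4}
    (ha : clifford p a = a) (hb : clifford p b = b) : a ⬝ᵥ symp (clifford n b) = 0 := by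
  have h1 := clifford_clifford p n b
  rw [hpn, hb, mul_zero, Complex.ofReal_zero, zero_smul, add_eq_zero_iff_eq_neg] at h1
  have h2 := clifford_dot_symp p a (clifford n b)
  rw [ha, h1, map_neg, dotProduct_neg] at h2
  exact self_eq_neg.1 h2

/-- The line of `(p, n)` has normal bundle `O(1)⁴` if and only if `n` is not tangent to `S⁴` at `p`.
For the negative part all parametrizations of the line have to be considered; their values are
described by `mk_mem_lineCarrier`. -/
theorem mem_generalLines_iff {w : S4 × E5} (hw : w.2 ≠ 0) :
    lineMap w ∈ generalLines ↔ inner ℝ (w.1 : E5) w.2 ≠ 0 := by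
  rw [lineMap_of_ne hw]
  constructor
  · rintro ⟨A, C, hA, hC, hl, hN⟩ hpn
    refine not_normalBundleIso_of_dotProduct_eq_zero hA hC ?_ hN
    have H : ∀ u, clifford w.1 (A u) = A u ∧ ∃ c : ℂ, c • symp (clifford w.2 (A u)) = C u := by
      intro u
      rcases eq_or_ne u 0 with rfl | hu
      · simp
      have h1 : A u ≠ 0 := fun h => hu (hA (by rw [h, map_zero]))
      have h2 : C u ≠ 0 := fun h => hu (hC (by rw [h, map_zero]))
      rw [← mk_mem_lineCarrier hw h1 h2]
      change _ ∈ (lineOf w.1 w.2 hw).carrier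
      rw [hl]
      exact ⟨u, h1, h2, rfl⟩
    intro u u'
    obtain ⟨c, hc⟩ := (H u').2
    rw [← hc, dotProduct_smul, dot_symp_clifford_eq_zero hpn (H u).1 (H u').1, smul_zero]
  · intro hpn
    obtain ⟨x, hx, h⟩ := exists_clifford_eq (S4.norm_coe w.1)
    have hy := symp_clifford_ne_zero hw hx
    refine ⟨realPencil x, realPencil (symp (clifford w.2 x)), realPencil_injective hx,
      realPencil_injective hy, (lineSet_realPencil hx h).symm, ?_⟩
    have hp := symp_clifford_mem_realParams hw hx
    have hκ : x ⬝ᵥ sigma (symp (clifford w.2 x)) ≠ 0 := by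
      rw [dot_sigma_symp_clifford_eq hx h, real_inner_comm]
      exact_mod_cast neg_ne_zero.2 (mul_ne_zero (normSq4_pos hx).ne' hpn)
    refine normalBundleIso_of_dotProduct_eq (realPencil_injective hx) (realPencil_injective hy)
      hκ ?_
    intro u u'
    have h1 := hp.2.2.1
    have h2 := hp.2.2.2
    have h3 := sigma_dot_sigma x (symp (clifford w.2 x))
    rw [h1, star_zero] at h3
    simp only [realPencil_apply, add_dotProduct, dotProduct_add, smul_dotProduct, dotProduct_smul,
      smul_eq_mul]
    linear_combination u' 0 * u 0 * h1 + u 1 * u' 1 * h3 + u 1 * u' 0 * h2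

theorem specialLines_eq : specialLines = {l | proj₂ l = -proj₁ l} := by
  ext l
  obtain ⟨w, hw, rfl⟩ := exists_lineMap l
  change lineMap w ∉ generalLines ↔ proj₂ (lineMap w) = -proj₁ (lineMap w)
  rw [mem_generalLines_iff hw, proj₁_lineMap hw, proj₂_lineMap hw, reflect_eq_neg_iff hw, not_not]

end TwistorLines

end

theorem mainTheorem5 :
    -- `X` is a smooth manifold of dimension 8, and the parametrization of the real lines
    -- `ζ ↦ ([x + ζ σ(x)],[y + ζ σ(y)])` is a surjective submersion onto it
    ∃ (_ : TopologicalSpace TwistorLines.RealLine)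
      (_ : ChartedSpace (EuclideanSpace ℝ (Fin 8)) TwistorLines.RealLine),
      IsManifold (𝓡 8) ∞ TwistorLines.RealLine ∧
      T2Space TwistorLines.RealLine ∧ SecondCountableTopology TwistorLines.RealLine ∧
      (∃ q : TwistorLines.realParams → TwistorLines.RealLine,
        (∀ p, (q p).carrier = TwistorLines.lineSet (TwistorLines.realPencil p.1.1)
          (TwistorLines.realPencil p.1.2)) ∧
        TwistorLines.IsSubmersionOnto 𝓘(ℝ, TwistorLines.C4 × TwistorLines.C4) (𝓡 8)
          TwistorLines.realParams Set.univ q) ∧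
      -- the two projections `X → S⁴` induced by the two projections `Q → P³`
      ∃ pr₁ pr₂ : TwistorLines.RealLine → TwistorLines.S4,
        (∀ (l : TwistorLines.RealLine) (x y : TwistorLines.C4) (hx : x ≠ 0) (hy : y ≠ 0),
          (Projectivization.mk ℂ x hx, Projectivization.mk ℂ y hy) ∈ l.carrier →
            (pr₁ l : EuclideanSpace ℝ (Fin 5)) = TwistorLines.hopf x ∧
            (pr₂ l : EuclideanSpace ℝ (Fin 5)) = TwistorLines.hopf (star y)) ∧
        -- (i)
        TwistorLines.IsRealBlowUp ((𝓡 4).prod (𝓡 4)) (𝓡 8) 4 4 (fun l => (pr₁ l, pr₂ l))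
          {p : TwistorLines.S4 × TwistorLines.S4 | p.2 = -p.1} ∧
        TwistorLines.specialLines = {l | pr₂ l = -pr₁ l} ∧
        (∃ f : TwistorLines.ProjBundle TwistorLines.CotangentS4 → TwistorLines.RealLine,
          TwistorLines.IsProjBundleDiffeo (F := EuclideanSpace ℝ (Fin 4) →L[ℝ] ℝ) (𝓡 4)
            TwistorLines.CotangentS4 (𝓡 8) TwistorLines.specialLines f ∧
          ∀ ξ, pr₁ (f ξ) = ξ.1) ∧
        -- (ii)
        ∀ pr ∈ ({pr₁, pr₂} : Set (TwistorLines.RealLine → TwistorLines.S4)),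
          TwistorLines.IsRealProjectiveSpaceBundle (𝓡 4) (𝓡 8) 4 pr ∧
          ∃ f : TwistorLines.ProjBundle TwistorLines.CotangentSumS4 → TwistorLines.RealLine,
            TwistorLines.IsProjBundleDiffeo (F := (EuclideanSpace ℝ (Fin 4) →L[ℝ] ℝ) × ℝ) (𝓡 4)
              TwistorLines.CotangentSumS4 (𝓡 8) Set.univ f ∧
            ∀ ξ, pr (f ξ) = ξ.1 := by
  refine ⟨inferInstance, inferInstance, inferInstance, inferInstance, inferInstance,
    ⟨TwistorLines.paramLine, TwistorLines.paramLine_carrier,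
      TwistorLines.isSubmersionOnto_paramLine⟩,
    TwistorLines.proj₁, TwistorLines.proj₂, TwistorLines.proj_eq_hopf,
    TwistorLines.isRealBlowUp_proj, TwistorLines.specialLines_eq, ?_, ?_⟩
  · rw [TwistorLines.specialLines_eq]
    exact TwistorLines.exists_projBundleDiffeo_antidiagonal
  · rintro pr (rfl | rfl)
    · exact ⟨TwistorLines.isRealProjectiveSpaceBundle_proj₁,
        TwistorLines.exists_projBundleDiffeo_proj₁⟩
    · exact ⟨TwistorLines.isRealProjectiveSpaceBundle_proj₂,
        TwistorLines.exists_projBundleDiffeo_proj₂⟩
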